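/- **Setting.** Let $G\subset GL_n(\mathbb R)$ be a closed subgroup with Lie algebra $\mathfrak g$. A *$G$-structure with connection* $(P,\theta,\omega)$ is a smooth manifold $P$ of dimension $n+\dim G$ with a smooth, proper, effective, locally free right $G$-action (for instance a free one, and then $M=P/G$ is a manifold; in general $M$ is an effective orbifold), a pointwise surjective $\theta\in\Omega^1(P,\mathbb R^n)$ that vanishes on the infinitesimal generators $\tilde\alpha$ of the action and satisfies $g^*\theta=g^{-1}\cdot\theta$, and $\omega\in\Omega^1(P,\mathfrak g)$ with $\omega(\tilde\alpha)=\alpha$ for $\alpha\in\mathfrak g$ and $g^*\omega=\mathrm{Ad}_{g^{-1}}\circ\omega$. Then $(\theta,\omega)_p:T_pP\to\mathbb R^n\oplus\mathfrak g$ is an isomorphism for every $p$. A *local equivalence* is a $G$-equivariant diffeomorphism between $G$-saturated open subsets of $P$ that preserves $\theta$ and $\omega$. **Classifying algebroid.** Let $X=P/{\sim}$, where $p\sim q$ if some local equivalence maps $p$ to $q$, let $h:P\to X$ be the projection, and let $C^\infty(X)$ be the algebra of functions $f:X\to\mathbb R$ with $f\circ h$ smooth and $\mathfrak X(X)=\mathrm{Der}(C^\infty(X))$.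 The sections of $A=X\times(\mathbb R^n\oplus\mathfrak g)$ are the maps $s:X\to\mathbb R^n\oplus\mathfrak g$ with $s\circ h$ smooth, and $H^*s$ denotes the vector field on $P$ with $(\theta,\omega)(H^*s)=s\circ h$. The anchor $\rho_A(s)\in\mathfrak X(X)$ and the bracket $[s,t]_A$ are determined by $$(\rho_A(s)f)\circ h=d(f\circ h)(H^*s),\qquad [s,t]_A\circ h=(\theta,\omega)\big([H^*s,H^*t]\big).$$ If $(P,\theta,\omega)$ is fully regular (i.e. $\{d_p(f\circ h):f\in C^\infty(X)\}$ has the same dimension for all $p$), $X$ is a manifold, $h$ is a submersion, and this is the classifying Lie algebroid of $(P,\theta,\omega)$; the formulas make sense in general. Its structure maps $F:\mathbb R^n\to\mathfrak X(X)$ and $T:X\to\mathrm{Hom}(\wedge^2\mathbb R^n,\mathbb R^n)$ are $F(u)=\rho_A(u,0)$ and $T(u,v)=-\mathrm{pr}_{\mathbb R^n}[(u,0),(v,0)]_A$ for constant sections $(u,0),(v,0)$; thus $T\circ h$ is the torsion of $\omega$. **Local symmetry.** Let $\nabla$ be the linear connection induced by $\omega$ on $M=P/G$. It is *locally symmetric*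 if for each $m\in M$ the local geodesic symmetry at $m$ (the local diffeomorphism $\gamma(t)\mapsto\gamma(-t)$ for geodesics $\gamma$ with $\gamma(0)=m$) is, near $m$, an affine transformation of $\nabla$. (At orbifold points this is understood in orbifold charts.) $(P,\theta,\omega)$ is *locally symmetric* if for each $m\in M$ the local geodesic symmetry at $m$ is, near $m$, covered by a local equivalence of $(P,\theta,\omega)$. **Theorem.** Let $(P,\theta,\omega)$ be a $G$-structure with connection. 1. If $(P,\theta,\omega)$ is locally symmetric, then $T\equiv 0$ and $F\equiv 0$. 2. Conversely, if $T\equiv 0$ and $F\equiv 0$, then the linear connection $\nabla$ induced by $\omega$ on $M=P/G$ is locally symmetric. -/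

import Mathlib

open scoped Manifold ContDiff
open MulOpposite

noncomputable section

set_option linter.unusedSectionVars false

namespace GStr

/-- The value at `p` of the infinitesimal generator of the right action `p · g = op g • p`, i.e.
the derivative at `g = 1` of `g ↦ p · g` in the direction `α`.  The Lie algebra `𝔤 = T₁G` is
identified, as always in Mathlib, with the model space `EG` of `G`. -/
def generator {EG : Type*} [NormedAddCommGroup EG] [NormedSpace ℝ EG]
    {G : Type*} [TopologicalSpace G] [ChartedSpace EG G] [Group G]
    {EP : Type*} [NormedAddCommGroup EP] [NormedSpace ℝ EP]
    {P : Type*} [TopologicalSpace P] [ChartedSpace EP P] [MulAction Gᵐᵒᵖ P]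
    (p : P) : EG →L[ℝ] TangentSpace 𝓘(ℝ, EP) p :=
  (mfderiv 𝓘(ℝ, EG) 𝓘(ℝ, EP) (fun g : G => op g • p) 1 : EG →L[ℝ] EP)

/-- The adjoint action of `g` on `𝔤 = T₁G`: the derivative at `1` of `x ↦ g x g⁻¹`. -/
def Ad {EG : Type*} [NormedAddCommGroup EG] [NormedSpace ℝ EG]
    {G : Type*} [TopologicalSpace G] [ChartedSpace EG G] [Group G] (g : G) : EG →L[ℝ] EG :=
  mfderiv 𝓘(ℝ, EG) 𝓘(ℝ, EG) (fun x : G => g * x * g⁻¹) 1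

end GStr

/-- A `G`-structure with connection `(P, θ, ω)`, where `G ⊂ GL_n(ℝ)` is a closed subgroup (given
as a Lie group with a smooth closed embedding `ρ` into `GL_n(ℝ)`) and `G` acts smoothly, properly
and effectively from the right on `P`.  The action is automatically locally free, since
`ω` maps the generator of `α` to `α`; free actions are included. -/
structure GStructureWithConnection (n : ℕ)
    (EG : Type*) [NormedAddCommGroup EG] [NormedSpace ℝ EG]
    (G : Type*) [TopologicalSpace G] [ChartedSpace EG G] [Group G]
    (EP : Type*) [NormedAddCommGroup EP] [NormedSpace ℝ EP]
    (P : Type*) [TopologicalSpace P] [ChartedSpace EP P] [IsManifold 𝓘(ℝ, EP) ∞ P]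
    [MulAction Gᵐᵒᵖ P] where
  /-- the inclusion of `G` into `GL_n(ℝ)` -/
  ρ : G →* (EuclideanSpace ℝ (Fin n) →L[ℝ] EuclideanSpace ℝ (Fin n))ˣ
  ρ_closed : Topology.IsClosedEmbedding ρ
  ρ_smooth : ContMDiff 𝓘(ℝ, EG) 𝓘(ℝ, EuclideanSpace ℝ (Fin n) →L[ℝ] EuclideanSpace ℝ (Fin n)) ∞
    (fun g => (ρ g : EuclideanSpace ℝ (Fin n) →L[ℝ] EuclideanSpace ℝ (Fin n)))
  act_smooth : ContMDiff (𝓘(ℝ, EP).prod 𝓘(ℝ, EG)) 𝓘(ℝ, EP) ∞ (fun x : P × G => op x.2 • x.1)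
  act_proper : ProperSMul Gᵐᵒᵖ P
  act_effective : FaithfulSMul Gᵐᵒᵖ P
  dim_eq : Module.finrank ℝ EP = n + Module.finrank ℝ EG
  /-- the tautological (soldering) form -/
  θ : ∀ p : P, TangentSpace 𝓘(ℝ, EP) p →L[ℝ] EuclideanSpace ℝ (Fin n)
  θ_smooth : ContMDiff 𝓘(ℝ, EP).tangent 𝓘(ℝ, EuclideanSpace ℝ (Fin n)) ∞
    (fun v : TangentBundle 𝓘(ℝ, EP) P => θ v.1 v.2)
  θ_surjective : ∀ p, Function.Surjective (θ p)
  θ_horizontal : ∀ p (α : EG), θ p (GStr.generator (G := G) p α) = 0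
  θ_equivariant : ∀ (g : G) p (ξ : TangentSpace 𝓘(ℝ, EP) p),
    θ (op g • p) (mfderiv 𝓘(ℝ, EP) 𝓘(ℝ, EP) (fun q : P => op g • q) p ξ)
      = (ρ g⁻¹ : EuclideanSpace ℝ (Fin n) →L[ℝ] EuclideanSpace ℝ (Fin n)) (θ p ξ)
  /-- the connection form -/
  conn : ∀ p : P, TangentSpace 𝓘(ℝ, EP) p →L[ℝ] EG
  conn_smooth : ContMDiff 𝓘(ℝ, EP).tangent 𝓘(ℝ, EG) ∞
    (fun v : TangentBundle 𝓘(ℝ, EP) P => conn v.1 v.2)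
  conn_vertical : ∀ p (α : EG), conn p (GStr.generator (G := G) p α) = α
  conn_equivariant : ∀ (g : G) p (ξ : TangentSpace 𝓘(ℝ, EP) p),
    conn (op g • p) (mfderiv 𝓘(ℝ, EP) 𝓘(ℝ, EP) (fun q : P => op g • q) p ξ)
      = GStr.Ad g⁻¹ (conn p ξ)

namespace GStructureWithConnection

variable {n : ℕ}
  {EG : Type*} [NormedAddCommGroup EG] [NormedSpace ℝ EG] [FiniteDimensional ℝ EG]
  {G : Type*} [TopologicalSpace G] [ChartedSpace EG G] [Group G]
  {EP : Type*} [NormedAddCommGroup EP] [NormedSpace ℝ EP] [FiniteDimensional ℝ EP]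
  {P : Type*} [TopologicalSpace P] [ChartedSpace EP P] [IsManifold 𝓘(ℝ, EP) ∞ P]
  [MulAction Gᵐᵒᵖ P]
  (S : GStructureWithConnection n EG G EP P)

/-! ### The coframe `(θ, ω)` and its dual frame -/

/-- The coframe `(θ, ω)`. -/
def coframe (p : P) : TangentSpace 𝓘(ℝ, EP) p →L[ℝ] EuclideanSpace ℝ (Fin n) × EG :=
  (S.θ p).prod (S.conn p)

theorem coframe_bijective (p : P) : Function.Bijective (S.coframe p) := by
  let V : EG →ₗ[ℝ] EP := (GStr.generator (G := G) (EP := EP) p).toLinearMap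
  let t : EP →ₗ[ℝ] EuclideanSpace ℝ (Fin n) := (S.θ p).toLinearMap
  let w : EP →ₗ[ℝ] EG := (S.conn p).toLinearMap
  have hV : Function.Injective V := by
    intro a b hab
    have h0 : w (V a) = w (V b) := congrArg w hab
    rwa [show w (V a) = a from S.conn_vertical p a,
      show w (V b) = b from S.conn_vertical p b] at h0
  have hle : LinearMap.range V ≤ LinearMap.ker t := by
    rintro _ ⟨α, rfl⟩
    exact S.θ_horizontal p α
  have hsurj : Function.Surjective t := S.θ_surjective p
  have h1 := t.finrank_range_add_finrank_ker
  rw [LinearMap.range_eq_top.2 hsurj, finrank_top, finrank_euclideanSpace_fin, S.dim_eq] at h1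
  have h2 : Module.finrank ℝ (LinearMap.range V) = Module.finrank ℝ EG :=
    LinearMap.finrank_range_of_inj hV
  have heq : LinearMap.range V = LinearMap.ker t :=
    Submodule.eq_of_le_of_finrank_eq hle (by omega)
  let c : EP →ₗ[ℝ] EuclideanSpace ℝ (Fin n) × EG := t.prod w
  have hinj : Function.Injective c := by
    rw [injective_iff_map_eq_zero]
    intro ξ hξ
    have h3 : t ξ = 0 := congrArg Prod.fst hξ
    have h4 : w ξ = 0 := congrArg Prod.snd hξ
    have h5 : ξ ∈ LinearMap.range V := heq ▸ h3
    obtain ⟨α, rfl⟩ := h5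
    have h6 : w (V α) = α := S.conn_vertical p α
    rw [h6] at h4
    rw [h4, map_zero]
  have hfin : Module.finrank ℝ EP = Module.finrank ℝ (EuclideanSpace ℝ (Fin n) × EG) := by
    rw [Module.finrank_prod, finrank_euclideanSpace_fin, S.dim_eq]
  exact ⟨hinj, (LinearMap.injective_iff_surjective_of_finrank_eq_finrank hfin).1 hinj⟩

/-- The frame dual to the coframe: `frame p (u, α)` is the tangent vector `ξ` at `p` with
`θ ξ = u` and `ω ξ = α`. -/
def frame (p : P) : EuclideanSpace ℝ (Fin n) × EG →ₗ[ℝ] TangentSpace 𝓘(ℝ, EP) p :=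
  (LinearEquiv.ofBijective (S.coframe p).toLinearMap (S.coframe_bijective p)).symm.toLinearMap

theorem coframe_frame (p : P) (a : EuclideanSpace ℝ (Fin n) × EG) :
    S.coframe p (S.frame p a) = a :=
  (LinearEquiv.ofBijective (S.coframe p).toLinearMap (S.coframe_bijective p)).apply_symm_apply a

theorem frame_coframe (p : P) (ξ : TangentSpace 𝓘(ℝ, EP) p) :
    S.frame p (S.coframe p ξ) = ξ :=
  (LinearEquiv.ofBijective (S.coframe p).toLinearMap (S.coframe_bijective p)).symm_apply_apply ξ

/-! ### Local equivalences and the classifying space -/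

/-- A local self-equivalence `Φ : π⁻¹(U) → π⁻¹(U')` of `(P, θ, ω)`: a `G`-equivariant
diffeomorphism between saturated open sets that preserves `θ` and `ω`. -/
structure IsLocalEquivalence (Φ : OpenPartialHomeomorph P P) : Prop where
  saturated : ∀ p ∈ Φ.source, ∀ g : G, op g • p ∈ Φ.source
  smooth : ContMDiffOn 𝓘(ℝ, EP) 𝓘(ℝ, EP) ∞ Φ Φ.source
  smooth_symm : ContMDiffOn 𝓘(ℝ, EP) 𝓘(ℝ, EP) ∞ Φ.symm Φ.target
  equivariant : ∀ p ∈ Φ.source, ∀ g : G, Φ (op g • p) = op g • Φ p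
  pullback_θ : ∀ p ∈ Φ.source, ∀ ξ : TangentSpace 𝓘(ℝ, EP) p,
    S.θ (Φ p) (mfderiv 𝓘(ℝ, EP) 𝓘(ℝ, EP) Φ p ξ) = S.θ p ξ
  pullback_conn : ∀ p ∈ Φ.source, ∀ ξ : TangentSpace 𝓘(ℝ, EP) p,
    S.conn (Φ p) (mfderiv 𝓘(ℝ, EP) 𝓘(ℝ, EP) Φ p ξ) = S.conn p ξ

variable {S} in
theorem IsLocalEquivalence.mdifferentiableAt {Φ : OpenPartialHomeomorph P P}
    (h : S.IsLocalEquivalence Φ) {p : P} (hp : p ∈ Φ.source) :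
    MDifferentiableAt 𝓘(ℝ, EP) 𝓘(ℝ, EP) Φ p :=
  (h.smooth.contMDiffAt (Φ.open_source.mem_nhds hp)).mdifferentiableAt (by simp)

variable {S} in
theorem IsLocalEquivalence.coframe {Φ : OpenPartialHomeomorph P P}
    (h : S.IsLocalEquivalence Φ) {p : P} (hp : p ∈ Φ.source) (ξ : TangentSpace 𝓘(ℝ, EP) p) :
    S.coframe (Φ p) (mfderiv 𝓘(ℝ, EP) 𝓘(ℝ, EP) Φ p ξ) = S.coframe p ξ :=
  Prod.ext (h.pullback_θ p hp ξ) (h.pullback_conn p hp ξ)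

theorem isLocalEquivalence_refl : S.IsLocalEquivalence (OpenPartialHomeomorph.refl P) where
  saturated := fun _ _ _ => trivial
  smooth := contMDiff_id.contMDiffOn
  smooth_symm := contMDiff_id.contMDiffOn
  equivariant := fun _ _ _ => rfl
  pullback_θ := fun p _ ξ => by
    have : mfderiv 𝓘(ℝ, EP) 𝓘(ℝ, EP) (OpenPartialHomeomorph.refl P) p
      = ContinuousLinearMap.id ℝ (TangentSpace 𝓘(ℝ, EP) p) := mfderiv_id
    rw [this]; rfl
  pullback_conn := fun p _ ξ => by
    have : mfderiv 𝓘(ℝ, EP) 𝓘(ℝ, EP) (OpenPartialHomeomorph.refl P) p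
      = ContinuousLinearMap.id ℝ (TangentSpace 𝓘(ℝ, EP) p) := mfderiv_id
    rw [this]; rfl

variable {S} in
theorem IsLocalEquivalence.symm {Φ : OpenPartialHomeomorph P P} (h : S.IsLocalEquivalence Φ) :
    S.IsLocalEquivalence Φ.symm := by
  have key : ∀ q ∈ Φ.target, ∀ g : G, op g • q = Φ (op g • Φ.symm q) := by
    intro q hq g
    rw [h.equivariant _ (Φ.map_target hq), Φ.right_inv hq]
  have hd : ∀ q ∈ Φ.target, ∀ ξ : TangentSpace 𝓘(ℝ, EP) q,
      S.coframe (Φ.symm q) (mfderiv 𝓘(ℝ, EP) 𝓘(ℝ, EP) Φ.symm q ξ) = S.coframe q ξ := by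
    intro q hq ξ
    rw [← h.coframe (Φ.map_target hq)]
    have h1 : MDifferentiableAt 𝓘(ℝ, EP) 𝓘(ℝ, EP) Φ.symm q :=
      (h.smooth_symm.contMDiffAt (Φ.open_target.mem_nhds hq)).mdifferentiableAt (by simp)
    have h2 := mfderiv_comp_apply q (h.mdifferentiableAt (Φ.map_target hq)) h1 ξ
    rw [← h2]
    have h3 : (Φ ∘ Φ.symm) =ᶠ[nhds q] id :=
      Filter.eventuallyEq_of_mem (Φ.open_target.mem_nhds hq) (fun x hx => Φ.right_inv hx)
    have h4 : mfderiv 𝓘(ℝ, EP) 𝓘(ℝ, EP) (Φ ∘ Φ.symm) q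
      = mfderiv 𝓘(ℝ, EP) 𝓘(ℝ, EP) (id : P → P) q := h3.mfderiv_eq
    have h5 : (mfderiv 𝓘(ℝ, EP) 𝓘(ℝ, EP) (Φ ∘ Φ.symm) q : EP →L[ℝ] EP) ξ = ξ := by
      rw [h4, mfderiv_id]; rfl
    have h6 : Φ (Φ.symm q) = q := Φ.right_inv hq
    have h7 : ∀ (r : P) (_ : r = q) (η : EP), η = ξ →
        (S.coframe r : EP →L[ℝ] _) η = (S.coframe q : EP →L[ℝ] _) ξ := by
      rintro r rfl η rfl; rfl
    exact h7 _ h6 _ h5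
  refine ⟨fun q hq g => ?_, h.smooth_symm, by simpa using h.smooth, fun q hq g => ?_,
    fun q hq ξ => congrArg Prod.fst (hd q hq ξ), fun q hq ξ => congrArg Prod.snd (hd q hq ξ)⟩
  · rw [key q hq g]
    exact Φ.map_source (h.saturated _ (Φ.map_target hq) g)
  · rw [key q hq g]
    exact Φ.left_inv (h.saturated _ (Φ.map_target hq) g)

variable {S} in
theorem IsLocalEquivalence.trans {Φ Ψ : OpenPartialHomeomorph P P}
    (h : S.IsLocalEquivalence Φ) (h' : S.IsLocalEquivalence Ψ) :
    S.IsLocalEquivalence (Φ.trans Ψ) := by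
  have hd : ∀ p ∈ (Φ.trans Ψ).source, ∀ ξ : TangentSpace 𝓘(ℝ, EP) p,
      S.coframe (Φ.trans Ψ p) (mfderiv 𝓘(ℝ, EP) 𝓘(ℝ, EP) (Φ.trans Ψ) p ξ) = S.coframe p ξ := by
    intro p hp ξ
    rw [OpenPartialHomeomorph.trans_source] at hp
    have h2 := mfderiv_comp_apply p (h'.mdifferentiableAt hp.2) (h.mdifferentiableAt hp.1) ξ
    have h3 := h'.coframe hp.2 (mfderiv 𝓘(ℝ, EP) 𝓘(ℝ, EP) Φ p ξ)
    rw [h.coframe hp.1, ← h2] at h3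
    exact h3
  refine ⟨fun p hp g => ?_, ?_, ?_, fun p hp g => ?_,
    fun q hq ξ => congrArg Prod.fst (hd q hq ξ), fun q hq ξ => congrArg Prod.snd (hd q hq ξ)⟩
  · rw [OpenPartialHomeomorph.trans_source] at hp ⊢
    refine ⟨h.saturated p hp.1 g, ?_⟩
    rw [Set.mem_preimage, h.equivariant p hp.1]
    exact h'.saturated _ hp.2 g
  · rw [OpenPartialHomeomorph.trans_source, OpenPartialHomeomorph.coe_trans]
    exact h'.smooth.comp (h.smooth.mono Set.inter_subset_left) (fun x hx => hx.2)
  · rw [OpenPartialHomeomorph.trans_target, OpenPartialHomeomorph.coe_trans_symm]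
    exact h.smooth_symm.comp (h'.smooth_symm.mono Set.inter_subset_left) (fun x hx => hx.2)
  · rw [OpenPartialHomeomorph.trans_source] at hp
    simp only [OpenPartialHomeomorph.coe_trans, Function.comp_apply]
    rw [h.equivariant p hp.1, h'.equivariant _ hp.2]

/-- Two points are locally equivalent if a local equivalence maps one to the other. -/
def localEquivSetoid : Setoid P where
  r p q := ∃ Φ : OpenPartialHomeomorph P P, S.IsLocalEquivalence Φ ∧ p ∈ Φ.source ∧ Φ p = q
  iseqv :=
    { refl := fun p => ⟨_, S.isLocalEquivalence_refl, trivial, rfl⟩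
      symm := by
        rintro p q ⟨Φ, h, hp, rfl⟩
        exact ⟨Φ.symm, h.symm, Φ.map_source hp, Φ.left_inv hp⟩
      trans := by
        rintro p q r ⟨Φ, h, hp, rfl⟩ ⟨Ψ, h', hq, rfl⟩
        exact ⟨Φ.trans Ψ, h.trans h', by
          rw [OpenPartialHomeomorph.trans_source]; exact ⟨hp, hq⟩, rfl⟩ }

/-- The classifying space `X = P / ∼`. -/
def ClassifyingSpace : Type _ := Quotient S.localEquivSetoid

/-- The classifying map `h : P → X`. -/
def h (p : P) : S.ClassifyingSpace := Quotient.mk S.localEquivSetoid p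

theorem h_eq {Φ : OpenPartialHomeomorph P P} (hΦ : S.IsLocalEquivalence Φ) {p : P}
    (hp : p ∈ Φ.source) : S.h (Φ p) = S.h p :=
  (Quotient.sound (s := S.localEquivSetoid) ⟨Φ, hΦ, hp, rfl⟩).symm

variable {S} in
theorem mfderiv_frame {Φ : OpenPartialHomeomorph P P} (hΦ : S.IsLocalEquivalence Φ) {p : P}
    (hp : p ∈ Φ.source) (a : EuclideanSpace ℝ (Fin n) × EG) :
    mfderiv 𝓘(ℝ, EP) 𝓘(ℝ, EP) Φ p (S.frame p a) = S.frame (Φ p) a := by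
  rw [← S.frame_coframe (Φ p) (mfderiv 𝓘(ℝ, EP) 𝓘(ℝ, EP) Φ p (S.frame p a)), hΦ.coframe hp,
    S.coframe_frame]

theorem coframe_smooth : ContMDiff 𝓘(ℝ, EP).tangent 𝓘(ℝ, EuclideanSpace ℝ (Fin n) × EG) ∞
    (fun v : TangentBundle 𝓘(ℝ, EP) P => S.coframe v.1 v.2) :=
  S.θ_smooth.prodMk_space S.conn_smooth

theorem frame_smooth {s : P → EuclideanSpace ℝ (Fin n) × EG}
    (hs : ContMDiff 𝓘(ℝ, EP) 𝓘(ℝ, EuclideanSpace ℝ (Fin n) × EG) ∞ s) :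
    ContMDiff 𝓘(ℝ, EP) 𝓘(ℝ, EP).tangent ∞
      (fun p => (⟨p, S.frame p (s p)⟩ : TangentBundle 𝓘(ℝ, EP) P)) := by
  intro p₀
  have : CompleteSpace EP := FiniteDimensional.complete ℝ EP
  let e := trivializationAt EP (TangentSpace 𝓘(ℝ, EP) : P → Type _) p₀
  have hp₀ : p₀ ∈ e.baseSet := FiberBundle.mem_baseSet_trivializationAt' p₀
  have hbase : ∀ᶠ p in nhds p₀, p ∈ e.baseSet := e.open_baseSet.mem_nhds hp₀
  let A : P → EP →L[ℝ] EuclideanSpace ℝ (Fin n) × EG := fun p =>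
    (S.coframe p).comp (e.symmL ℝ p)
  have hAapp : ∀ v : EP, ContMDiffAt 𝓘(ℝ, EP) 𝓘(ℝ, EuclideanSpace ℝ (Fin n) × EG) ∞
      (fun p => A p v) p₀ := by
    intro v
    have h1 : ContMDiffAt 𝓘(ℝ, EP) 𝓘(ℝ, EP).tangent ∞
        (fun p => (⟨p, e.symmL ℝ p v⟩ : TangentBundle 𝓘(ℝ, EP) P)) p₀ := by
      refine (e.contMDiffAt_section_iff hp₀).2 ?_
      refine (contMDiffAt_const (c := v)).congr_of_eventuallyEq ?_
      filter_upwards [hbase] with p hp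
      have := e.continuousLinearMapAt_symmL (R := ℝ) hp v
      rwa [e.continuousLinearMapAt_apply_of_mem (R := ℝ) hp] at this
    exact (S.coframe_smooth _).comp p₀ h1
  have hA : ContMDiffAt 𝓘(ℝ, EP) 𝓘(ℝ, EP →L[ℝ] EuclideanSpace ℝ (Fin n) × EG) ∞ A p₀ := by
    let d := Module.finrank ℝ EP
    have hd : d = Module.finrank ℝ (Fin d → ℝ) := (Module.finrank_fin_fun ℝ).symm
    let e₁ := ContinuousLinearEquiv.ofFinrankEq hd
    let e₂ := (e₁.arrowCongr (1 : (EuclideanSpace ℝ (Fin n) × EG) ≃L[ℝ]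
      (EuclideanSpace ℝ (Fin n) × EG))).trans (ContinuousLinearEquiv.piRing (Fin d))
    have h2 : ContMDiffAt 𝓘(ℝ, EP) 𝓘(ℝ, Fin d → EuclideanSpace ℝ (Fin n) × EG) ∞
        (fun p => e₂ (A p)) p₀ := contMDiffAt_pi_space.2 fun i => hAapp _
    have h3 := e₂.symm.contDiff.contMDiff.contMDiffAt.comp p₀ h2
    refine h3.congr_of_eventuallyEq (Filter.Eventually.of_forall fun p => ?_)
    simp
  have hinv : ∀ p ∈ e.baseSet, ∃ L : EP ≃L[ℝ] EuclideanSpace ℝ (Fin n) × EG,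
      (L : EP →L[ℝ] EuclideanSpace ℝ (Fin n) × EG) = A p := by
    intro p hp
    have hb : Function.Bijective (A p : EP →ₗ[ℝ] EuclideanSpace ℝ (Fin n) × EG) := by
      have := (S.coframe_bijective p).comp (e.continuousLinearEquivAt ℝ p hp).symm.bijective
      rw [e.symm_continuousLinearEquivAt_eq] at this
      exact this
    exact ⟨(LinearEquiv.ofBijective _ hb).toContinuousLinearEquiv, by ext1 v; rfl⟩
  have hAinv : ContMDiffAt 𝓘(ℝ, EP) 𝓘(ℝ, EuclideanSpace ℝ (Fin n) × EG →L[ℝ] EP) ∞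
      (fun p => (A p).inverse) p₀ := by
    obtain ⟨L, hL⟩ := hinv p₀ hp₀
    have h4 := contDiffAt_map_inverse (n := ∞) L
    rw [hL] at h4
    exact h4.contMDiffAt.comp p₀ hA
  refine (e.contMDiffAt_section_iff hp₀).2 ?_
  refine (hAinv.clm_apply (hs p₀)).congr_of_eventuallyEq ?_
  filter_upwards [hbase] with p hp
  obtain ⟨L, hL⟩ := hinv p hp
  rw [← e.continuousLinearMapAt_apply_of_mem (R := ℝ) hp, ← hL, ContinuousLinearMap.inverse_equiv]
  refine (L.symm_apply_eq.2 ?_).symm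
  have h5 : A p (e.continuousLinearMapAt ℝ p (S.frame p (s p))) = s p := by
    have h6 := e.symmL_continuousLinearMapAt (R := ℝ) hp (S.frame p (s p))
    have h7 : A p (e.continuousLinearMapAt ℝ p (S.frame p (s p)))
      = S.coframe p (e.symmL ℝ p (e.continuousLinearMapAt ℝ p (S.frame p (s p)))) := rfl
    rw [h7, h6, S.coframe_frame]
  rw [← hL] at h5
  exact h5.symm

/-! ### The classifying algebroid

Smooth functions on `X` are the functions whose pullback along `h` is smooth (so that `h^*`
identifies them with the invariant functions on `P`), vector fields on `X` are derivations of this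
algebra, and the sections of the trivial bundle `A = X × (ℝⁿ ⊕ 𝔤)` are the smooth maps
`X → ℝⁿ ⊕ 𝔤`.  If `(P, θ, ω)` is fully regular, then `X` is a manifold and `h` a surjective
submersion, so that these are the usual smooth functions, vector fields and sections: a function on
`X` is smooth iff its pullback along `h` is, and a vector field is determined by its action on
functions since the differentials of the global functions span every cotangent space of `X`. -/

/-- The algebra `C^∞(X)`. -/
def smoothFunctions : Subalgebra ℝ (S.ClassifyingSpace → ℝ) where
  carrier := {f | ContMDiff 𝓘(ℝ, EP) 𝓘(ℝ, ℝ) ∞ (fun p => f (S.h p))}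
  mul_mem' := fun hf hg => ContMDiff.mul hf hg
  add_mem' := fun hf hg => ContMDiff.add hf hg
  algebraMap_mem' := fun _ => contMDiff_const

/-- The `C^∞(X)`-module `Γ(A)` of sections of `A = X × (ℝⁿ ⊕ 𝔤)`. -/
def Sections : Type _ :=
  {s : S.ClassifyingSpace → EuclideanSpace ℝ (Fin n) × EG //
    ContMDiff 𝓘(ℝ, EP) 𝓘(ℝ, EuclideanSpace ℝ (Fin n) × EG) ∞ (fun p => s (S.h p))}

instance : AddCommGroup S.Sections :=
  inferInstanceAs (AddCommGroup
    ({ carrier := {s | ContMDiff 𝓘(ℝ, EP) 𝓘(ℝ, EuclideanSpace ℝ (Fin n) × EG) ∞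
        (fun p => s (S.h p))}
       add_mem' := fun hf hg => ContMDiff.add hf hg
       zero_mem' := contMDiff_const
       neg_mem' := fun hf => ContMDiff.neg hf } :
      AddSubgroup (S.ClassifyingSpace → EuclideanSpace ℝ (Fin n) × EG)))

instance : Module S.smoothFunctions S.Sections where
  smul f s := ⟨fun x => f.1 x • s.1 x, ContMDiff.smul f.2 s.2⟩
  one_smul s := Subtype.ext <| funext fun x => one_smul ℝ (s.1 x)
  mul_smul f g s := Subtype.ext <| funext fun x => mul_smul (f.1 x) (g.1 x) (s.1 x)
  smul_zero f := Subtype.ext <| funext fun x => smul_zero (f.1 x)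
  smul_add f s t := Subtype.ext <| funext fun x => smul_add (f.1 x) (s.1 x) (t.1 x)
  add_smul f g s := Subtype.ext <| funext fun x => add_smul (f.1 x) (g.1 x) (s.1 x)
  zero_smul s := Subtype.ext <| funext fun x => zero_smul ℝ (s.1 x)

/-- The constant section with value `a`. -/
def constSection : EuclideanSpace ℝ (Fin n) × EG →+ S.Sections where
  toFun a := ⟨fun _ => a, contMDiff_const⟩
  map_add' _ _ := rfl
  map_zero' := rfl

/-- The vector field `H^*s` on `P` that corresponds to a section `s` under the fibrewise
isomorphism `H = (θ, ω) : TP → A`. -/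
def pullbackSection (s : S.Sections) (p : P) : TangentSpace 𝓘(ℝ, EP) p :=
  S.frame p (s.1 (S.h p))

theorem pullbackSection_smooth (s : S.Sections) :
    ContMDiff 𝓘(ℝ, EP) 𝓘(ℝ, EP).tangent ∞
      (fun p => (⟨p, S.pullbackSection s p⟩ : TangentBundle 𝓘(ℝ, EP) P)) :=
  S.frame_smooth s.2

/-- The derivative of `f ∘ h` along the vector field `H^*s`. -/
def anchorAux (s : S.Sections) (f : S.smoothFunctions) (p : P) : ℝ :=
  (mfderiv 𝓘(ℝ, EP) 𝓘(ℝ, ℝ) (fun q => f.1 (S.h q)) p : TangentSpace 𝓘(ℝ, EP) p →L[ℝ] ℝ)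
    (S.pullbackSection s p)

theorem mdifferentiable_comp_h (f : S.smoothFunctions) :
    MDifferentiable 𝓘(ℝ, EP) 𝓘(ℝ, ℝ) (fun q => f.1 (S.h q)) :=
  ContMDiff.mdifferentiable f.2 (by simp)

theorem anchorAux_smooth (s : S.Sections) (f : S.smoothFunctions) :
    ContMDiff 𝓘(ℝ, EP) 𝓘(ℝ, ℝ) ∞ (S.anchorAux s f) := by
  have h1 : ContMDiff 𝓘(ℝ, EP).tangent 𝓘(ℝ, ℝ).tangent ∞
      (tangentMap 𝓘(ℝ, EP) 𝓘(ℝ, ℝ) (fun q => f.1 (S.h q))) :=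
    ContMDiff.contMDiff_tangentMap f.2 le_rfl
  have h2 := h1.comp (S.pullbackSection_smooth s)
  exact (contMDiff_snd_tangentBundle_modelSpace ℝ 𝓘(ℝ, ℝ)).comp h2

theorem anchorAux_invariant (s : S.Sections) (f : S.smoothFunctions) (p q : P)
    (hpq : S.localEquivSetoid p q) : S.anchorAux s f p = S.anchorAux s f q := by
  obtain ⟨Φ, hΦ, hp, rfl⟩ := hpq
  have h1 := mfderiv_comp_apply p (S.mdifferentiable_comp_h f (Φ p)) (hΦ.mdifferentiableAt hp)
    (S.pullbackSection s p)
  have h2 : ((fun q => f.1 (S.h q)) ∘ Φ) =ᶠ[nhds p] (fun q => f.1 (S.h q)) :=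
    Filter.eventuallyEq_of_mem (Φ.open_source.mem_nhds hp)
      (fun x hx => congrArg f.1 (S.h_eq hΦ hx))
  rw [h2.mfderiv_eq] at h1
  have h3 : mfderiv 𝓘(ℝ, EP) 𝓘(ℝ, EP) Φ p (S.pullbackSection s p)
      = S.pullbackSection s (Φ p) := by
    rw [pullbackSection, mfderiv_frame hΦ hp, pullbackSection, S.h_eq hΦ hp]
  rw [h3] at h1
  exact h1

/-- The function `ρ_A(s) f` on `X`, which satisfies `(ρ_A(s) f) ∘ h = d(f ∘ h)(H^*s)`. -/
def anchorFun (s : S.Sections) (f : S.smoothFunctions) : S.smoothFunctions :=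
  ⟨Quotient.lift (S.anchorAux s f) (S.anchorAux_invariant s f), S.anchorAux_smooth s f⟩

theorem anchorFun_h (s : S.Sections) (f : S.smoothFunctions) (p : P) :
    (S.anchorFun s f).1 (S.h p) = S.anchorAux s f p := rfl

theorem ext_h {Y : Type*} {f g : S.ClassifyingSpace → Y} (hfg : ∀ p, f (S.h p) = g (S.h p)) :
    f = g := funext fun x => Quotient.inductionOn x hfg

/-- The anchor `ρ_A : Γ(A) → 𝔛(X)`. -/
def anchor : S.Sections →ₗ[S.smoothFunctions] Derivation ℝ S.smoothFunctions S.smoothFunctions where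
  toFun s := Derivation.mk'
    { toFun := S.anchorFun s
      map_add' := fun f g => Subtype.ext <| S.ext_h fun p => by
        have h1 := ((S.mdifferentiable_comp_h f p).hasMFDerivAt.add
          (S.mdifferentiable_comp_h g p).hasMFDerivAt).mfderiv
        exact congrArg (fun L : EP →L[ℝ] ℝ => L (S.pullbackSection s p)) h1
      map_smul' := fun c f => Subtype.ext <| S.ext_h fun p => by
        have h1 := ((S.mdifferentiable_comp_h f p).hasMFDerivAt.const_smul c).mfderiv
        exact congrArg (fun L : EP →L[ℝ] ℝ => L (S.pullbackSection s p)) h1 }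
    (fun f g => Subtype.ext <| S.ext_h fun p => by
      have h1 := ((S.mdifferentiable_comp_h f p).hasMFDerivAt.mul
        (S.mdifferentiable_comp_h g p).hasMFDerivAt).mfderiv
      exact congrArg (fun L : EP →L[ℝ] ℝ => L (S.pullbackSection s p)) h1)
  map_add' s t := Derivation.ext fun f => Subtype.ext <| S.ext_h fun p => by
    have h1 : S.pullbackSection (s + t) p = S.pullbackSection s p + S.pullbackSection t p :=
      map_add (S.frame p) _ _
    have h2 : S.anchorAux (s + t) f p = S.anchorAux s f p + S.anchorAux t f p := by
      rw [anchorAux, h1, map_add]; rfl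
    exact h2
  map_smul' g s := Derivation.ext fun f => Subtype.ext <| S.ext_h fun p => by
    have h1 : S.pullbackSection (g • s) p = g.1 (S.h p) • S.pullbackSection s p :=
      map_smul (S.frame p) _ _
    have h2 : S.anchorAux (g • s) f p = g.1 (S.h p) * S.anchorAux s f p := by
      rw [anchorAux, h1, map_smul]; rfl
    exact h2

/-- `H [H^*s, H^*t]`, where the bracket is the Lie bracket of vector fields on `P`. -/
def bracketAux (s t : S.Sections) (p : P) : EuclideanSpace ℝ (Fin n) × EG :=
  S.coframe p (VectorField.mlieBracket 𝓘(ℝ, EP) (S.pullbackSection s) (S.pullbackSection t) p)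

theorem bracketAux_smooth (s t : S.Sections) :
    ContMDiff 𝓘(ℝ, EP) 𝓘(ℝ, EuclideanSpace ℝ (Fin n) × EG) ∞ (S.bracketAux s t) := by
  have : IsManifold 𝓘(ℝ, EP) (((⊤ : ℕ∞) : WithTop ℕ∞) + 1) P := ‹IsManifold 𝓘(ℝ, EP) ∞ P›
  have : CompleteSpace EP := FiniteDimensional.complete ℝ EP
  have : IsManifold 𝓘(ℝ, EP) (minSmoothness ℝ 2) P := by
    rw [minSmoothness_of_isRCLikeNormedField]; infer_instance
  have h1 := ContDiff.mlieBracket_vectorField (m := ⊤) (n := ⊤) (S.pullbackSection_smooth s)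
    (S.pullbackSection_smooth t) (by simp)
  exact S.coframe_smooth.comp h1

theorem bracketAux_invariant (s t : S.Sections) (p q : P)
    (hpq : S.localEquivSetoid p q) : S.bracketAux s t p = S.bracketAux s t q := by
  obtain ⟨Φ, hΦ, hp, rfl⟩ := hpq
  have : CompleteSpace EP := FiniteDimensional.complete ℝ EP
  have : IsManifold 𝓘(ℝ, EP) (minSmoothness ℝ 2) P := by
    rw [minSmoothness_of_isRCLikeNormedField]; infer_instance
  have h1 := VectorField.mpullback_mlieBracket (n := ∞) (f := Φ) (x₀ := p)
    ((S.pullbackSection_smooth s).mdifferentiable (by simp) (Φ p))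
    ((S.pullbackSection_smooth t).mdifferentiable (by simp) (Φ p))
    (hΦ.smooth.contMDiffAt (Φ.open_source.mem_nhds hp))
    (by rw [minSmoothness_of_isRCLikeNormedField]; exact WithTop.coe_le_coe.2 le_top)
  have hinv : ∀ x ∈ Φ.source, (mfderiv 𝓘(ℝ, EP) 𝓘(ℝ, EP) Φ x).IsInvertible := by
    intro x hx
    let L : EP →ₗ[ℝ] EP := (mfderiv 𝓘(ℝ, EP) 𝓘(ℝ, EP) Φ x : EP →L[ℝ] EP).toLinearMap
    have hL : Function.Injective L := by
      intro ξ η hξη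
      have h2 := hΦ.coframe hx ξ
      have h3 := hΦ.coframe hx η
      have h4 : mfderiv 𝓘(ℝ, EP) 𝓘(ℝ, EP) Φ x ξ = mfderiv 𝓘(ℝ, EP) 𝓘(ℝ, EP) Φ x η := hξη
      rw [h4] at h2
      exact (S.coframe_bijective x).1 (h2.symm.trans h3)
    exact ⟨(LinearEquiv.ofInjectiveEndo L hL).toContinuousLinearEquiv, by ext1 v; rfl⟩
  have hbij : ∀ x ∈ Φ.source, ∀ a, (mfderiv 𝓘(ℝ, EP) 𝓘(ℝ, EP) Φ x).inverse (S.frame (Φ x) a)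
      = S.frame x a := by
    intro x hx a
    rw [← mfderiv_frame hΦ hx a]
    exact (hinv x hx).inverse_apply_self _
  have hpull : ∀ u : S.Sections, VectorField.mpullback 𝓘(ℝ, EP) 𝓘(ℝ, EP) Φ
      (S.pullbackSection u) =ᶠ[nhds p] S.pullbackSection u := by
    intro u
    filter_upwards [Φ.open_source.mem_nhds hp] with x hx
    rw [VectorField.mpullback_apply, pullbackSection, hbij x hx, pullbackSection, S.h_eq hΦ hx]
  rw [(hpull s).mlieBracket_vectorField_eq (hpull t)] at h1
  rw [VectorField.mpullback_apply, (hinv p hp).inverse_apply_eq] at h1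
  rw [bracketAux, bracketAux, h1, hΦ.coframe hp]

/-- The bracket of `Γ(A)`, characterised by `H [s, t]_A = [H^*s, H^*t]`; equivalently,
`H^*` intertwines `d_A` with the de Rham differential. -/
def bracket (s t : S.Sections) : S.Sections :=
  ⟨Quotient.lift (S.bracketAux s t) (S.bracketAux_invariant s t), S.bracketAux_smooth s t⟩

/-- The torsion map `T : X → Hom(∧²ℝⁿ, ℝⁿ)` of the classifying algebroid: on constant sections
`[(u, 0), (v, 0)]_A = (-T(u, v), -R(u, v))`.  Since `θ` is constant along `H^*(u, 0)`, this is the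
function with `T(h p)(u, v) = dθ(ξ, η)` for the horizontal `ξ, η ∈ T_pP` over `u, v`. -/
def T (x : S.ClassifyingSpace) (u v : EuclideanSpace ℝ (Fin n)) : EuclideanSpace ℝ (Fin n) :=
  -((S.bracket (S.constSection (u, 0)) (S.constSection (v, 0))).1 x).1

/-- The map `F : ℝⁿ → 𝔛(X)`, the restriction of the anchor to constant sections `(u, 0)`; thus
`(F(u) f) ∘ h = ∂(f ∘ h)/∂θ (u)`. -/
def F (u : EuclideanSpace ℝ (Fin n)) : Derivation ℝ S.smoothFunctions S.smoothFunctions :=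
  S.anchor (S.constSection (u, 0))

/-! ### The induced linear connection on `M = P / G`

The connection is described in charts of `M`.  A chart of the (possibly orbifold) quotient
`M = P / G` is given by a smooth map from an open subset of `ℝⁿ` to `P` that is transverse to the
orbits; if the action is free, these are the local sections of `P → M` over coordinate
domains, and every point of `M` lies in the domain of one. -/

/-- A chart of `M = P / G` together with a section of `P` over it: a smooth map `σ` from an open
set `W ⊂ ℝⁿ` to `P`, transverse to the orbits. -/
structure FramedChart where
  dom : Set (EuclideanSpace ℝ (Fin n))
  isOpen_dom : IsOpen dom
  σ : EuclideanSpace ℝ (Fin n) → P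
  smooth : ContMDiffOn 𝓘(ℝ, EuclideanSpace ℝ (Fin n)) 𝓘(ℝ, EP) ∞ σ dom
  transverse : ∀ w ∈ dom, Function.Bijective fun v : EuclideanSpace ℝ (Fin n) =>
    S.θ (σ w) (mfderiv 𝓘(ℝ, EuclideanSpace ℝ (Fin n)) 𝓘(ℝ, EP) σ w v)

namespace FramedChart

variable {S} (c : S.FramedChart)

/-- `σ^*θ`.  Its value at `w` is the inverse of the frame of `T_wW = ℝⁿ` defined by `σ w`. -/
def solder (w : EuclideanSpace ℝ (Fin n)) :
    EuclideanSpace ℝ (Fin n) →L[ℝ] EuclideanSpace ℝ (Fin n) :=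
  (S.θ (c.σ w)).comp (mfderiv 𝓘(ℝ, EuclideanSpace ℝ (Fin n)) 𝓘(ℝ, EP) c.σ w :
    EuclideanSpace ℝ (Fin n) →L[ℝ] TangentSpace 𝓘(ℝ, EP) (c.σ w))

/-- `σ^*ω`, as a form with values in `𝔤 ⊂ 𝔤𝔩_n(ℝ)`. -/
def connForm (w : EuclideanSpace ℝ (Fin n)) :
    EuclideanSpace ℝ (Fin n) →L[ℝ] EuclideanSpace ℝ (Fin n) →L[ℝ] EuclideanSpace ℝ (Fin n) :=
  (mfderiv 𝓘(ℝ, EG) 𝓘(ℝ, EuclideanSpace ℝ (Fin n) →L[ℝ] EuclideanSpace ℝ (Fin n))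
    (fun g => (S.ρ g : EuclideanSpace ℝ (Fin n) →L[ℝ] EuclideanSpace ℝ (Fin n))) 1 :
      EG →L[ℝ] EuclideanSpace ℝ (Fin n) →L[ℝ] EuclideanSpace ℝ (Fin n)).comp
  ((S.conn (c.σ w)).comp (mfderiv 𝓘(ℝ, EuclideanSpace ℝ (Fin n)) 𝓘(ℝ, EP) c.σ w :
    EuclideanSpace ℝ (Fin n) →L[ℝ] TangentSpace 𝓘(ℝ, EP) (c.σ w)))

/-- The covariant derivative `(∇_v Y)(w)` of the connection induced by `ω`: in the frame `σ` the
vector field `Y` has the components `σ^*θ (Y)`, and the connection matrix is `σ^*ω`. -/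
def nabla (Y : EuclideanSpace ℝ (Fin n) → EuclideanSpace ℝ (Fin n))
    (w v : EuclideanSpace ℝ (Fin n)) : EuclideanSpace ℝ (Fin n) :=
  (c.solder w).inverse
    (fderiv ℝ (fun x => c.solder x (Y x)) w v + c.connForm w v (c.solder w (Y w)))

/-- The Christoffel symbols `Γ_w(v, u) = (∇_v u)(w)`, with `u` a constant vector field. -/
def christoffel (w v u : EuclideanSpace ℝ (Fin n)) : EuclideanSpace ℝ (Fin n) :=
  c.nabla (fun _ => u) w v

/-- `γ : (-ε, ε) → W` is a geodesic of `∇`. -/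
def IsGeodesic (γ : ℝ → EuclideanSpace ℝ (Fin n)) (ε : ℝ) : Prop :=
  ContDiffOn ℝ ∞ γ (Set.Ioo (-ε) ε) ∧
  (∀ t ∈ Set.Ioo (-ε) ε, γ t ∈ c.dom) ∧
  ∀ t ∈ Set.Ioo (-ε) ε, deriv (deriv γ) t + c.christoffel (γ t) (deriv γ t) (deriv γ t) = 0

/-- `s` is a local geodesic symmetry at `w₀`: a diffeomorphism between neighbourhoods of `w₀` in
`W` that maps `γ(t)` to `γ(-t)` for the geodesics `γ` through `γ(0) = w₀`. -/
structure IsGeodesicSymmetry (w₀ : EuclideanSpace ℝ (Fin n))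
    (s : OpenPartialHomeomorph (EuclideanSpace ℝ (Fin n)) (EuclideanSpace ℝ (Fin n))) : Prop where
  mem_source : w₀ ∈ s.source
  source_subset : s.source ⊆ c.dom
  target_subset : s.target ⊆ c.dom
  smooth : ContDiffOn ℝ ∞ s s.source
  smooth_symm : ContDiffOn ℝ ∞ s.symm s.target
  reverses : ∀ (ε : ℝ) (γ : ℝ → EuclideanSpace ℝ (Fin n)), 0 < ε → c.IsGeodesic γ ε → γ 0 = w₀ →
    (∀ t ∈ Set.Ioo (-ε) ε, γ t ∈ s.source) → ∀ t ∈ Set.Ioo (-ε) ε, s (γ t) = γ (-t)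

/-- `s` is a local affine transformation: it preserves `∇`, i.e. it satisfies the transformation
law of the Christoffel symbols. -/
def IsAffine
    (s : OpenPartialHomeomorph (EuclideanSpace ℝ (Fin n)) (EuclideanSpace ℝ (Fin n))) : Prop :=
  ∀ w ∈ s.source, ∀ v u : EuclideanSpace ℝ (Fin n),
    fderiv ℝ (fun x => fderiv ℝ s x u) w v
      + c.christoffel (s w) (fderiv ℝ s w v) (fderiv ℝ s w u)
      = fderiv ℝ s w (c.christoffel w v u)

end FramedChart

/-- The linear connection `∇` induced by `ω` on `M = P / G` is locally symmetric: at every point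
of every chart of `M`, a local geodesic symmetry is an affine transformation. -/
def InducedConnectionLocallySymmetric : Prop :=
  ∀ (c : S.FramedChart), ∀ w₀ ∈ c.dom, ∃ s, c.IsGeodesicSymmetry w₀ s ∧ c.IsAffine s

/-- `(P, θ, ω)` is a locally symmetric `G`-structure with connection: for every point `π(p)` of
`M`, a local geodesic symmetry `s` at `π(p)` is a local symmetry of the `G`-structure, i.e. it is
covered by a local self-equivalence `Φ` of `(P, θ, ω)`.  In a chart with section `σ` of `P` this
means `Φ(σ(w)) = σ(s(w)) · a(w)`, with `a` smooth and `G`-valued. -/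
def LocallySymmetric : Prop :=
  ∀ p : P, ∃ c : S.FramedChart, ∃ w₀ ∈ c.dom, c.σ w₀ = p ∧
    ∃ s, c.IsGeodesicSymmetry w₀ s ∧
    ∃ Φ : OpenPartialHomeomorph P P, S.IsLocalEquivalence Φ ∧
    ∃ a : EuclideanSpace ℝ (Fin n) → G,
      ContMDiffOn 𝓘(ℝ, EuclideanSpace ℝ (Fin n)) 𝓘(ℝ, EG) ∞ a s.source ∧
      ∀ w ∈ s.source, c.σ w ∈ Φ.source ∧ Φ (c.σ w) = op (a w) • c.σ (s w)

end GStructureWithConnection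

end

/-! Local symmetry forces `T = 0` and `F = 0` because `-1` must lie in `G` and act trivially on `X`.
A geodesic symmetry at `m` reverses every geodesic through `m`, so it fixes `m` with differential
`-1`. A local equivalence covering it sends a point `p` over `m` to `p · g` for some `g` in `G`, and
preservation of `θ` forces `g = -1` on `ℝⁿ`. Thus `p` and `p · g` have the same image in `X`
(`LocallySymmetric.exists_rep_eq_neg`). By equivariance the torsion at `p · g` comes from that at
`p` by applying `-1` to the value and to both arguments, so it equals its own negative. The
translation by `g` carries the horizontal vector over `u` to the one over `-u`, so the derivative
`F(u) f` of an invariant function equals its own negative too (`T_eq_zero_of_rep_eq_neg`,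
`F_eq_zero_of_rep_eq_neg`).

For the converse, `T = 0` leaves `dθ(ξ, η) = ω(η) θ(ξ)` and a pure curvature term in `dω(ξ, η)`
whenever `ξ` is horizontal. As the curvature components descend to `X`, `F = 0` makes them constant
in horizontal directions. Take normal coordinates at `m` with the section of `P` that is parallel
along the rays, and let `κ` be the pullback of `(θ, ω)`. Then `t ↦ t κ(tx) v` solves a linear
equation whose coefficients involve only the curvature at the centre. Replacing `(x, v)` by `(-x,
-v)` and `(θ, ω)` by `(-θ, ω)` preserves this equation, so `θ` is even and `ω` is odd as matrix
functions of `x` (`radial_pullback_symmetric`). The Christoffel symbols in normal coordinates are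
therefore odd, and `x ↦ -x` is affine (`christoffel_neg`, `isAffine_symmetry`).

The link between the algebroid bracket and calculus is the structure equation `formD_pull`: all
differential forms are pulled back to vector spaces and differentiated there. Normal coordinates
come from the radial flow of the horizontal fields, constructed by the implicit function theorem in
a space of curves (`exists_radial_flow`). -/

noncomputable section

set_option linter.unusedSectionVars false

/-! ### Calculus in spaces of continuous functions, and local inverses -/

namespace ContinuousMap

variable {X : Type*} [TopologicalSpace X] [CompactSpace X]

/-- The pointwise application of a continuous family of operators to a continuous function. -/
def applyL (X : Type*) [TopologicalSpace X] [CompactSpace X]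
    (E F : Type*) [NormedAddCommGroup E] [NormedSpace ℝ E]
    [NormedAddCommGroup F] [NormedSpace ℝ F] : C(X, E →L[ℝ] F) →L[ℝ] C(X, E) →L[ℝ] C(X, F) :=
  LinearMap.mkContinuous₂
    (LinearMap.mk₂ ℝ (fun (A : C(X, E →L[ℝ] F)) (γ : C(X, E)) =>
      (⟨fun t => A t (γ t), A.continuous.clm_apply γ.continuous⟩ : C(X, F)))
      (fun _ _ _ => by ext; simp) (fun _ _ _ => by ext; simp)
      (fun _ _ _ => by ext; simp) (fun _ _ _ => by ext; simp)) 1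
    (fun A γ => by
      rw [one_mul, ContinuousMap.norm_le _ (by positivity)]
      intro t
      exact (A t).le_of_opNorm_le_of_le (A.norm_coe_le_norm t) (γ.norm_coe_le_norm t))

@[simp] theorem applyL_apply {E F : Type*} [NormedAddCommGroup E] [NormedSpace ℝ E]
    [NormedAddCommGroup F] [NormedSpace ℝ F] (A : C(X, E →L[ℝ] F)) (γ : C(X, E)) (t : X) :
    applyL X E F A γ t = A t (γ t) := rfl

/-- The remainder at `t` is bounded by the mean value inequality on the segment from `γ t` to `γ t +
η t`. On it the variation of `f'` is at most the sup distance between `f' ∘ (γ + s η)` and `f' ∘ γ`,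
which is small uniformly in `t` by continuity of composition with `f'`. -/
theorem hasFDerivAt_comp_left {E F : Type*} [NormedAddCommGroup E] [NormedSpace ℝ E]
    [NormedAddCommGroup F] [NormedSpace ℝ F] (f : C(E, F)) (f' : C(E, E →L[ℝ] F))
    (hf : ∀ x, HasFDerivAt f (f' x) x) (γ : C(X, E)) :
    HasFDerivAt (fun γ : C(X, E) => f.comp γ) (applyL X E F (f'.comp γ)) γ := by
  rw [hasFDerivAt_iff_isLittleO_nhds_zero, Asymptotics.isLittleO_iff]
  intro ε hε
  have hc : Continuous (fun γ : C(X, E) => f'.comp γ) := ContinuousMap.continuous_postcomp f'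
  obtain ⟨δ, hδ, h⟩ := (Metric.continuous_iff (α := C(X, E)) (β := C(X, E →L[ℝ] F))).1 hc γ ε hε
  filter_upwards [Metric.ball_mem_nhds (0 : C(X, E)) hδ] with η hη
  rw [mem_ball_zero_iff] at hη
  rw [ContinuousMap.norm_le _ (by positivity)]
  intro t
  have hseg : ∀ x ∈ segment ℝ (γ t) (γ t + η t),
      ‖f' x - f' (γ t)‖ ≤ ε := by
    intro x hx
    rw [segment_eq_image'] at hx
    obtain ⟨s, hs, rfl⟩ := hx
    have h1 : dist (γ + s • η) γ < δ := by
      rw [dist_eq_norm, add_sub_cancel_left, norm_smul, Real.norm_of_nonneg hs.1]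
      exact (mul_le_of_le_one_left (norm_nonneg _) hs.2).trans_lt hη
    have h2 := (ContinuousMap.dist_apply_le_dist (f := f'.comp (γ + s • η)) (g := f'.comp γ)
        t).trans
      (h _ h1).le
    rw [dist_eq_norm] at h2
    simpa using h2
  have h3 := (convex_segment (γ t) (γ t + η t)).norm_image_sub_le_of_norm_hasFDerivWithin_le'
    (fun x _ => (hf x).hasFDerivWithinAt) hseg (left_mem_segment ℝ _ _) (right_mem_segment ℝ _ _)
  rw [add_sub_cancel_left] at h3
  exact h3.trans (mul_le_mul_of_nonneg_left (η.norm_coe_le_norm t) hε.le)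

/-- Composition with a smooth map is a smooth map between spaces of continuous functions on a
compact space. -/
theorem contDiff_comp_left_nat {X : Type*} [TopologicalSpace X] [CompactSpace X]
    {E : Type u} [NormedAddCommGroup E] [NormedSpace ℝ E] (k : ℕ) :
    ∀ {F : Type u} [NormedAddCommGroup F] [NormedSpace ℝ F] (f : C(E, F)), ContDiff ℝ k f →
      ContDiff ℝ k (fun γ : C(X, E) => f.comp γ) := by
  -- The derivative of composition with `f` is built from composition with `fderiv ℝ f`, whose
  -- values lie in `E →L[ℝ] F`. So the target varies in the induction, and `E` and `F` share a
  -- universe so that this space of operators stays in it.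
  induction k with
  | zero =>
    intro F _ _ f _
    exact contDiff_zero.2 (ContinuousMap.continuous_postcomp f)
  | succ k ih =>
    intro F _ _ f hf
    have hf' : ContDiff ℝ k (fderiv ℝ f) := hf.fderiv_right (m := k) (by norm_cast)
    have h1 := ih (F := E →L[ℝ] F) ⟨fderiv ℝ f, hf'.continuous⟩ hf'
    have hd : ∀ γ : C(X, E), HasFDerivAt (fun γ : C(X, E) => f.comp γ)
        (applyL X E F ((⟨fderiv ℝ f, hf'.continuous⟩ : C(E, E →L[ℝ] F)).comp γ)) γ := fun γ =>
      hasFDerivAt_comp_left f ⟨fderiv ℝ f, hf'.continuous⟩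
        (fun x => (hf.differentiable (by simp) x).hasFDerivAt) γ
    have h2 : ContDiff ℝ k (fun γ : C(X, E) =>
        applyL X E F ((⟨fderiv ℝ f, hf'.continuous⟩ : C(E, E →L[ℝ] F)).comp γ)) :=
      ContDiff.comp (g := applyL X E F) (ContinuousLinearMap.contDiff _) h1
    have := (contDiff_succ_iff_hasFDerivAt (n := k) (𝕜 := ℝ)
      (f := fun γ : C(X, E) => f.comp γ)).2 ⟨_, h2, hd⟩
    exact_mod_cast this

theorem contDiff_comp_left {X : Type*} [TopologicalSpace X] [CompactSpace X]
    {E F : Type u} [NormedAddCommGroup E] [NormedSpace ℝ E] [NormedAddCommGroup F]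
    [NormedSpace ℝ F] (f : C(E, F)) (hf : ContDiff ℝ ∞ f) :
      ContDiff ℝ ∞ (fun γ : C(X, E) => f.comp γ) :=
  contDiff_infty.2 fun k => contDiff_comp_left_nat k f (hf.of_le (by exact_mod_cast le_top))

end ContinuousMap

/-- The inverse function theorem for smooth maps. -/
theorem ContDiffOn.exists_openPartialHomeomorph {E F : Type*} [NormedAddCommGroup E]
    [NormedSpace ℝ E] [NormedAddCommGroup F] [NormedSpace ℝ F] [CompleteSpace E]
    {f : E → F} {U : Set E} (hf : ContDiffOn ℝ ∞ f U) (hU : IsOpen U) {z : E} (hz : z ∈ U)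
    (hinv : (fderiv ℝ f z).IsInvertible) :
    ∃ e : OpenPartialHomeomorph E F, z ∈ e.source ∧ e.source ⊆ U ∧ (e : E → F) = f ∧
      ContDiffOn ℝ ∞ e.symm e.target ∧ ∀ x ∈ e.source, (fderiv ℝ f x).IsInvertible := by
  obtain ⟨L, hL⟩ := hinv
  have hfz := hf.contDiffAt (hU.mem_nhds hz)
  let e₀ := hfz.toOpenPartialHomeomorph f (f' := L)
    (hL ▸ (hfz.differentiableAt (by simp)).hasFDerivAt) (by simp)
  have hcont : ContinuousOn (fderiv ℝ f) U := hf.continuousOn_fderiv_of_isOpen hU (by simp)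
  -- The inverse is smooth at images of points where the derivative is invertible. These points form
  -- an open set, and the source is cut down to it.
  have hopen := hcont.isOpen_inter_preimage hU (ContinuousLinearEquiv.isOpen (𝕜 := ℝ) (E := E)
      (F := F))
  refine ⟨e₀.restrOpen _ hopen, ⟨hfz.mem_toOpenPartialHomeomorph_source _ _, hz, L, hL⟩,
    fun x hx => hx.2.1, rfl, ?_, fun x hx => hx.2.2⟩
  intro y hy
  have hx := (e₀.restrOpen _ hopen).map_target hy
  obtain ⟨L', hL'⟩ := hx.2.2
  have h1 := hf.contDiffAt (hU.mem_nhds hx.2.1)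
  refine ((e₀.restrOpen _ hopen).contDiffAt_symm (f₀' := L') hy ?_ h1).contDiffWithinAt
  rw [hL']
  exact (h1.differentiableAt (by simp)).hasFDerivAt

namespace ContinuousMap

/-- The primitive vanishing at `0` of a continuous function on `[0, 1]`. -/
def primitiveL (E : Type*) [NormedAddCommGroup E] [NormedSpace ℝ E] :
    C(Set.Icc (0 : ℝ) 1, E) →L[ℝ] C(Set.Icc (0 : ℝ) 1, E) :=
  LinearMap.mkContinuous
    { toFun := fun γ => ⟨fun t => ∫ s in (0 : ℝ)..t, Set.IccExtend zero_le_one γ s,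
        (intervalIntegral.continuous_primitive
          (fun a b => (γ.continuous.Icc_extend' (h := zero_le_one)).intervalIntegrable a b) 0).comp
          continuous_subtype_val⟩
      map_add' := fun γ η => by
        ext t
        exact intervalIntegral.integral_add
          ((γ.continuous.Icc_extend' (h := zero_le_one)).intervalIntegrable _ _)
          ((η.continuous.Icc_extend' (h := zero_le_one)).intervalIntegrable _ _)
      map_smul' := fun c γ => by
        ext t
        exact intervalIntegral.integral_smul c _ } 1
    (fun γ => by
      rw [one_mul, ContinuousMap.norm_le _ (norm_nonneg _)]
      intro t
      refine (intervalIntegral.norm_integral_le_of_norm_le_const (C := ‖γ‖)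
        (fun s _ => γ.norm_coe_le_norm _)).trans ?_
      rw [sub_zero, abs_of_nonneg t.2.1]
      exact mul_le_of_le_one_right (norm_nonneg _) t.2.2)

end ContinuousMap

/-- Multiplication by a bump function. It makes a local vector field global, as is needed to compose
it with arbitrary continuous curves. -/
theorem ContDiffOn.exists_contDiff_eventuallyEq {E F : Type*} [NormedAddCommGroup E]
    [NormedSpace ℝ E] [FiniteDimensional ℝ E] [NormedAddCommGroup F] [NormedSpace ℝ F]
    {f : E → F} {U : Set E} (hf : ContDiffOn ℝ ∞ f U) (hU : IsOpen U) {z : E} (hz : z ∈ U) :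
    ∃ g : E → F, ContDiff ℝ ∞ g ∧ ∃ δ > 0, Metric.ball z δ ⊆ U ∧
      ∀ x ∈ Metric.ball z δ, g x = f x := by
  obtain ⟨ε, hε, hεU⟩ := Metric.isOpen_iff.1 hU z hz
  let χ : ContDiffBump z := ⟨ε / 4, ε / 2, by positivity, by linarith⟩
  refine ⟨fun x => χ x • f x, ?_, ε / 4, by positivity,
    (Metric.ball_subset_ball (by linarith)).trans hεU, ?_⟩
  · rw [contDiff_iff_contDiffAt]
    intro x
    by_cases hx : x ∈ U
    · exact χ.contDiff.contDiffAt.smul (hf.contDiffAt (hU.mem_nhds hx))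
    · have hx' : x ∉ tsupport χ := by
        rw [χ.tsupport_eq]
        intro h
        exact hx (hεU (Metric.closedBall_subset_ball (by change ε / 2 < ε; linarith) h))
      refine (contDiffAt_const (c := (0 : F))).congr_of_eventuallyEq ?_
      filter_upwards [(isClosed_tsupport χ).isOpen_compl.mem_nhds hx'] with y hy
      rw [image_eq_zero_of_notMem_tsupport hy, zero_smul]
  · intro x hx
    have : χ x = 1 := χ.one_of_mem_closedBall (Metric.ball_subset_closedBall hx)
    simp only [this, one_smul]

/-! ### Smooth radial flows from the implicit function theorem -/

/-- The exponential map of a family of vector fields `f · u` depending linearly on `u`: the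
time-one flow of these fields depends smoothly on `u`. -/
theorem exists_radial_flow {V : Type} [NormedAddCommGroup V] [NormedSpace ℝ V] [CompleteSpace V]
    {E : Type u} [NormedAddCommGroup E] [NormedSpace ℝ E] [FiniteDimensional ℝ E]
    {f : E → V →L[ℝ] E} {U : Set E} (hf : ContDiffOn ℝ ∞ f U) (hU : IsOpen U) {z : E}
    (hz : z ∈ U) :
    ∃ r > 0, ∃ σ : V → E, ContDiffOn ℝ ∞ σ (Metric.ball 0 r) ∧ σ 0 = z ∧
      (∀ x ∈ Metric.ball (0 : V) r, σ x ∈ U) ∧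
      ∀ (t : ℝ) (u : V), t • u ∈ Metric.ball (0 : V) r →
        fderiv ℝ σ (t • u) u = f (σ (t • u)) u := by
  have : CompleteSpace E := FiniteDimensional.complete ℝ E
  obtain ⟨g, hg, δ, hδ, hδU, hgf⟩ := hf.exists_contDiff_eventuallyEq hU hz
  let gc : C(E, V →L[ℝ] E) := ⟨g, hg.continuous⟩
  -- A zero of `H (u, ·)` is a curve with `γ t = z + ∫₀ᵗ g (γ s) u ds`, that is, a trajectory of the
  -- field `g · u` from `z`. Since `H (0, γ) = γ - z`, the partial derivative in `γ` at `u = 0` is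
  -- the identity, and the solution depends smoothly on `u` near `0`.
  let H : V × C(Set.Icc (0 : ℝ) 1, E) → C(Set.Icc (0 : ℝ) 1, E) := fun p => p.2 -
      ContinuousMap.const (Set.Icc (0 : ℝ) 1) z -
    ContinuousMap.primitiveL E (ContinuousMap.applyL (Set.Icc (0 : ℝ) 1) V E (gc.comp p.2)
        (ContinuousMap.const (Set.Icc (0 : ℝ) 1) p.1))
  have hconst : ContDiff ℝ ∞ (fun u : V => ContinuousMap.const (Set.Icc (0 : ℝ) 1) u) :=
    (ContinuousLinearMap.mk (R := ℝ) (S := ℝ) (σ := RingHom.id ℝ)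
      { toFun := fun u : V => ContinuousMap.const (Set.Icc (0 : ℝ) 1) u
        map_add' := fun _ _ => rfl
        map_smul' := fun _ _ => rfl } ContinuousMap.continuous_const').contDiff
  have hH : ContDiff ℝ ∞ H := by
    -- Since `V` lives in the lowest universe, `V →L[ℝ] E` lies in the same universe as `E`, which
    -- `contDiff_comp_left` demands.
    have h1 : ContDiff ℝ ∞ (fun p : V × C(Set.Icc (0 : ℝ) 1, E) => gc.comp p.2) :=
      (ContinuousMap.contDiff_comp_left gc hg).comp contDiff_snd
    have h2 : ContDiff ℝ ∞ (fun p : V × C(Set.Icc (0 : ℝ) 1, E) => ContinuousMap.applyL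
        (Set.Icc (0 : ℝ) 1) V E (gc.comp p.2)) :=
      ContDiff.comp (g := ContinuousMap.applyL (Set.Icc (0 : ℝ) 1) V E)
          (ContinuousLinearMap.contDiff _) h1
    have h3 : ContDiff ℝ ∞ (fun p : V × C(Set.Icc (0 : ℝ) 1, E) => ContinuousMap.applyL
        (Set.Icc (0 : ℝ) 1) V E (gc.comp p.2)
        (ContinuousMap.const (Set.Icc (0 : ℝ) 1) p.1)) := h2.clm_apply (hconst.comp contDiff_fst)
    have h4 := ContDiff.comp (g := ContinuousMap.primitiveL E) (ContinuousLinearMap.contDiff _) h3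
    exact (contDiff_snd.sub contDiff_const).sub h4
  let G : V × C(Set.Icc (0 : ℝ) 1, E) → V × C(Set.Icc (0 : ℝ) 1, E) := fun p => (p.1, H p)
  have hG : ContDiff ℝ ∞ G := contDiff_fst.prodMk hH
  let p₀ : V × C(Set.Icc (0 : ℝ) 1, E) := (0, ContinuousMap.const (Set.Icc (0 : ℝ) 1) z)
  have hH0 : ∀ γ : C(Set.Icc (0 : ℝ) 1, E), H (0, γ) = γ - ContinuousMap.const (Set.Icc (0 : ℝ) 1)
      z := by
    intro γ
    ext t
    simp [H]
  have hdH : ∀ η : C(Set.Icc (0 : ℝ) 1, E), fderiv ℝ H p₀ (0, η) = η := by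
    intro η
    have h1 : HasFDerivAt (fun γ : C(Set.Icc (0 : ℝ) 1, E) => H (0, γ))
        ((fderiv ℝ H p₀).comp (ContinuousLinearMap.inr ℝ V C(Set.Icc (0 : ℝ) 1, E)))
            (ContinuousMap.const (Set.Icc (0 : ℝ) 1) z) :=
      ((hH.differentiable (by simp) p₀).hasFDerivAt).comp (ContinuousMap.const (Set.Icc (0 : ℝ) 1)
          z)
        (hasFDerivAt_prodMk_right 0 _)
    have h2 : HasFDerivAt (fun γ : C(Set.Icc (0 : ℝ) 1, E) => H (0, γ)) (ContinuousLinearMap.id ℝ _)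
        (ContinuousMap.const (Set.Icc (0 : ℝ) 1) z) := by
      simp_rw [hH0]
      exact (hasFDerivAt_id _).sub_const _
    exact congrArg (fun L : C(Set.Icc (0 : ℝ) 1, E) →L[ℝ] C(Set.Icc (0 : ℝ) 1, E) => L η)
        (h1.unique h2)
  have hdG : (fderiv ℝ G p₀).IsInvertible := by
    have h1 : ∀ p, fderiv ℝ G p₀ p = (p.1, fderiv ℝ H p₀ p) := by
      intro p
      have := (hasFDerivAt_fst (𝕜 := ℝ) (p := p₀)).prodMk
        (hH.differentiable (by simp) p₀).hasFDerivAt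
      rw [this.fderiv]
      rfl
    have h2 : ∀ p : V × C(Set.Icc (0 : ℝ) 1, E), fderiv ℝ H p₀ p = fderiv ℝ H p₀ (p.1, 0) + p.2 :=
        by
      intro p
      have h3 : fderiv ℝ H p₀ (p.1, 0) + fderiv ℝ H p₀ (0, p.2) = fderiv ℝ H p₀ p := by
        rw [← map_add, Prod.mk_add_mk, add_zero, zero_add]
      rw [← h3, hdH]
    refine ContinuousLinearMap.IsInvertible.of_inverse
      (g := (ContinuousLinearMap.fst ℝ V C(Set.Icc (0 : ℝ) 1, E)).prod
          (ContinuousLinearMap.snd ℝ V C(Set.Icc (0 : ℝ) 1, E) -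
        (fderiv ℝ H p₀).comp ((ContinuousLinearMap.inl ℝ V C(Set.Icc (0 : ℝ) 1, E)).comp
          (ContinuousLinearMap.fst ℝ V C(Set.Icc (0 : ℝ) 1, E))))) ?_ ?_
    · refine ContinuousLinearMap.ext fun p => ?_
      simp only [ContinuousLinearMap.comp_apply, h1]
      rw [h2]
      simp
    · refine ContinuousLinearMap.ext fun p => ?_
      simp only [ContinuousLinearMap.comp_apply, ContinuousLinearMap.prod_apply, h1]
      simp [h2 p]
  obtain ⟨e, hp₀, -, heG, hesymm, -⟩ := hG.contDiffOn.exists_openPartialHomeomorph isOpen_univ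
    (Set.mem_univ p₀) hdG
  have hGp₀ : G p₀ = (0, 0) := by
    simp only [G, p₀, hH0, sub_self]
  have h0t : ((0 : V), (0 : C(Set.Icc (0 : ℝ) 1, E))) ∈ e.target := by
    rw [← hGp₀, ← heG]; exact e.map_source hp₀
  let ψ : V → C(Set.Icc (0 : ℝ) 1, E) := fun u => (e.symm (u, 0)).2
  have hψ0 : ψ 0 = ContinuousMap.const (Set.Icc (0 : ℝ) 1) z := by
    have : e.symm (0, 0) = p₀ := by rw [← hGp₀, ← heG]; exact e.left_inv hp₀
    simp only [ψ, this, p₀]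
  have hψG : ∀ u, (u, (0 : C(Set.Icc (0 : ℝ) 1, E))) ∈ e.target → e.symm (u, 0) = (u, ψ u) ∧ H
      (u, ψ u) = 0 := by
    intro u hu
    have h1 : G (e.symm (u, 0)) = (u, 0) := by rw [← heG]; exact e.right_inv hu
    have h2 : (e.symm (u, 0)).1 = u := congrArg Prod.fst h1
    have h3 : e.symm (u, 0) = (u, ψ u) := Prod.ext h2 rfl
    refine ⟨h3, ?_⟩
    rw [← h3]
    exact congrArg Prod.snd h1
  have hψU : ∀ u γ, (u, γ) ∈ e.source → H (u, γ) = 0 → ψ u = γ := by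
    intro u γ hu hγ
    have h1 : e (u, γ) = (u, 0) := by rw [heG]; exact Prod.ext rfl hγ
    simp only [ψ, ← h1, e.left_inv hu]
  obtain ⟨ε, hε, hεs⟩ := Metric.isOpen_iff.1 e.open_source p₀ hp₀
  have hT : IsOpen {u : V | (u, (0 : C(Set.Icc (0 : ℝ) 1, E))) ∈ e.target} :=
    e.open_target.preimage (by fun_prop : Continuous fun u : V =>
        (u, (0 : C(Set.Icc (0 : ℝ) 1, E))))
  have hψs : ContDiffOn ℝ ∞ ψ {u : V | (u, (0 : C(Set.Icc (0 : ℝ) 1, E))) ∈ e.target} :=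
    (hesymm.comp (contDiff_id.prodMk contDiff_const).contDiffOn fun u hu => hu).snd
  -- The bound `ε` keeps the curves where the solution is unique; the bound `δ` keeps their values
  -- where `g` agrees with `f`.
  have hnear : ∀ᶠ u in nhds (0 : V), dist (ψ u) (ContinuousMap.const (Set.Icc (0 : ℝ) 1) z) < min ε
      δ := by
    have h1 := (hψs.continuousOn.continuousAt (hT.mem_nhds h0t))
    rw [ContinuousAt, hψ0] at h1
    exact h1 (Metric.ball_mem_nhds _ (lt_min hε hδ))
  obtain ⟨r, hr, hball⟩ := Metric.eventually_nhds_iff_ball.1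
    ((hT.eventually_mem h0t).and (hnear.and (Metric.ball_mem_nhds (0 : V) hε)))
  let one : Set.Icc (0 : ℝ) 1 := ⟨1, by simp⟩
  let σ : V → E := fun u => ψ u one
  have hσ : ContDiffOn ℝ ∞ σ (Metric.ball 0 r) :=
    ContDiff.comp_contDiffOn (g := ContinuousMap.evalCLM ℝ one)
      (ContinuousLinearMap.contDiff _) (hψs.mono fun u hu => (hball u hu).1)
  have hψball : ∀ u ∈ Metric.ball (0 : V) r, ∀ t, ψ u t ∈ Metric.ball z δ := by
    intro u hu t
    exact (ContinuousMap.dist_apply_le_dist (g := ContinuousMap.const (Set.Icc (0 : ℝ) 1) z)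
        t).trans_lt
      ((hball u hu).2.1.trans_le (min_le_right _ _))
  have hψint : ∀ u ∈ Metric.ball (0 : V) r, ∀ t : Set.Icc (0 : ℝ) 1,
      ψ u t = z + ∫ s in (0 : ℝ)..t, g (Set.IccExtend zero_le_one (ψ u) s) u := by
    intro u hu t
    have h1 := congrArg (fun γ : C(Set.Icc (0 : ℝ) 1, E) => γ t) (hψG u (hball u hu).1).2
    simp only [H, ContinuousMap.sub_apply, ContinuousMap.zero_apply, sub_sub, sub_eq_zero] at h1
    exact h1
  -- The slowed-down curve `s ↦ ψ u (t s)` solves the equation with parameter `t • u`. By local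
  -- uniqueness it is `ψ (t • u)`, and its value at `s = 1` is `σ (t • u)`.
  have hscale : ∀ u ∈ Metric.ball (0 : V) r, ∀ t : Set.Icc (0 : ℝ) 1, ψ u t = σ ((t : ℝ) • u) := by
    intro u hu t
    let γ : C(Set.Icc (0 : ℝ) 1, E) := ⟨fun s => ψ u ⟨t * s, unitInterval.mul_mem t.2 s.2⟩, by
        fun_prop⟩
    have hnorm : ‖(t : ℝ) • u‖ ≤ ‖u‖ := by
      rw [norm_smul, Real.norm_of_nonneg t.2.1]
      exact mul_le_of_le_one_left (norm_nonneg _) t.2.2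
    have h1 : ((t : ℝ) • u, γ) ∈ e.source := by
      refine hεs ?_
      rw [Metric.mem_ball, Prod.dist_eq, max_lt_iff]
      constructor
      · have := (hball u hu).2.2
        rw [dist_zero_right] at this
        change dist ((t : ℝ) • u) 0 < ε
        rw [dist_zero_right]
        exact hnorm.trans_lt this
      · refine lt_of_le_of_lt ?_ ((hball u hu).2.1.trans_le (min_le_left _ _))
        rw [ContinuousMap.dist_le dist_nonneg]
        intro s
        exact ContinuousMap.dist_apply_le_dist (f := ψ u) (g := ContinuousMap.const
            (Set.Icc (0 : ℝ) 1) z) _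
    have h2 : H ((t : ℝ) • u, γ) = 0 := by
      ext s
      simp only [H, ContinuousMap.sub_apply, ContinuousMap.zero_apply, sub_sub, sub_eq_zero]
      have h3 : γ s = _ := hψint u hu ⟨t * s, unitInterval.mul_mem t.2 s.2⟩
      rw [h3]
      congr 1
      have h4 := intervalIntegral.smul_integral_comp_mul_left (a := (0 : ℝ)) (b := s)
        (fun τ => g (Set.IccExtend zero_le_one (ψ u) τ) u) (t : ℝ)
      rw [mul_zero] at h4
      rw [← h4, ← intervalIntegral.integral_smul]
      refine intervalIntegral.integral_congr fun τ hτ => ?_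
      rw [Set.uIcc_of_le s.2.1] at hτ
      have hτI : τ ∈ Set.Icc (0 : ℝ) 1 := ⟨hτ.1, hτ.2.trans s.2.2⟩
      simp only [Set.IccExtend_of_mem zero_le_one _ hτI,
        Set.IccExtend_of_mem zero_le_one (ψ u) (unitInterval.mul_mem t.2 hτI),
        ContinuousMap.applyL_apply, ContinuousMap.const_apply, map_smul]
      rfl
    have h5 := hψU _ γ h1 h2
    simp only [σ, h5]
    change _ = ψ u ⟨t * 1, _⟩
    simp only [mul_one]
  have hray : ∀ u ∈ Metric.ball (0 : V) r, ∀ t : Set.Icc (0 : ℝ) 1,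
      fderiv ℝ σ ((t : ℝ) • u) u = f (σ ((t : ℝ) • u)) u := by
    intro u hu t
    have htu : (t : ℝ) • u ∈ Metric.ball (0 : V) r := by
      rw [mem_ball_zero_iff] at hu ⊢
      refine lt_of_le_of_lt ?_ hu
      rw [norm_smul, Real.norm_of_nonneg t.2.1]
      exact mul_le_of_le_one_left (norm_nonneg _) t.2.2
    have h1 : HasDerivWithinAt (fun s : ℝ => σ (s • u)) (fderiv ℝ σ ((t : ℝ) • u) u)
        (Set.Icc (0 : ℝ) 1) t := by
      have h2 := ((hσ.contDiffAt (Metric.isOpen_ball.mem_nhds htu)).differentiableAt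
        (by simp)).hasFDerivAt
      have h3 : HasDerivAt (fun s : ℝ => s • u) u t := by
        simpa using (hasDerivAt_id (t : ℝ)).smul_const u
      exact (h2.comp_hasDerivAt (t : ℝ) h3).hasDerivWithinAt
    have hcont : Continuous fun s => g (Set.IccExtend zero_le_one (ψ u) s) u :=
      (hg.continuous.comp ((ψ u).continuous.Icc_extend' (h := zero_le_one))).clm_apply
        continuous_const
    have h2 : HasDerivWithinAt (fun s : ℝ => σ (s • u)) (f (σ ((t : ℝ) • u)) u) (Set.Icc (0 : ℝ) 1)
        t := by
      have h3 := (intervalIntegral.integral_hasDerivAt_right (hcont.intervalIntegrable 0 t)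
        (hcont.stronglyMeasurableAtFilter _ _) hcont.continuousAt).const_add z
      have h4 : g (Set.IccExtend zero_le_one (ψ u) t) u = f (σ ((t : ℝ) • u)) u := by
        rw [Set.IccExtend_of_mem zero_le_one _ t.2, ← hscale u hu, hgf _ (hψball u hu _)]
      rw [h4] at h3
      refine h3.hasDerivWithinAt.congr_of_mem (fun s hs => ?_) t.2
      rw [← hψint u hu ⟨s, hs⟩, hscale u hu ⟨s, hs⟩]
    exact ((uniqueDiffOn_Icc zero_lt_one) t t.2).eq_deriv _ h1 h2
  refine ⟨r, hr, σ, hσ, ?_, fun x hx => hδU (hψball x hx _), fun t u htu => ?_⟩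
  · simp only [σ, hψ0, ContinuousMap.const_apply]
  -- `hray` only treats `t` in `[0, 1]` and `u` in the ball. For `t ≠ 0` it is applied to the vector
  -- `t • u` at time `1` and `t` is cancelled. For `t = 0` the vector `u` may be large, so it is
  -- first shrunk to `c • u` in the ball.
  · by_cases ht : t = 0
    · subst ht
      obtain ⟨c, hc, hcu⟩ : ∃ c : ℝ, c ≠ 0 ∧ c • u ∈ Metric.ball (0 : V) r := by
        have h1 : Filter.Tendsto (fun c : ℝ => c • u) (nhdsWithin 0 {0}ᶜ) (nhds 0) := by
          have : ContinuousAt (fun c : ℝ => c • u) 0 := by fun_prop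
          rw [ContinuousAt, zero_smul] at this
          exact this.mono_left nhdsWithin_le_nhds
        obtain ⟨c, hc, hc'⟩ := ((h1.eventually_mem (Metric.ball_mem_nhds 0 hr)).and
            self_mem_nhdsWithin).exists
        exact ⟨c, hc', hc⟩
      have h2 := hray _ hcu ⟨0, by simp ⟩
      simp only [zero_smul, map_smul] at h2 ⊢
      exact smul_right_injective E hc h2
    · have h2 := hray _ htu one
      simp only [one, one_smul, map_smul] at h2
      exact smul_right_injective E ht h2

/-! ### Exterior derivatives of vector-valued forms and parity in the radial gauge -/

/-- The exterior derivative of the vector-valued 1-form `κ`. -/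
def formD {E V : Type*} [NormedAddCommGroup E] [NormedSpace ℝ E] [NormedAddCommGroup V]
    [NormedSpace ℝ V] (κ : E → E →L[ℝ] V) (z ξ η : E) : V :=
  fderiv ℝ κ z ξ η - fderiv ℝ κ z η ξ

theorem formD_smul_left {E V : Type*} [NormedAddCommGroup E] [NormedSpace ℝ E]
    [NormedAddCommGroup V] [NormedSpace ℝ V] (κ : E → E →L[ℝ] V) (z : E) (c : ℝ) (ξ η : E) :
    formD κ z (c • ξ) η = c • formD κ z ξ η := by
  simp [formD, smul_sub]

theorem formD_smul_right {E V : Type*} [NormedAddCommGroup E] [NormedSpace ℝ E]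
    [NormedAddCommGroup V] [NormedSpace ℝ V] (κ : E → E →L[ℝ] V) (z : E) (c : ℝ) (ξ η : E) :
    formD κ z ξ (c • η) = c • formD κ z ξ η := by
  simp [formD, smul_sub]

/-- The exterior derivative commutes with pullback. -/
theorem formD_pullback {E E' V : Type*} [NormedAddCommGroup E] [NormedSpace ℝ E]
    [NormedAddCommGroup E'] [NormedSpace ℝ E'] [NormedAddCommGroup V] [NormedSpace ℝ V]
    {κ : E → E →L[ℝ] V} {κ' : E' → E' →L[ℝ] V} {g : E' → E} {x : E'}
    (hκ' : κ' =ᶠ[nhds x] fun y => (κ (g y)).comp (fderiv ℝ g y))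
    (hκ : DifferentiableAt ℝ κ (g x)) (hg : ContDiffAt ℝ 2 g x) (ξ η : E') :
    formD κ' x ξ η = formD κ (g x) (fderiv ℝ g x ξ) (fderiv ℝ g x η) := by
  have h1 : DifferentiableAt ℝ (fderiv ℝ g) x :=
    (hg.fderiv_right (m := 1) (by norm_num)).differentiableAt (by simp)
  have h2 : HasFDerivAt (fun y => κ (g y)) ((fderiv ℝ κ (g x)).comp (fderiv ℝ g x)) x :=
    hκ.hasFDerivAt.comp x (hg.differentiableAt (by simp)).hasFDerivAt
  have h3 := (h2.clm_comp h1.hasFDerivAt).congr_of_eventuallyEq hκ'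
  have h4 : ∀ ξ η, fderiv ℝ κ' x ξ η = fderiv ℝ κ (g x) (fderiv ℝ g x ξ) (fderiv ℝ g x η)
      + κ (g x) (fderiv ℝ (fderiv ℝ g) x ξ η) := by
    intro ξ η
    rw [h3.fderiv]
    simp [add_comm]
  have h5 : IsSymmSndFDerivAt ℝ g x := hg.isSymmSndFDerivAt (by simp)
  rw [formD, h4, h4, formD, h5.eq ξ η]
  abel

theorem formD_const_comp {E V W : Type*} [NormedAddCommGroup E] [NormedSpace ℝ E]
    [NormedAddCommGroup V] [NormedSpace ℝ V] [NormedAddCommGroup W] [NormedSpace ℝ W]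
        (A : V →L[ℝ] W)
    {κ : E → E →L[ℝ] V} {z : E} (hκ : DifferentiableAt ℝ κ z) (ξ η : E) :
    formD (fun y => A.comp (κ y)) z ξ η = A (formD κ z ξ η) := by
  have h1 := ((hasFDerivAt_const A z).clm_comp hκ.hasFDerivAt).fderiv
  rw [formD, formD, h1]
  simp

/-- Differentiating `κ y y = j y` in the direction `v` gives `κ y v + (D_v κ) y = j v`. This trades
the undifferentiated term of the product rule for the missing half of the exterior derivative, so a
radially normalised form satisfies a differential equation along rays governed by `dκ`. -/
theorem hasDerivAt_smul_comp_smul {V W : Type*} [NormedAddCommGroup V] [NormedSpace ℝ V]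
    [NormedAddCommGroup W] [NormedSpace ℝ W] {κ : V → V →L[ℝ] W} (j : V →L[ℝ] W) {t : ℝ} {x : V}
    (hκ : DifferentiableAt ℝ κ (t • x)) (hj : ∀ᶠ y in nhds (t • x), κ y y = j y) (v : V) :
    HasDerivAt (fun s : ℝ => s • κ (s • x) v) (j v + formD κ (t • x) x (t • v)) t := by
  have h1 : HasDerivAt (fun s : ℝ => s • x) x t := by
    simpa using (hasDerivAt_id t).smul_const x
  have h2 : HasDerivAt (fun s : ℝ => κ (s • x)) (fderiv ℝ κ (t • x) x) t :=
    hκ.hasFDerivAt.comp_hasDerivAt t h1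
  have h3 := (hasDerivAt_id t).smul (h2.clm_apply (hasDerivAt_const t v))
  simp only [id, map_zero, add_zero, one_smul] at h3
  refine h3.congr_deriv ?_
  have h4 : κ (t • x) v + fderiv ℝ κ (t • x) v (t • x) = j v := by
    have h5 := hκ.hasFDerivAt.clm_apply (hasFDerivAt_id (t • x))
    have h7 := h5.unique ((j.hasFDerivAt (x := t • x)).congr_of_eventuallyEq hj)
    have h8 := congrArg (fun M : V →L[ℝ] W => M v) h7
    simpa using h8
  rw [← h4]
  simp [formD]
  abel

/-- In the exponential gauge `σ` of a Cartan connection `κ = (θ, ω)` without torsion and with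
parallel curvature, `σ^*θ` is even and `σ^*ω` is odd. -/
theorem radial_pullback_symmetric {V₁ V₂ E : Type*} [NormedAddCommGroup V₁] [NormedSpace ℝ V₁]
    [NormedAddCommGroup V₂] [NormedSpace ℝ V₂] [NormedAddCommGroup E] [NormedSpace ℝ E]
    {κ : E → E →L[ℝ] V₁ × V₂} {U : Set E} (hU : IsOpen U) (hκ : ContDiffOn ℝ ∞ κ U)
    (hinv : ∀ z ∈ U, (κ z).IsInvertible)
    {L : V₂ → V₁ → V₁} (hL : ∀ β u, L β (-u) = -L β u) {R : E → V₁ → V₁ → V₂}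
    (hd : ∀ z ∈ U, ∀ ξ η, (κ z ξ).2 = 0 →
      formD κ z ξ η = (L (κ z η).2 (κ z ξ).1, R z (κ z ξ).1 (κ z η).1))
    (hRd : ∀ z ∈ U, ∀ u v, DifferentiableAt ℝ (fun z => R z u v) z)
    (hR : ∀ z ∈ U, ∀ ξ, (κ z ξ).2 = 0 → ∀ u v, fderiv ℝ (fun z => R z u v) z ξ = 0)
    {r : ℝ} {σ : V₁ → E} (hσ : ContDiffOn ℝ ∞ σ (Metric.ball 0 r))
    (hσU : ∀ x ∈ Metric.ball (0 : V₁) r, σ x ∈ U)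
    (hray : ∀ (t : ℝ) (u : V₁), t • u ∈ Metric.ball (0 : V₁) r →
      κ (σ (t • u)) (fderiv ℝ σ (t • u) u) = (u, 0))
    {x : V₁} (hx : x ∈ Metric.ball (0 : V₁) r) (v : V₁) :
    (κ (σ (-x)) (fderiv ℝ σ (-x) v)).1 = (κ (σ x) (fderiv ℝ σ x v)).1 ∧
    (κ (σ (-x)) (fderiv ℝ σ (-x) v)).2 = -(κ (σ x) (fderiv ℝ σ x v)).2 := by
  let κ' : V₁ → V₁ →L[ℝ] V₁ × V₂ := fun y => (κ (σ y)).comp (fderiv ℝ σ y)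
  have hσat : ∀ y ∈ Metric.ball (0 : V₁) r, ContDiffAt ℝ ∞ σ y := fun y hy =>
    hσ.contDiffAt (Metric.isOpen_ball.mem_nhds hy)
  have hκat : ∀ z ∈ U, DifferentiableAt ℝ κ z := fun z hz =>
    (hκ.contDiffAt (hU.mem_nhds hz)).differentiableAt (by simp)
  have hκ' : ∀ y ∈ Metric.ball (0 : V₁) r, DifferentiableAt ℝ κ' y := by
    intro y hy
    have h1 : DifferentiableAt ℝ (fderiv ℝ σ) y :=
      ((hσat y hy).fderiv_right (m := 1) (by norm_cast)).differentiableAt (by simp)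
    exact ((hκat _ (hσU y hy)).comp y ((hσat y hy).differentiableAt (by simp))).clm_comp h1
  have hz : σ 0 ∈ U := hσU 0 (Metric.mem_ball_self (Metric.pos_of_mem_ball hx))
  obtain ⟨K, hK⟩ := hinv _ hz
  have hK' : ∀ a, κ (σ 0) (K.symm a) = a := fun a => by rw [← hK]; exact K.apply_symm_apply a
  have hmodel : ∀ u b, formD κ (σ 0) (K.symm (u, 0)) (K.symm b) = (L b.2 u, R (σ 0) u b.1) := by
    intro u b
    rw [hd _ hz _ _ (by rw [hK']), hK', hK']
  -- `R` is not assumed bilinear. At `σ 0` it is a component of `dκ` in the basis given by `κ`, and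
  -- the sign moves through the bilinearity of `formD`.
  have hRneg : ∀ u w, R (σ 0) (-u) w = R (σ 0) u (-w) := by
    intro u w
    have h1 := congrArg Prod.snd (hmodel (-u) (w, 0))
    have h2 := congrArg Prod.snd (hmodel u (-w, 0))
    have h3 : ((-u, 0) : V₁ × V₂) = (-1 : ℝ) • (u, 0) := by simp
    have h4 : ((-w, 0) : V₁ × V₂) = (-1 : ℝ) • (w, 0) := by simp
    rw [h3, map_smul, formD_smul_left] at h1
    rw [h4, map_smul, formD_smul_right] at h2
    exact h1.symm.trans (by simpa using h2)
  have htx : ∀ x ∈ Metric.ball (0 : V₁) r, ∀ t ∈ Set.Icc (0 : ℝ) 1,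
      t • x ∈ Metric.ball (0 : V₁) r := by
    intro x hx t ht
    rw [mem_ball_zero_iff] at hx ⊢
    refine lt_of_le_of_lt ?_ hx
    rw [norm_smul, Real.norm_of_nonneg ht.1]
    exact mul_le_of_le_one_left (norm_nonneg _) ht.2
  have hcurve : ∀ x t, t • x ∈ Metric.ball (0 : V₁) r →
      HasDerivAt (fun s : ℝ => σ (s • x)) (fderiv ℝ σ (t • x) x) t := by
    intro x t ht
    have h3 : HasDerivAt (fun s : ℝ => s • x) x t := by
      simpa using (hasDerivAt_id t).smul_const x
    exact ((hσat _ ht).differentiableAt (by simp)).hasFDerivAt.comp_hasDerivAt t h3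
  -- Rays are horizontal by `hray`, so the curvature keeps its central value along them and the
  -- equation in `hode` has constant coefficients.
  have hRconst : ∀ x ∈ Metric.ball (0 : V₁) r, ∀ t ∈ Set.Icc (0 : ℝ) 1, ∀ u w,
      R (σ (t • x)) u w = R (σ 0) u w := by
    intro x hx t ht u w
    have hder : ∀ s ∈ Set.Icc (0 : ℝ) 1, HasDerivAt (fun s : ℝ => R (σ (s • x)) u w) 0 s := by
      intro s hs
      have hsx := htx x hx s hs
      have h1 := ((hRd _ (hσU _ hsx) u w).hasFDerivAt).comp_hasDerivAt s (hcurve x s hsx)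
      rwa [hR _ (hσU _ hsx) _ (by rw [hray s x hsx])] at h1
    have h2 := constant_of_has_deriv_right_zero (f := fun s : ℝ => R (σ (s • x)) u w)
      (fun s hs => (hder s hs).continuousAt.continuousWithinAt)
      (fun s hs => (hder s ⟨hs.1, hs.2.le⟩).hasDerivWithinAt) t ht
    simpa using h2
  have hode : ∀ x ∈ Metric.ball (0 : V₁) r, ∀ v, ∀ t ∈ Set.Icc (0 : ℝ) 1,
      HasDerivAt (fun s : ℝ => s • κ' (s • x) v)
        ((v, 0) + (L (t • κ' (t • x) v).2 x, R (σ 0) x (t • κ' (t • x) v).1)) t := by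
    intro x hx v t ht
    have hy := htx x hx t ht
    have h1 := hasDerivAt_smul_comp_smul (ContinuousLinearMap.inl ℝ V₁ V₂) (hκ' _ hy) (by
      filter_upwards [Metric.isOpen_ball.mem_nhds hy] with y hy
      have := hray 1 y (by rwa [one_smul])
      rwa [one_smul] at this) v
    refine h1.congr_deriv ?_
    have h7 := hray t x hy
    rw [formD_pullback (κ := κ) (g := σ) (Filter.EventuallyEq.refl _ _)
      (hκat _ (hσU _ hy)) ((hσat _ hy).of_le (by norm_cast)),
      hd _ (hσU _ hy) _ _ (by rw [h7]), h7, hRconst x hx t ht, map_smul, map_smul]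
    rfl
  have hnx : -x ∈ Metric.ball (0 : V₁) r := by simpa using hx
  -- Expressing the right-hand side through `fderiv ℝ κ (σ 0)` exhibits it as a continuous linear
  -- map of `b`, hence as Lipschitz.
  let M : V₁ × V₂ →L[ℝ] V₁ × V₂ := (fderiv ℝ κ (σ 0) (K.symm (x, 0)) -
    (fderiv ℝ κ (σ 0)).flip (K.symm (x, 0))).comp (K.symm : V₁ × V₂ →L[ℝ] E)
  have hM : ∀ b, M b = (L b.2 x, R (σ 0) x b.1) := fun b => by
    rw [← hmodel x b]; rfl
  -- The solution for `(-x, -v)` with its first component negated solves the equation for `(x, v)`: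
  -- `L` is odd in its vector argument, and `hRneg` shifts the sign of `x` onto the first component.
  -- Both solutions vanish at `0`, and comparison at time `1` gives the parity.
  have huniq := ODE_solution_unique (v := fun _ b => (v, 0) + M b) (K := ‖M‖₊)
    (f := fun s : ℝ => s • κ' (s • x) v)
    (g := fun s : ℝ => (-(s • κ' (s • (-x)) (-v)).1, (s • κ' (s • (-x)) (-v)).2))
    (a := 0) (b := 1) (fun _ => by
      have := (LipschitzWith.const ((v, 0) : V₁ × V₂)).add M.lipschitz
      rwa [zero_add] at this)
    (fun t ht => (hode x hx v t ht).continuousAt.continuousWithinAt)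
    (fun t ht => by
      rw [hM]; exact (hode x hx v t ⟨ht.1, ht.2.le⟩).hasDerivWithinAt)
    (fun t ht => by
      have := (hode (-x) hnx (-v) t ht).continuousAt
      exact (this.fst.neg.prodMk this.snd).continuousWithinAt)
    (fun t ht => by
      have h1 := hode (-x) hnx (-v) t ⟨ht.1, ht.2.le⟩
      have h2 := ((-ContinuousLinearMap.fst ℝ V₁ V₂).prod
        (ContinuousLinearMap.snd ℝ V₁ V₂)).hasFDerivAt.comp_hasDerivAt t h1
      refine (h2.congr_deriv ?_).hasDerivWithinAt
      rw [hM, hL, hRneg]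
      ext <;> simp [add_comm])
    (by simp; rfl) (Set.right_mem_Icc.2 zero_le_one)
  simp only [one_smul, map_neg, Prod.fst_neg, Prod.snd_neg, neg_neg] at huniq
  have h1 := congrArg Prod.fst huniq
  have h2 := congrArg Prod.snd huniq
  refine ⟨h1.symm, ?_⟩
  change (κ' (-x) v).2 = - (κ' x v).2
  rw [h2, neg_neg]

/-! ### Christoffel symbols of a coframe, and uniqueness of geodesics -/

section Christoffel

variable {V W : Type*} [NormedAddCommGroup V] [NormedSpace ℝ V] [NormedAddCommGroup W]
  [NormedSpace ℝ W]

/-- The Christoffel symbols, at `w`, of the linear connection on `V` with the connection form `A`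
with respect to the coframe `Θ`. -/
def coframeChristoffel (Θ : V → V →L[ℝ] V) (A : V → V →L[ℝ] V →L[ℝ] V) (w v u : V) : V :=
  (Θ w).inverse (fderiv ℝ Θ w v u + A w v (Θ w u))

/-- The transformation law of Christoffel symbols under a change `φ` of coordinates and a change
`N` of the frame. -/
theorem coframeChristoffel_transformation {Θ Θ' : V → V →L[ℝ] V} {A A' : V → V →L[ℝ] V →L[ℝ] V}
    {φ : V → V} {N : V → V →L[ℝ] V} {x : V} (hφ : ContDiffAt ℝ 2 φ x)
    (hN : DifferentiableAt ℝ N x) (hΘ : DifferentiableAt ℝ Θ (φ x))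
    (hΘ' : DifferentiableAt ℝ Θ' x) (hinv : (Θ (φ x)).IsInvertible) (hinv' : (Θ' x).IsInvertible)
    (h1 : ∀ᶠ y in nhds x, ∀ v, N y (Θ' y v) = Θ (φ y) (fderiv ℝ φ y v))
    (h2 : ∀ v, (N x).comp (A' x v) = (A (φ x) (fderiv ℝ φ x v)).comp (N x) + fderiv ℝ N x v)
    (v u : V) :
    fderiv ℝ (fun y => fderiv ℝ φ y u) x v
      + coframeChristoffel Θ A (φ x) (fderiv ℝ φ x v) (fderiv ℝ φ x u)
      = fderiv ℝ φ x (coframeChristoffel Θ' A' x v u) := by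
  have hφ1 : DifferentiableAt ℝ φ x := hφ.differentiableAt (by simp)
  have hφ2 : DifferentiableAt ℝ (fderiv ℝ φ) x :=
    (hφ.fderiv_right (m := 1) (by norm_num)).differentiableAt (by simp)
  have hφu := hφ2.hasFDerivAt.clm_apply (hasFDerivAt_const u x)
  -- The two sides of `N (Θ' u) = Θ (φ' u)` are differentiated in the direction `v`. The derivative
  -- of `N` that appears is eliminated with `h2`.
  have hl := hN.hasFDerivAt.clm_apply (hΘ'.hasFDerivAt.clm_apply (hasFDerivAt_const u x))
  have hr := (hΘ.hasFDerivAt.comp x hφ1.hasFDerivAt).clm_apply hφu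
  have h3 := (hl.congr_of_eventuallyEq (h1.mono fun y hy => (hy u).symm)).unique hr
  have h4 := congrArg (fun L : V →L[ℝ] V => L v) h3
  have h5 := congrArg (fun L : V →L[ℝ] V => L (Θ' x u)) (h2 v)
  have h6 := h1.self_of_nhds
  simp only [ContinuousLinearMap.coe_comp, Function.comp_apply, add_apply] at h5
  rw [h6] at h5
  apply hinv.injective
  rw [map_add, ← h6, hφu.fderiv]
  simp only [coframeChristoffel, hinv.self_apply_inverse, hinv'.self_apply_inverse, map_add, h5]
  simp at h4
  simp
  rw [← sub_eq_zero] at h4 ⊢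
  rw [← neg_eq_zero, ← h4]
  abel

/-- A radial map pulling the coframe and the connection form back to radially constant ones maps
the rays to geodesics. -/
theorem coframeChristoffel_geodesic {Θ Θ' : V → V →L[ℝ] V} {A A' : V → V →L[ℝ] V →L[ℝ] V}
    {φ : V → V} {N : V → V →L[ℝ] V} {x : V} {t : ℝ} (hφ : ContDiffAt ℝ 2 φ (t • x))
    (hN : DifferentiableAt ℝ N (t • x)) (hΘ : DifferentiableAt ℝ Θ (φ (t • x)))
    (hΘ' : DifferentiableAt ℝ Θ' (t • x)) (hinv : (Θ (φ (t • x))).IsInvertible)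
    (hinv' : (Θ' (t • x)).IsInvertible)
    (h1 : ∀ᶠ y in nhds (t • x), ∀ v, N y (Θ' y v) = Θ (φ y) (fderiv ℝ φ y v))
    (h2 : ∀ v, (N (t • x)).comp (A' (t • x) v)
      = (A (φ (t • x)) (fderiv ℝ φ (t • x) v)).comp (N (t • x)) + fderiv ℝ N (t • x) v)
    (h3 : ∀ᶠ r in nhds t, Θ' (r • x) x = x) (h4 : A' (t • x) x = 0) :
    deriv (deriv fun r : ℝ => φ (r • x)) t + coframeChristoffel Θ A (φ (t • x))
      (deriv (fun r : ℝ => φ (r • x)) t) (deriv (fun r : ℝ => φ (r • x)) t) = 0 := by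
  have hray : ∀ r : ℝ, HasDerivAt (fun r : ℝ => r • x) x r := fun r => by
    simpa using (hasDerivAt_id r).smul_const x
  have hφ1 : ∀ᶠ r : ℝ in nhds t, DifferentiableAt ℝ φ (r • x) := by
    have h5 : ∀ᶠ y in nhds (t • x), DifferentiableAt ℝ φ y :=
      (hφ.eventually (by simp)).mono fun y hy => hy.differentiableAt (by simp)
    exact (hray t).continuousAt.eventually h5
  have hd : ∀ᶠ r in nhds t, deriv (fun r : ℝ => φ (r • x)) r = fderiv ℝ φ (r • x) x :=
    hφ1.mono fun r hr => (hr.hasFDerivAt.comp_hasDerivAt r (hray r)).deriv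
  have hφ2 : DifferentiableAt ℝ (fderiv ℝ φ) (t • x) :=
    (hφ.fderiv_right (m := 1) (by norm_num)).differentiableAt (by simp)
  have hφu := hφ2.hasFDerivAt.clm_apply (hasFDerivAt_const x (t • x))
  have hdd : deriv (deriv fun r : ℝ => φ (r • x)) t
      = fderiv ℝ (fun y => fderiv ℝ φ y x) (t • x) x := by
    rw [Filter.EventuallyEq.deriv_eq hd]
    have h6 := (hφu.comp_hasDerivAt t (hray t)).deriv
    rw [hφu.fderiv]
    exact h6
  -- `Θ' (r • x) x` does not depend on `r`. Together with `A' (t • x) x = 0` this makes the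
  -- Christoffel symbol of `Θ'`, `A'` vanish on `(x, x)`, and the transformation law becomes the
  -- geodesic equation for the image of the ray.
  have hc : fderiv ℝ Θ' (t • x) x x = 0 := by
    have h5 : HasDerivAt (fun r : ℝ => Θ' (r • x) x) _ t :=
      HasFDerivAt.comp_hasDerivAt t (l := fun y => Θ' y x)
        (hΘ'.hasFDerivAt.clm_apply (hasFDerivAt_const x (t • x))) (hray t)
    have h6 := h5.unique ((hasDerivAt_const t x).congr_of_eventuallyEq h3)
    simpa using h6
  rw [hdd, hd.self_of_nhds, coframeChristoffel_transformation hφ hN hΘ hΘ' hinv hinv' h1 h2,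
    coframeChristoffel, hc, h4]
  simp

/-- A `C¹` field is locally Lipschitz, so two solutions that meet agree nearby. The set of times
near which they agree is thus open, and it is closed in the interval by continuity; connectedness
does the rest. -/
theorem eqOn_of_hasDerivAt_of_contDiffOn {f : V → V} {D : Set V} (hD : IsOpen D)
    (hf : ContDiffOn ℝ 1 f D) {X Y : ℝ → V} {a b t₀ : ℝ}
    (hX : ∀ t ∈ Set.Ioo a b, X t ∈ D ∧ HasDerivAt X (f (X t)) t)
    (hY : ∀ t ∈ Set.Ioo a b, Y t ∈ D ∧ HasDerivAt Y (f (Y t)) t) (ht₀ : t₀ ∈ Set.Ioo a b)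
    (h₀ : X t₀ = Y t₀) : Set.EqOn X Y (Set.Ioo a b) := by
  have hloc : ∀ t ∈ Set.Ioo a b, X t = Y t → X =ᶠ[nhds t] Y := by
    intro t ht hXY
    obtain ⟨K, s, hs, hK⟩ := (hf.contDiffAt (hD.mem_nhds (hX t ht).1)).exists_lipschitzOnWith
    refine ODE_solution_unique_of_eventually (v := fun _ => f) (s := fun _ => s) (K := K)
      (Filter.Eventually.of_forall fun _ => hK) ?_ ?_ hXY
    · filter_upwards [isOpen_Ioo.mem_nhds ht, (hX t ht).2.continuousAt.eventually hs] with r hr h1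
      exact ⟨(hX r hr).2, h1⟩
    · rw [hXY] at hs
      filter_upwards [isOpen_Ioo.mem_nhds ht, (hY t ht).2.continuousAt.eventually hs] with r hr h1
      exact ⟨(hY r hr).2, h1⟩
  have hsub : Set.Ioo a b ⊆ {t | X =ᶠ[nhds t] Y} := by
    refine isPreconnected_Ioo.subset_of_closure_inter_subset isOpen_setOfPred_eventually_nhds
      ⟨t₀, ht₀, hloc t₀ ht₀ h₀⟩ ?_
    rintro t ⟨ht, hab⟩
    refine hloc t hab ?_
    by_contra hne
    have h1 : ∀ᶠ r in nhds t, X r ≠ Y r :=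
      ((hX t hab).2.continuousAt.ne_iff_eventually_ne (hY t hab).2.continuousAt).1 hne
    obtain ⟨r, hr1, hr2⟩ := mem_closure_iff_nhds.1 ht _ h1
    exact hr1 (Filter.EventuallyEq.eq_of_nhds hr2)
  exact fun t ht => Filter.EventuallyEq.eq_of_nhds (hsub ht)

/-- Solutions of a second order equation, e.g. geodesics, are determined by their initial
conditions. -/
theorem eqOn_of_second_order {q : V → V → V} {D : Set V} (hD : IsOpen D)
    (hq : ContDiffOn ℝ 1 (fun x : V × V => q x.1 x.2) (D ×ˢ Set.univ)) {γ δ : ℝ → V} {a b t₀ : ℝ}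
    (hγ : ContDiffOn ℝ 2 γ (Set.Ioo a b)) (hδ : ContDiffOn ℝ 2 δ (Set.Ioo a b))
    (hγD : ∀ t ∈ Set.Ioo a b, γ t ∈ D) (hδD : ∀ t ∈ Set.Ioo a b, δ t ∈ D)
    (hγq : ∀ t ∈ Set.Ioo a b, deriv (deriv γ) t + q (γ t) (deriv γ t) = 0)
    (hδq : ∀ t ∈ Set.Ioo a b, deriv (deriv δ) t + q (δ t) (deriv δ t) = 0)
    (ht₀ : t₀ ∈ Set.Ioo a b) (h₀ : γ t₀ = δ t₀) (h₁ : deriv γ t₀ = deriv δ t₀) :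
    Set.EqOn γ δ (Set.Ioo a b) := by
  have key : ∀ γ : ℝ → V, ContDiffOn ℝ 2 γ (Set.Ioo a b) → (∀ t ∈ Set.Ioo a b, γ t ∈ D) →
      (∀ t ∈ Set.Ioo a b, deriv (deriv γ) t + q (γ t) (deriv γ t) = 0) →
      ∀ t ∈ Set.Ioo a b, (γ t, deriv γ t) ∈ D ×ˢ Set.univ ∧
        HasDerivAt (fun t => (γ t, deriv γ t)) (deriv γ t, -q (γ t) (deriv γ t)) t := by
    intro γ hγ hγD hγq t ht
    have h2 : ContDiffAt ℝ 2 γ t := hγ.contDiffAt (isOpen_Ioo.mem_nhds ht)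
    have h3 : DifferentiableAt ℝ (deriv γ) t :=
      ((contDiffOn_succ_iff_deriv_of_isOpen (n := 1) isOpen_Ioo).1
        (by simpa [one_add_one_eq_two] using hγ)).2.2.differentiableOn (by simp) |>.differentiableAt
          (isOpen_Ioo.mem_nhds ht)
    rw [← eq_neg_of_add_eq_zero_left (hγq t ht)]
    exact ⟨⟨hγD t ht, trivial⟩, (h2.differentiableAt (by simp)).hasDerivAt.prodMk h3.hasDerivAt⟩
  have h := eqOn_of_hasDerivAt_of_contDiffOn (hD.prod isOpen_univ)
    (f := fun x : V × V => (x.2, -q x.1 x.2)) (contDiffOn_snd.prodMk hq.neg)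
    (key γ hγ hγD hγq) (key δ hδ hδD hδq) ht₀ (Prod.ext h₀ h₁)
  exact fun t ht => congrArg Prod.fst (h ht)

end Christoffel

/-! ### The structure equation for pullbacks of the coframe to vector spaces -/

theorem ContinuousLinearMap.isInvertible_of_bijective {E F : Type*} [NormedAddCommGroup E]
    [NormedSpace ℝ E] [FiniteDimensional ℝ E] [NormedAddCommGroup F] [NormedSpace ℝ F]
    {L : E →L[ℝ] F} (hL : Function.Bijective L) : L.IsInvertible :=
  ⟨(LinearEquiv.ofBijective (L : E →ₗ[ℝ] F) hL).toContinuousLinearEquiv, by ext1 v; rfl⟩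

theorem ContinuousLinearMap.isInvertible_of_injective {E F : Type*} [NormedAddCommGroup E]
    [NormedSpace ℝ E] [FiniteDimensional ℝ E] [NormedAddCommGroup F] [NormedSpace ℝ F]
    [FiniteDimensional ℝ F] {L : E →L[ℝ] F}
    (hL : Function.Injective L) (hd : Module.finrank ℝ E = Module.finrank ℝ F) :
    L.IsInvertible :=
  isInvertible_of_bijective
    ⟨hL, (LinearMap.injective_iff_surjective_of_finrank_eq_finrank (f := (L : E →ₗ[ℝ] F)) hd).1 hL⟩

/-- If `κ X = a` and `κ Y = b` are constant, then `dκ(X, Y) = -κ [X, Y]`. -/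
theorem formD_eq_neg_lieBracket {E V : Type*} [NormedAddCommGroup E] [NormedSpace ℝ E]
    [NormedAddCommGroup V] [NormedSpace ℝ V] {κ : E → E →L[ℝ] V} {z : E} {X Y : E → E} {a b : V}
    (hκ : DifferentiableAt ℝ κ z) (hX : DifferentiableAt ℝ X z) (hY : DifferentiableAt ℝ Y z)
    (ha : ∀ᶠ y in nhds z, κ y (X y) = a) (hb : ∀ᶠ y in nhds z, κ y (Y y) = b) :
    formD κ z (X z) (Y z) = -κ z (VectorField.lieBracket ℝ X Y z) := by
  have key : ∀ {X : E → E} {a : V}, DifferentiableAt ℝ X z → (∀ᶠ y in nhds z, κ y (X y) = a) →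
      ∀ ξ, fderiv ℝ κ z ξ (X z) = -κ z (fderiv ℝ X z ξ) := by
    intro X a hX ha ξ
    have h1 := (hκ.hasFDerivAt.clm_apply hX.hasFDerivAt).unique
      ((hasFDerivAt_const a z).congr_of_eventuallyEq ha)
    have h2 := congrArg (fun M : E →L[ℝ] V => M ξ) h1
    simp only [add_apply, ContinuousLinearMap.comp_apply,
      ContinuousLinearMap.flip_apply, zero_apply] at h2
    rw [add_comm] at h2
    exact eq_neg_of_add_eq_zero_left h2
  rw [formD, key hY hb, key hX ha, VectorField.lieBracket, map_sub]
  abel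

namespace GStructureWithConnection

variable {n : ℕ}
  {EG : Type*} [NormedAddCommGroup EG] [NormedSpace ℝ EG] [FiniteDimensional ℝ EG]
  {G : Type*} [TopologicalSpace G] [ChartedSpace EG G] [Group G]
  {EP : Type*} [NormedAddCommGroup EP] [NormedSpace ℝ EP] [FiniteDimensional ℝ EP]
  {P : Type*} [TopologicalSpace P] [ChartedSpace EP P] [IsManifold 𝓘(ℝ, EP) ∞ P]
  [MulAction Gᵐᵒᵖ P]
  (S : GStructureWithConnection n EG G EP P)
  {E E' : Type*} [NormedAddCommGroup E] [NormedSpace ℝ E] [FiniteDimensional ℝ E]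
  [NormedAddCommGroup E'] [NormedSpace ℝ E'] [FiniteDimensional ℝ E']

/-- The pullback `f^*(θ, ω)` along a map from a vector space. -/
def pull (f : E → P) (z : E) : E →L[ℝ] EuclideanSpace ℝ (Fin n) × EG :=
  (S.coframe (f z)).comp
    (mfderiv 𝓘(ℝ, E) 𝓘(ℝ, EP) f z : E →L[ℝ] TangentSpace 𝓘(ℝ, EP) (f z))

theorem pull_apply (f : E → P) (z ξ : E) :
    S.pull f z ξ = S.coframe (f z) (mfderiv 𝓘(ℝ, E) 𝓘(ℝ, EP) f z ξ) := rfl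

theorem contDiffOn_pull {f : E → P} {U : Set E} (hU : IsOpen U)
    (hf : ContMDiffOn 𝓘(ℝ, E) 𝓘(ℝ, EP) ∞ f U) : ContDiffOn ℝ ∞ (S.pull f) U := by
  rw [contDiffOn_clm_apply]
  intro v
  have h1 := hf.contMDiffOn_tangentMapWithin (m := ∞) (by simp) hU.uniqueMDiffOn
  have h2 : ContMDiff 𝓘(ℝ, E) 𝓘(ℝ, E).tangent ∞
      (fun z : E => (⟨z, v⟩ : TangentBundle 𝓘(ℝ, E) E)) :=
    contMDiff_vectorSpace_iff_contDiff.2 contDiff_const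
  have h3 := (S.coframe_smooth.comp_contMDiffOn h1).comp h2.contMDiffOn
    (fun z (hz : z ∈ U) => hz)
  refine (h3.congr fun z hz => ?_).contDiffOn
  simp only [Function.comp_apply, tangentMapWithin, mfderivWithin_of_isOpen hU hz]
  rfl

theorem pull_comp {f : E → P} {g : E' → E} {y : E'}
    (hf : MDifferentiableAt 𝓘(ℝ, E) 𝓘(ℝ, EP) f (g y)) (hg : DifferentiableAt ℝ g y) :
    S.pull (f ∘ g) y = (S.pull f (g y)).comp (fderiv ℝ g y) := by
  ext1 v
  have h1 := mfderiv_comp_apply y hf hg.mdifferentiableAt v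
  rw [pull_apply, h1, mfderiv_eq_fderiv]
  rfl

theorem pull_congr {f f' : E → P} {z : E} (h : f =ᶠ[nhds z] f') : S.pull f z = S.pull f' z := by
  have h0 := h.eq_of_nhds
  have h1 : mfderiv 𝓘(ℝ, E) 𝓘(ℝ, EP) f z = mfderiv 𝓘(ℝ, E) 𝓘(ℝ, EP) f' z := h.mfderiv_eq
  ext1 v
  have h7 : ∀ (p q : P) (_ : p = q) (η ζ : EP), η = ζ →
      (S.coframe p : EP →L[ℝ] _) η = (S.coframe q : EP →L[ℝ] _) ζ := by
    rintro r _ rfl η _ rfl; rfl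
  exact h7 _ _ h0 _ _ (congrArg (fun L : E →L[ℝ] EP => L v) h1)

theorem isInvertible_coframe (p : P) :
    (S.coframe p : EP →L[ℝ] EuclideanSpace ℝ (Fin n) × EG).IsInvertible :=
  ContinuousLinearMap.isInvertible_of_bijective (E := EP) (S.coframe_bijective p)

theorem isInvertible_mfderiv {f : E → P} {z : E} (hz : (S.pull f z).IsInvertible) :
    (mfderiv 𝓘(ℝ, E) 𝓘(ℝ, EP) f z).IsInvertible := by
  refine ContinuousLinearMap.isInvertible_of_bijective (E := E) (F := EP) ?_
  have h1 := hz.bijective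
  have h2 := S.coframe_bijective (f z)
  exact (Function.Bijective.of_comp_iff' h2 _).1 h1

theorem mpullback_frame {f : E → P} {z : E} (hz : (S.pull f z).IsInvertible)
    (a : EuclideanSpace ℝ (Fin n) × EG) :
    VectorField.mpullback 𝓘(ℝ, E) 𝓘(ℝ, EP) f (fun p => S.frame p a) z
      = (S.pull f z).inverse a := by
  rw [VectorField.mpullback_apply]
  have h1 := S.isInvertible_mfderiv hz
  refine h1.inverse_apply_eq.2 ((S.coframe_bijective (f z)).1 ?_)
  rw [S.coframe_frame]
  exact (hz.self_apply_inverse a).symm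

/-- The structure equation for a local parametrization of `P`. -/
theorem formD_pull_of_isInvertible {f : E → P} {U : Set E} (hU : IsOpen U)
    (hf : ContMDiffOn 𝓘(ℝ, E) 𝓘(ℝ, EP) ∞ f U) (hinv : ∀ z ∈ U, (S.pull f z).IsInvertible)
    {z : E} (hz : z ∈ U) (ξ η : E) :
    formD (S.pull f) z ξ η = -S.bracketAux (S.constSection (S.pull f z ξ))
      (S.constSection (S.pull f z η)) (f z) := by
  have : CompleteSpace EP := FiniteDimensional.complete ℝ EP
  have : CompleteSpace E := FiniteDimensional.complete ℝ E
  have : IsManifold 𝓘(ℝ, EP) (minSmoothness ℝ 2) P := by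
    rw [minSmoothness_of_isRCLikeNormedField]; infer_instance
  have : IsManifold 𝓘(ℝ, E) (minSmoothness ℝ 2) E := by
    rw [minSmoothness_of_isRCLikeNormedField]; infer_instance
  set a := S.pull f z ξ with ha
  set b := S.pull f z η with hb
  -- `X a` is the pullback under `f` of the frame field of the constant section `a`. Pullback
  -- respects brackets, and the constant values `S.pull f (X a) = a` allow `formD_eq_neg_lieBracket`
  -- to be used.
  let X : EuclideanSpace ℝ (Fin n) × EG → E → E := fun a y => (S.pull f y).inverse a
  have hpull : ∀ a, VectorField.mpullback 𝓘(ℝ, E) 𝓘(ℝ, EP) f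
      (S.pullbackSection (S.constSection a)) =ᶠ[nhds z] X a := by
    intro a
    filter_upwards [hU.mem_nhds hz] with y hy
    exact S.mpullback_frame (hinv y hy) a
  have h1 := VectorField.mpullback_mlieBracket (n := ∞) (f := f) (x₀ := z)
    ((S.pullbackSection_smooth (S.constSection a)).mdifferentiable (by simp) (f z))
    ((S.pullbackSection_smooth (S.constSection b)).mdifferentiable (by simp) (f z))
    (hf.contMDiffAt (hU.mem_nhds hz))
    (by rw [minSmoothness_of_isRCLikeNormedField]; exact WithTop.coe_le_coe.2 le_top)
  rw [(hpull a).mlieBracket_vectorField_eq (hpull b), VectorField.mpullback_apply,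
    (S.isInvertible_mfderiv (hinv z hz)).inverse_apply_eq] at h1
  have hκ : ContDiffAt ℝ ∞ (S.pull f) z := (S.contDiffOn_pull hU hf).contDiffAt (hU.mem_nhds hz)
  have hX : ∀ a, DifferentiableAt ℝ (X a) z := by
    intro a
    obtain ⟨L, hL⟩ := hinv z hz
    have h4 := contDiffAt_map_inverse (𝕜 := ℝ) (n := ∞) L
    rw [hL] at h4
    exact ((h4.comp z hκ).clm_apply contDiffAt_const).differentiableAt (by simp)
  have hXa : ∀ a, ∀ᶠ y in nhds z, S.pull f y (X a y) = a := by
    intro a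
    filter_upwards [hU.mem_nhds hz] with y hy
    exact (hinv y hy).self_apply_inverse a
  have h2 := formD_eq_neg_lieBracket (hκ.differentiableAt (by simp)) (hX a) (hX b) (hXa a) (hXa b)
  have h3 : X a z = ξ := (hinv z hz).inverse_apply_self ξ
  have h4 : X b z = η := (hinv z hz).inverse_apply_self η
  rw [h3, h4] at h2
  have h5 : ∀ V W : ∀ x : E, TangentSpace 𝓘(ℝ, E) x, VectorField.mlieBracket 𝓘(ℝ, E) V W z
      = VectorField.lieBracket ℝ V W z := by
    intro V W
    rw [← VectorField.mlieBracketWithin_univ, VectorField.mlieBracketWithin_eq_lieBracketWithin]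
    exact congrFun VectorField.lieBracketWithin_univ z
  rw [h2, bracketAux, h1, pull_apply]
  exact congrArg (fun ζ : E => -S.pull f z ζ) (h5 (X a) (X b)).symm

theorem isInvertible_pull_extChartAt_symm {p : P} {y : EP}
    (hy : y ∈ (extChartAt 𝓘(ℝ, EP) p).target) :
    (S.pull (extChartAt 𝓘(ℝ, EP) p).symm y).IsInvertible := by
  have h1 := isInvertible_mfderivWithin_extChartAt_symm (I := 𝓘(ℝ, EP)) (x := p) hy
  rw [modelWithCornersSelf_coe, Set.range_id, mfderivWithin_univ] at h1
  exact ContinuousLinearMap.IsInvertible.comp (M₂ := EP) (S.isInvertible_coframe _) h1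

theorem exists_parametrization (p : P) : ∃ (f : EP → P) (U : Set EP), IsOpen U ∧
    ContMDiffOn 𝓘(ℝ, EP) 𝓘(ℝ, EP) ∞ f U ∧ (∀ y ∈ U, (S.pull f y).IsInvertible) ∧
    ∃ z ∈ U, f z = p := by
  let ψ := extChartAt 𝓘(ℝ, EP) p
  refine ⟨ψ.symm, ψ.target, isOpen_extChartAt_target _, contMDiffOn_extChartAt_symm _, ?_,
    ψ p, mem_extChartAt_target p, extChartAt_to_inv p⟩
  exact fun y hy => S.isInvertible_pull_extChartAt_symm hy

/-- The structure equation. -/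
theorem formD_pull {f : E → P} {U : Set E} (hU : IsOpen U)
    (hf : ContMDiffOn 𝓘(ℝ, E) 𝓘(ℝ, EP) ∞ f U) {z : E} (hz : z ∈ U) (ξ η : E) :
    formD (S.pull f) z ξ η = -S.bracketAux (S.constSection (S.pull f z ξ))
      (S.constSection (S.pull f z η)) (f z) := by
  -- Near `z` the map `f` is `ψ.symm ∘ (ψ ∘ f)`. The equation is known for the parametrization
  -- `ψ.symm`, and `d` commutes with the pullback along `ψ ∘ f`, so no condition on the rank of `f`
  -- is needed.
  let ψ := extChartAt 𝓘(ℝ, EP) (f z)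
  have hψt : IsOpen ψ.target := isOpen_extChartAt_target _
  have hψs : ContMDiffOn 𝓘(ℝ, EP) 𝓘(ℝ, EP) ∞ ψ.symm ψ.target := contMDiffOn_extChartAt_symm _
  have hψinv : ∀ y ∈ ψ.target, (S.pull ψ.symm y).IsInvertible :=
    fun y hy => S.isInvertible_pull_extChartAt_symm hy
  have hfz : ContMDiffAt 𝓘(ℝ, E) 𝓘(ℝ, EP) ∞ f z := hf.contMDiffAt (hU.mem_nhds hz)
  have hev : ∀ᶠ y in nhds z, y ∈ U ∧ f y ∈ ψ.source :=
    (hU.eventually_mem hz).and (hfz.continuousAt.eventually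
      (extChartAt_source_mem_nhds (I := 𝓘(ℝ, EP)) (f z)))
  have hg : ∀ y, y ∈ U ∧ f y ∈ ψ.source → ContDiffAt ℝ ∞ (ψ ∘ f) y := by
    intro y hy
    refine ContMDiffAt.contDiffAt (ContMDiffAt.comp y (I' := 𝓘(ℝ, EP)) ?_
      (hf.contMDiffAt (hU.mem_nhds hy.1)))
    have h1 := hy.2
    rw [extChartAt_source] at h1
    exact contMDiffAt_extChartAt' h1
  have hfg : ∀ y, y ∈ U ∧ f y ∈ ψ.source → f =ᶠ[nhds y] ψ.symm ∘ (ψ ∘ f) := by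
    intro y hy
    filter_upwards [(hf.continuousOn.continuousAt (hU.mem_nhds hy.1)).eventually
      ((isOpen_extChartAt_source (I := 𝓘(ℝ, EP)) (f z)).mem_nhds hy.2)] with x hx
    exact (ψ.left_inv hx).symm
  have hcomp : ∀ y, y ∈ U ∧ f y ∈ ψ.source →
      S.pull f y = (S.pull ψ.symm (ψ (f y))).comp (fderiv ℝ (ψ ∘ f) y) := by
    intro y hy
    rw [S.pull_congr (hfg y hy), S.pull_comp ?_ ((hg y hy).differentiableAt (by simp))]
    · rfl
    · exact (hψs.contMDiffAt (hψt.mem_nhds (ψ.map_source hy.2))).mdifferentiableAt (by simp)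
  have hz' := hev.self_of_nhds
  have ht : ψ (f z) ∈ ψ.target := ψ.map_source hz'.2
  rw [formD_pullback (κ := S.pull ψ.symm) (g := ψ ∘ f) (hev.mono hcomp)
    (((S.contDiffOn_pull hψt hψs).contDiffAt (hψt.mem_nhds ht)).differentiableAt (by simp))
    ((hg z hz').of_le (by norm_cast)), Function.comp_apply,
    S.formD_pull_of_isInvertible hψt hψs hψinv ht, hcomp z hz', ψ.left_inv hz'.2]
  rfl

end GStructureWithConnection

/-! ### The group action and changes of gauge -/

section PlainDerivative

variable (E E' : Type*) {E'' : Type*} [NormedAddCommGroup E] [NormedSpace ℝ E]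
  [NormedAddCommGroup E'] [NormedSpace ℝ E'] [NormedAddCommGroup E''] [NormedSpace ℝ E'']
  {M M' M'' : Type*} [TopologicalSpace M] [ChartedSpace E M] [TopologicalSpace M']
  [ChartedSpace E' M'] [TopologicalSpace M''] [ChartedSpace E'' M'']

/-- `mfderiv` with the tangent spaces identified with the model spaces. -/
def plainDeriv (f : M → M') (x : M) : E →L[ℝ] E' := mfderiv 𝓘(ℝ, E) 𝓘(ℝ, E') f x

theorem plainDeriv_comp {g : M' → M''} {f : M → M'} {x : M} {y : M'}
    (hg : MDifferentiableAt 𝓘(ℝ, E') 𝓘(ℝ, E'') g y) (hf : MDifferentiableAt 𝓘(ℝ, E) 𝓘(ℝ, E') f x)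
    (hy : f x = y) :
    plainDeriv E E'' (g ∘ f) x = (plainDeriv E' E'' g y).comp (plainDeriv E E' f x) := by
  subst hy
  exact mfderiv_comp x hg hf

theorem plainDeriv_eq_fderiv (f : E → E') (x : E) : plainDeriv E E' f x = fderiv ℝ f x :=
  mfderiv_eq_fderiv

end PlainDerivative

namespace GStructureWithConnection

variable {n : ℕ}
  {EG : Type*} [NormedAddCommGroup EG] [NormedSpace ℝ EG] [FiniteDimensional ℝ EG]
  {G : Type*} [TopologicalSpace G] [ChartedSpace EG G] [Group G] [LieGroup 𝓘(ℝ, EG) ∞ G]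
  {EP : Type*} [NormedAddCommGroup EP] [NormedSpace ℝ EP] [FiniteDimensional ℝ EP]
  {P : Type*} [TopologicalSpace P] [ChartedSpace EP P] [IsManifold 𝓘(ℝ, EP) ∞ P]
  [MulAction Gᵐᵒᵖ P]
  (S : GStructureWithConnection n EG G EP P)
  {E : Type*} [NormedAddCommGroup E] [NormedSpace ℝ E] [FiniteDimensional ℝ E]

/-- The representation of `G` on `ℝⁿ`. -/
def rep (g : G) : EuclideanSpace ℝ (Fin n) →L[ℝ] EuclideanSpace ℝ (Fin n) := S.ρ g

/-- The derivative `𝔤 → 𝔤𝔩_n(ℝ)` of the inclusion `G → GL_n(ℝ)`. -/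
def repDeriv : EG →L[ℝ] EuclideanSpace ℝ (Fin n) →L[ℝ] EuclideanSpace ℝ (Fin n) :=
  plainDeriv EG (EuclideanSpace ℝ (Fin n) →L[ℝ] EuclideanSpace ℝ (Fin n)) S.rep 1

theorem rep_mul (g k : G) : S.rep (g * k) = (S.rep g).comp (S.rep k) := by
  simp only [rep, map_mul, Units.val_mul]; rfl

theorem rep_one : S.rep (1 : G) = ContinuousLinearMap.id ℝ _ := by
  simp only [rep, map_one, Units.val_one]; rfl

theorem rep_inv_rep (g : G) (u : EuclideanSpace ℝ (Fin n)) : S.rep g⁻¹ (S.rep g u) = u := by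
  rw [← ContinuousLinearMap.comp_apply, ← rep_mul, inv_mul_cancel, rep_one]; rfl

theorem rep_rep_inv (g : G) (u : EuclideanSpace ℝ (Fin n)) : S.rep g (S.rep g⁻¹ u) = u := by
  rw [← ContinuousLinearMap.comp_apply, ← rep_mul, mul_inv_cancel, rep_one]; rfl

theorem mdifferentiable_rep : MDifferentiable 𝓘(ℝ, EG)
    𝓘(ℝ, EuclideanSpace ℝ (Fin n) →L[ℝ] EuclideanSpace ℝ (Fin n)) S.rep :=
  S.ρ_smooth.mdifferentiable (by simp)

theorem mdifferentiableAt_mul_left (a b : G) :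
    MDifferentiableAt 𝓘(ℝ, EG) 𝓘(ℝ, EG) (fun g : G => a * g) b :=
  (contMDiff_mul_left (I := 𝓘(ℝ, EG)) (n := ∞) (a := a)).mdifferentiable (by simp) b

theorem mdifferentiableAt_mul_right (a b : G) :
    MDifferentiableAt 𝓘(ℝ, EG) 𝓘(ℝ, EG) (fun g : G => g * a) b :=
  (contMDiff_mul_right (I := 𝓘(ℝ, EG)) (n := ∞) (a := a)).mdifferentiable (by simp) b

/-- Derivative at `g = a` of `ρ(g) = ρ(a) ρ(a⁻¹ g)`. It identifies `ρ(a)` times the Maurer–Cartan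
term `a⁻¹ da` with the ordinary derivative of the matrix. -/
theorem repDeriv_plainDeriv_mul_left (a : G) (w : EG) :
    (S.rep a).comp (S.repDeriv (plainDeriv EG EG (fun g : G => a⁻¹ * g) a w))
      = plainDeriv EG (EuclideanSpace ℝ (Fin n) →L[ℝ] EuclideanSpace ℝ (Fin n)) S.rep a w := by
  have h1 := plainDeriv_comp EG EG (S.mdifferentiable_rep 1) (mdifferentiableAt_mul_left a⁻¹ a)
    (inv_mul_cancel a)
  let A := ContinuousLinearMap.compL ℝ (EuclideanSpace ℝ (Fin n)) (EuclideanSpace ℝ (Fin n))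
    (EuclideanSpace ℝ (Fin n)) (S.rep a)
  have h2 := plainDeriv_comp EG (EuclideanSpace ℝ (Fin n) →L[ℝ] EuclideanSpace ℝ (Fin n))
    (g := A) (f := S.rep ∘ fun g : G => a⁻¹ * g) (x := a) A.mdifferentiableAt
    ((S.mdifferentiable_rep _).comp a (mdifferentiableAt_mul_left a⁻¹ a)) rfl
  have h3 : A ∘ S.rep ∘ (fun g : G => a⁻¹ * g) = S.rep := by
    funext g
    change (S.rep a).comp (S.rep (a⁻¹ * g)) = _
    rw [← rep_mul, mul_inv_cancel_left]
  rw [h3, h1, plainDeriv_eq_fderiv, A.fderiv] at h2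
  rw [h2]
  rfl

/-- Derivative at `g = 1` of the identity `ρ(a g a⁻¹) ρ(a) = ρ(a) ρ(g)`. -/
theorem repDeriv_Ad (a : G) (α : EG) :
    (S.repDeriv (GStr.Ad a α)).comp (S.rep a) = (S.rep a).comp (S.repDeriv α) := by
  have h0 : MDifferentiableAt 𝓘(ℝ, EG) 𝓘(ℝ, EG) (fun x : G => a * x * a⁻¹) 1 :=
    (mdifferentiableAt_mul_right a⁻¹ (a * 1)).comp (1 : G) (mdifferentiableAt_mul_left a 1)
  have h1 := plainDeriv_comp EG EG (S.mdifferentiable_rep 1) h0 (by simp)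
  let A := ContinuousLinearMap.compL ℝ (EuclideanSpace ℝ (Fin n)) (EuclideanSpace ℝ (Fin n))
    (EuclideanSpace ℝ (Fin n)) (S.rep a)
  let B := (ContinuousLinearMap.compL ℝ (EuclideanSpace ℝ (Fin n)) (EuclideanSpace ℝ (Fin n))
    (EuclideanSpace ℝ (Fin n))).flip (S.rep a)
  have h2 := plainDeriv_comp EG (EuclideanSpace ℝ (Fin n) →L[ℝ] EuclideanSpace ℝ (Fin n))
    (g := B) (f := S.rep ∘ fun x : G => a * x * a⁻¹) (x := 1) B.mdifferentiableAt
    ((S.mdifferentiable_rep _).comp (1 : G) h0) rfl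
  have h3 := plainDeriv_comp EG (EuclideanSpace ℝ (Fin n) →L[ℝ] EuclideanSpace ℝ (Fin n))
    (g := A) (f := S.rep) (x := 1) A.mdifferentiableAt (S.mdifferentiable_rep _) rfl
  have h4 : B ∘ S.rep ∘ (fun x : G => a * x * a⁻¹) = A ∘ S.rep := by
    funext g
    change (S.rep (a * g * a⁻¹)).comp (S.rep a) = (S.rep a).comp (S.rep g)
    rw [← rep_mul, ← rep_mul, inv_mul_cancel_right]
  rw [h4, h3, h1, plainDeriv_eq_fderiv, plainDeriv_eq_fderiv, A.fderiv, B.fderiv] at h2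
  exact (congrArg (fun L : EG →L[ℝ] _ => L α) h2).symm

theorem mdifferentiable_action_right (S : GStructureWithConnection n EG G EP P) (p : P) :
    MDifferentiable 𝓘(ℝ, EG) 𝓘(ℝ, EP) (fun g : G => op g • p) :=
  (S.act_smooth.comp (contMDiff_const.prodMk contMDiff_id)).mdifferentiable (by simp)

theorem mdifferentiable_action_left (S : GStructureWithConnection n EG G EP P) (g : G) :
    MDifferentiable 𝓘(ℝ, EP) 𝓘(ℝ, EP) (fun p : P => op g • p) :=
  (S.act_smooth.comp (contMDiff_id.prodMk contMDiff_const)).mdifferentiable (by simp)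

/-- Since `p · g = (p · a) · (a⁻¹ g)`, velocities of an orbit at `p · a` are generators at `p · a`,
on which `θ` and `ω` are prescribed. -/
theorem plainDeriv_orbit (S : GStructureWithConnection n EG G EP P) (p : P) (a : G) :
    plainDeriv EG EP (fun g : G => op g • p) a = (plainDeriv EG EP (fun g : G => op g • op a • p)
      1).comp (plainDeriv EG EG (fun g : G => a⁻¹ * g) a) := by
  rw [← plainDeriv_comp EG EG (S.mdifferentiable_action_right (op a • p) 1)
    (mdifferentiableAt_mul_left a⁻¹ a) (inv_mul_cancel a)]
  congr 1
  funext g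
  simp only [Function.comp_apply, smul_smul, ← op_mul, mul_inv_cancel_left]

theorem plainDeriv_action (S : GStructureWithConnection n EG G EP P)
    {s : E → P} {a : E → G} {z : E}
    (hs : MDifferentiableAt 𝓘(ℝ, E) 𝓘(ℝ, EP) s z) (ha : MDifferentiableAt 𝓘(ℝ, E) 𝓘(ℝ, EG) a z)
    (v : E) :
    plainDeriv E EP (fun y => op (a y) • s y) z v =
      plainDeriv EP EP (fun p => op (a z) • p) (s z) (plainDeriv E EP s z v) +
      plainDeriv EG EP (fun g : G => op g • op (a z) • s z) 1
        (plainDeriv EG EG (fun g : G => (a z)⁻¹ * g) (a z) (plainDeriv E EG a z v)) := by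
  have h1 : MDifferentiableAt (𝓘(ℝ, EP).prod 𝓘(ℝ, EG)) 𝓘(ℝ, EP)
      (fun x : P × G => op x.2 • x.1) (s z, a z) :=
    S.act_smooth.mdifferentiable (by simp) (s z, a z)
  have h2 := mfderiv_comp_apply z (f := fun y => (s y, a y)) h1 (hs.prodMk ha) v
  rw [mfderiv_prod_eq_add_apply h1, mfderiv_prodMk hs ha] at h2
  rw [← ContinuousLinearMap.comp_apply (plainDeriv EG EP _ 1), ← S.plainDeriv_orbit]
  exact h2

/-- The behaviour of `(θ, ω)` under a change of gauge. -/
theorem pull_action {s : E → P} {a : E → G} {z : E}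
    (hs : MDifferentiableAt 𝓘(ℝ, E) 𝓘(ℝ, EP) s z) (ha : MDifferentiableAt 𝓘(ℝ, E) 𝓘(ℝ, EG) a z)
    (v : E) :
    S.pull (fun y => op (a y) • s y) z v =
      (S.rep (a z)⁻¹ (S.pull s z v).1, GStr.Ad (a z)⁻¹ (S.pull s z v).2 +
        plainDeriv EG EG (fun g : G => (a z)⁻¹ * g) (a z) (plainDeriv E EG a z v)) := by
  have h1 := S.plainDeriv_action hs ha v
  let C : EP →L[ℝ] EuclideanSpace ℝ (Fin n) × EG := S.coframe (op (a z) • s z)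
  have h3 : C (plainDeriv EP EP (fun p => op (a z) • p) (s z) (plainDeriv E EP s z v))
      = (S.rep (a z)⁻¹ (S.pull s z v).1, GStr.Ad (a z)⁻¹ (S.pull s z v).2) :=
    Prod.ext (S.θ_equivariant (a z) (s z) (plainDeriv E EP s z v))
      (S.conn_equivariant (a z) (s z) (plainDeriv E EP s z v))
  have h4 : ∀ α, C (plainDeriv EG EP (fun g : G => op g • op (a z) • s z) 1 α) = (0, α) := fun α =>
    Prod.ext (S.θ_horizontal _ α) (S.conn_vertical _ α)
  have h5 := congrArg C h1
  rw [map_add, h3, h4, Prod.mk_add_mk, add_zero] at h5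
  exact h5

/-- This and its companion for `ω` are the gauge-change laws in the form that
`coframeChristoffel_transformation` takes as hypotheses, with `N = ρ(a)`. -/
theorem rep_pull_action_fst {s : E → P} {a : E → G} {z : E}
    (hs : MDifferentiableAt 𝓘(ℝ, E) 𝓘(ℝ, EP) s z) (ha : MDifferentiableAt 𝓘(ℝ, E) 𝓘(ℝ, EG) a z)
    (v : E) :
    S.rep (a z) (S.pull (fun y => op (a y) • s y) z v).1 = (S.pull s z v).1 := by
  rw [S.pull_action hs ha, rep_rep_inv]

theorem rep_pull_action_snd {s : E → P} {a : E → G} {z : E}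
    (hs : MDifferentiableAt 𝓘(ℝ, E) 𝓘(ℝ, EP) s z) (ha : MDifferentiableAt 𝓘(ℝ, E) 𝓘(ℝ, EG) a z)
    (v : E) :
    (S.rep (a z)).comp (S.repDeriv (S.pull (fun y => op (a y) • s y) z v).2)
      = (S.repDeriv (S.pull s z v).2).comp (S.rep (a z)) + fderiv ℝ (fun y => S.rep (a y)) z v := by
  have h1 := plainDeriv_comp E EG (S.mdifferentiable_rep (a z)) ha rfl
  rw [plainDeriv_eq_fderiv] at h1
  have h2 : fderiv ℝ (fun y => S.rep (a y)) z = _ := h1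
  rw [S.pull_action hs ha, map_add, ContinuousLinearMap.comp_add, S.repDeriv_plainDeriv_mul_left,
      h2]
  congr 1
  have h3 := S.repDeriv_Ad (a z)⁻¹ (S.pull s z v).2
  refine ContinuousLinearMap.ext fun u => ?_
  have h4 := congrArg (fun L : _ →L[ℝ] _ => S.rep (a z) (L (S.rep (a z) u))) h3
  simpa [rep_rep_inv, rep_inv_rep] using h4

/-! ### Structure functions of the coframe -/

/-- The bracket of the constant sections `a` and `b` at `p`. -/
def structureFn (p : P) (a b : EuclideanSpace ℝ (Fin n) × EG) : EuclideanSpace ℝ (Fin n) × EG :=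
  S.bracketAux (S.constSection a) (S.constSection b) p

/-- In a parametrization the structure function is minus the exterior derivative of the coframe in
the basis dual to it, so algebraic identities are inherited from `formD`. -/
theorem structureFn_add_right (p : P) (a b c : EuclideanSpace ℝ (Fin n) × EG) :
    S.structureFn p a (b + c) = S.structureFn p a b + S.structureFn p a c := by
  obtain ⟨f, U, hU, hf, hinv, z, hz, rfl⟩ := S.exists_parametrization p
  obtain ⟨K, hK⟩ := hinv z hz
  have h1 : ∀ a b, S.structureFn (f z) a b = -formD (S.pull f) z (K.symm a) (K.symm b) := by
    intro a b
    rw [S.formD_pull hU hf hz, ← hK]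
    simp [structureFn]
  rw [h1, h1, h1, map_add]
  simp only [formD, map_add, add_apply]
  abel

theorem structureFn_swap (p : P) (a b : EuclideanSpace ℝ (Fin n) × EG) :
    S.structureFn p a b = -S.structureFn p b a := by
  obtain ⟨f, U, hU, hf, hinv, z, hz, rfl⟩ := S.exists_parametrization p
  obtain ⟨K, hK⟩ := hinv z hz
  have h1 : ∀ a b, S.structureFn (f z) a b = -formD (S.pull f) z (K.symm a) (K.symm b) := by
    intro a b
    rw [S.formD_pull hU hf hz, ← hK]
    simp [structureFn]
  rw [h1, h1, formD, formD]
  abel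

theorem contMDiffOn_gauge (S : GStructureWithConnection n EG G EP P)
    {s : E → P} {U : Set E} (hs : ContMDiffOn 𝓘(ℝ, E) 𝓘(ℝ, EP) ∞ s U) :
    ContMDiffOn 𝓘(ℝ, E × EG) 𝓘(ℝ, EP) ∞
      (fun x : E × EG => op ((extChartAt 𝓘(ℝ, EG) (1 : G)).symm x.2) • s x.1)
      (U ×ˢ (extChartAt 𝓘(ℝ, EG) (1 : G)).target) := by
  have h1 : ContMDiffOn 𝓘(ℝ, E × EG) 𝓘(ℝ, EP) ∞ (fun x : E × EG => s x.1)
      (U ×ˢ (extChartAt 𝓘(ℝ, EG) (1 : G)).target) :=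
    hs.comp contDiff_fst.contMDiff.contMDiffOn fun x hx => hx.1
  have h2 : ContMDiffOn 𝓘(ℝ, E × EG) 𝓘(ℝ, EG) ∞
      (fun x : E × EG => (extChartAt 𝓘(ℝ, EG) (1 : G)).symm x.2)
      (U ×ˢ (extChartAt 𝓘(ℝ, EG) (1 : G)).target) :=
    (contMDiffOn_extChartAt_symm (1 : G)).comp contDiff_snd.contMDiff.contMDiffOn fun x hx => hx.2
  exact S.act_smooth.comp_contMDiffOn (h1.prodMk h2)

theorem mdifferentiableAt_extChartAt_symm_one {b : EG}
    (hb : b ∈ (extChartAt 𝓘(ℝ, EG) (1 : G)).target) :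
    MDifferentiableAt 𝓘(ℝ, EG) 𝓘(ℝ, EG) (extChartAt 𝓘(ℝ, EG) (1 : G)).symm b :=
  ((contMDiffOn_extChartAt_symm (n := ∞) (1 : G)).contMDiffAt
    ((isOpen_extChartAt_target _).mem_nhds hb)).mdifferentiableAt (by simp)

theorem isInvertible_plainDeriv_extChartAt_symm_one :
    (plainDeriv EG EG (extChartAt 𝓘(ℝ, EG) (1 : G)).symm
      (extChartAt 𝓘(ℝ, EG) (1 : G) 1)).IsInvertible := by
  have : IsManifold 𝓘(ℝ, EG) 1 G := IsManifold.of_le (n := ∞) (by norm_cast)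
  have h1 := isInvertible_mfderivWithin_extChartAt_symm (I := 𝓘(ℝ, EG))
    (mem_extChartAt_target (I := 𝓘(ℝ, EG)) (1 : G))
  rw [modelWithCornersSelf_coe, Set.range_id, mfderivWithin_univ] at h1
  exact h1

/-- The value of `s^*(θ, ω)`, for the gauge transform of a section, in the coordinates of `G`. -/
theorem pull_gauge {s : E → P} {U : Set E} (hU : IsOpen U)
    (hs : ContMDiffOn 𝓘(ℝ, E) 𝓘(ℝ, EP) ∞ s U) {y : E} (hy : y ∈ U) {b : EG}
    (hb : b ∈ (extChartAt 𝓘(ℝ, EG) (1 : G)).target) (ξ : E) (β : EG) :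
    S.pull (fun x : E × EG => op ((extChartAt 𝓘(ℝ, EG) (1 : G)).symm x.2) • s x.1) (y, b) (ξ, β)
      = (S.rep ((extChartAt 𝓘(ℝ, EG) (1 : G)).symm b)⁻¹ (S.pull s y ξ).1,
        GStr.Ad ((extChartAt 𝓘(ℝ, EG) (1 : G)).symm b)⁻¹ (S.pull s y ξ).2 +
        plainDeriv EG EG (fun g : G => ((extChartAt 𝓘(ℝ, EG) (1 : G)).symm b)⁻¹ * g)
          ((extChartAt 𝓘(ℝ, EG) (1 : G)).symm b)
          (plainDeriv EG EG (extChartAt 𝓘(ℝ, EG) (1 : G)).symm b β)) := by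
  have hsy := (hs.contMDiffAt (hU.mem_nhds hy)).mdifferentiableAt (by simp)
  have hχ := mdifferentiableAt_extChartAt_symm_one hb
  have hfst : MDifferentiableAt 𝓘(ℝ, E × EG) 𝓘(ℝ, E) (Prod.fst : E × EG → E) (y, b) :=
    differentiableAt_fst.mdifferentiableAt
  have hsnd : MDifferentiableAt 𝓘(ℝ, E × EG) 𝓘(ℝ, EG) (Prod.snd : E × EG → EG) (y, b) :=
    differentiableAt_snd.mdifferentiableAt
  have h1 := S.pull_action (s := s ∘ Prod.fst)
    (a := (extChartAt 𝓘(ℝ, EG) (1 : G)).symm ∘ Prod.snd) (z := ((y, b) : E × EG))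
    (hsy.comp _ hfst) (hχ.comp _ hsnd) (ξ, β)
  rw [S.pull_comp hsy differentiableAt_fst, plainDeriv_comp (E × EG) EG hχ hsnd rfl,
    plainDeriv_eq_fderiv, fderiv_fst, fderiv_snd] at h1
  exact h1

/-- The bracket of a vertical and a horizontal constant section. -/
theorem structureFn_vertical_horizontal (p : P) (β : EG) (u : EuclideanSpace ℝ (Fin n)) :
    S.structureFn p (0, β) (u, 0) = (S.repDeriv β u, 0) := by
  obtain ⟨f, U, hU, hf, hinv, z, hz, rfl⟩ := S.exists_parametrization p
  let χ := extChartAt 𝓘(ℝ, EG) (1 : G)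
  -- The domain of `Ψ` is larger than `P`, but `formD_pull` applies to any smooth map. The extra
  -- factor `EG` provides a vertical direction that commutes with the horizontal one.
  let Ψ : EP × EG → P := fun x => op (χ.symm x.2) • f x.1
  have hχt : IsOpen χ.target := isOpen_extChartAt_target _
  have he : χ 1 ∈ χ.target := mem_extChartAt_target _
  have hχ1 : χ.symm (χ 1) = 1 := extChartAt_to_inv _
  obtain ⟨α, rfl⟩ := (isInvertible_plainDeriv_extChartAt_symm_one (G := G)).surjective β
  let η := (S.pull f z).inverse (u, 0)
  have hη : S.pull f z η = (u, 0) := (hinv z hz).self_apply_inverse _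
  have hΨ := S.contMDiffOn_gauge hf
  have hw : (z, χ 1) ∈ U ×ˢ χ.target := ⟨hz, he⟩
  have hκ : DifferentiableAt ℝ (S.pull Ψ) (z, χ 1) :=
    ((S.contDiffOn_pull (hU.prod hχt) hΨ).contDiffAt
      ((hU.prod hχt).mem_nhds hw)).differentiableAt (by simp)
  have hvert : ∀ y ∈ U, S.pull Ψ (y, χ 1) (0, α)
      = (0, plainDeriv EG EG χ.symm (χ 1) α) := by
    intro y hy
    have h1 : plainDeriv EG EG (fun g : G => (1 : G)⁻¹ * g) 1 = ContinuousLinearMap.id ℝ EG := by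
      simp only [inv_one, one_mul]
      exact mfderiv_id
    have h2 := S.pull_gauge hU hf hy he 0 α
    rw [map_zero, Prod.fst_zero, Prod.snd_zero, map_zero, map_zero, zero_add, hχ1, h1] at h2
    exact h2
  have hhor : ∀ b ∈ χ.target, S.pull Ψ (z, b) (η, 0) = (S.rep (χ.symm b)⁻¹ u, 0) := by
    intro b hb
    have h2 := S.pull_gauge hU hf hz hb η 0
    rw [hη, map_zero, map_zero, map_zero, add_zero] at h2
    exact h2
  -- By `hvert` the coframe takes the same value on the generator direction `(0, α)` along the whole
  -- slice `b = χ 1`.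
  have hd1 : fderiv ℝ (S.pull Ψ) (z, χ 1) (η, 0) (0, α) = 0 := by
    have h0 : HasFDerivAt (fun y => S.pull Ψ (y, χ 1)) ((fderiv ℝ (S.pull Ψ) (z, χ 1)).comp
        (ContinuousLinearMap.inl ℝ EP EG)) z :=
      HasFDerivAt.comp (g := S.pull Ψ) (f := fun y => (y, χ 1)) z hκ.hasFDerivAt
        (hasFDerivAt_prodMk_left z (χ 1))
    have h2 := (h0.clm_apply (hasFDerivAt_const ((0 : EP), α) z)).unique
        ((hasFDerivAt_const _ z).congr_of_eventuallyEq
      (Filter.eventually_of_mem (hU.mem_nhds hz) hvert))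
    simpa using congrArg (fun L : EP →L[ℝ] _ => L η) h2
  have hd2 : fderiv ℝ (S.pull Ψ) (z, χ 1) (0, α) (η, 0)
      = (-S.repDeriv (plainDeriv EG EG χ.symm (χ 1) α) u, 0) := by
    have h0 : HasFDerivAt (fun b => S.pull Ψ (z, b)) ((fderiv ℝ (S.pull Ψ) (z, χ 1)).comp
        (ContinuousLinearMap.inr ℝ EP EG)) (χ 1) :=
      HasFDerivAt.comp (g := S.pull Ψ) (f := fun b => (z, b)) (χ 1) hκ.hasFDerivAt
        (hasFDerivAt_prodMk_right z (χ 1))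
    have h1 := h0.clm_apply (hasFDerivAt_const (η, (0 : EG)) (χ 1))
    have h2 := h1.snd.unique ((hasFDerivAt_const (0 : EG) _).congr_of_eventuallyEq
      (Filter.eventually_of_mem (hχt.mem_nhds he) fun b hb => congrArg Prod.snd (hhor b hb)))
    have h3 := plainDeriv_comp EG EG (x := χ 1) (S.mdifferentiable_rep 1)
      (mdifferentiableAt_extChartAt_symm_one he) hχ1
    rw [plainDeriv_eq_fderiv] at h3
    have h4 : DifferentiableAt ℝ (S.rep ∘ χ.symm) (χ 1) :=
      ((S.mdifferentiable_rep _).comp _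
        (mdifferentiableAt_extChartAt_symm_one he)).differentiableAt
    -- Differentiating `ρ(g) ρ(g⁻¹) u = u` at `g = 1` gives the derivative of `ρ(g⁻¹) u` without
    -- differentiating the inversion of `G`.
    have h5 := (h4.hasFDerivAt.clm_apply h1.fst).unique
      ((hasFDerivAt_const u _).congr_of_eventuallyEq
      (Filter.eventually_of_mem (hχt.mem_nhds he) fun b hb => by
        simp only [hhor b hb, Function.comp_apply, rep_rep_inv]))
    have h6 := congrArg (fun L : EG →L[ℝ] _ => L α) h5
    have h7 := congrArg (fun L : EG →L[ℝ] _ => L α) h2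
    rw [h3] at h6
    simp only [hhor _ he] at h6
    refine Prod.ext ?_ (by simpa using h7)
    simp [hχ1, rep_one] at h6
    exact eq_neg_of_add_eq_zero_left h6
  have h8 := S.formD_pull (hU.prod hχt) hΨ hw (0, α) (η, 0)
  have h9 : formD (S.pull Ψ) (z, χ 1) (0, α) (η, 0) = -S.structureFn (Ψ (z, χ 1))
    (S.pull Ψ (z, χ 1) (0, α)) (S.pull Ψ (z, χ 1) (η, 0)) := h8
  have h10 : Ψ (z, χ 1) = f z := by simp [Ψ, hχ1]
  rw [formD, hd1, hd2, sub_zero, hvert z hz, hhor _ he, hχ1, inv_one, rep_one, h10,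
    ← neg_eq_iff_eq_neg] at h9
  refine h9.symm.trans ?_
  simp [χ]

/-! ### Framed charts and the existence of normal coordinates -/

namespace FramedChart

variable {S} (c : S.FramedChart)

theorem contDiffOn_solder : ContDiffOn ℝ ∞ c.solder c.dom := by
  rw [contDiffOn_clm_apply]
  exact fun v => ((S.contDiffOn_pull c.isOpen_dom c.smooth).clm_apply contDiffOn_const).fst

theorem contDiffOn_connForm : ContDiffOn ℝ ∞ c.connForm c.dom := by
  rw [contDiffOn_clm_apply]
  exact fun v => S.repDeriv.contDiff.comp_contDiffOn
    ((S.contDiffOn_pull c.isOpen_dom c.smooth).clm_apply contDiffOn_const).snd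

theorem isInvertible_solder {w : EuclideanSpace ℝ (Fin n)} (hw : w ∈ c.dom) :
    (c.solder w).IsInvertible :=
  ContinuousLinearMap.isInvertible_of_bijective (c.transverse w hw)

theorem differentiableAt_solder {w : EuclideanSpace ℝ (Fin n)} (hw : w ∈ c.dom) :
    DifferentiableAt ℝ c.solder w :=
  (c.contDiffOn_solder.contDiffAt (c.isOpen_dom.mem_nhds hw)).differentiableAt (by simp)

theorem christoffel_eq {w : EuclideanSpace ℝ (Fin n)} (hw : w ∈ c.dom)
    (v u : EuclideanSpace ℝ (Fin n)) :
    c.christoffel w v u = coframeChristoffel c.solder c.connForm w v u := by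
  have h := ((c.differentiableAt_solder hw).hasFDerivAt.clm_apply (hasFDerivAt_const u w)).fderiv
  rw [christoffel, nabla, h, coframeChristoffel]
  simp

/-- The regularity that `eqOn_of_second_order` needs for uniqueness of geodesics. -/
theorem contDiffOn_christoffel : ContDiffOn ℝ 1
    (fun x : EuclideanSpace ℝ (Fin n) × EuclideanSpace ℝ (Fin n) => c.christoffel x.1 x.2 x.2)
    (c.dom ×ˢ Set.univ) := by
  have hs : ContDiffOn ℝ 1 (fun x : EuclideanSpace ℝ (Fin n) × EuclideanSpace ℝ (Fin n) =>
      c.solder x.1) (c.dom ×ˢ Set.univ) :=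
    (c.contDiffOn_solder.of_le (by norm_cast)).comp contDiffOn_fst fun x hx => hx.1
  have hds : ContDiffOn ℝ 1 (fun x : EuclideanSpace ℝ (Fin n) × EuclideanSpace ℝ (Fin n) =>
      fderiv ℝ c.solder x.1) (c.dom ×ˢ Set.univ) :=
    (c.contDiffOn_solder.fderiv_of_isOpen c.isOpen_dom (by norm_cast)).comp contDiffOn_fst
      fun x hx => hx.1
  have ha : ContDiffOn ℝ 1 (fun x : EuclideanSpace ℝ (Fin n) × EuclideanSpace ℝ (Fin n) =>
      c.connForm x.1) (c.dom ×ˢ Set.univ) :=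
    (c.contDiffOn_connForm.of_le (by norm_cast)).comp contDiffOn_fst fun x hx => hx.1
  have hi : ContDiffOn ℝ 1 (fun x : EuclideanSpace ℝ (Fin n) × EuclideanSpace ℝ (Fin n) =>
      (c.solder x.1).inverse) (c.dom ×ˢ Set.univ) := by
    intro x hx
    obtain ⟨L, hL⟩ := c.isInvertible_solder hx.1
    have h4 := contDiffAt_map_inverse (𝕜 := ℝ) (n := 1) L
    rw [hL] at h4
    exact h4.comp_contDiffWithinAt x (hs x hx)
  refine (hi.clm_apply (((hds.clm_apply contDiffOn_snd).clm_apply contDiffOn_snd).add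
    ((ha.clm_apply contDiffOn_snd).clm_apply (hs.clm_apply contDiffOn_snd)))).congr fun x hx => ?_
  exact c.christoffel_eq hx.1 _ _

/-- The parametrization of `P` given by a section and a chart of `G` at `1`. -/
def gauge (x : EuclideanSpace ℝ (Fin n) × EG) : P :=
  op ((extChartAt 𝓘(ℝ, EG) (1 : G)).symm x.2) • c.σ x.1

theorem contMDiffOn_gauge : ContMDiffOn 𝓘(ℝ, EuclideanSpace ℝ (Fin n) × EG) 𝓘(ℝ, EP) ∞ c.gauge
    (c.dom ×ˢ (extChartAt 𝓘(ℝ, EG) (1 : G)).target) :=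
  S.contMDiffOn_gauge c.smooth

theorem isOpen_dom_prod : IsOpen (c.dom ×ˢ (extChartAt 𝓘(ℝ, EG) (1 : G)).target) :=
  c.isOpen_dom.prod (isOpen_extChartAt_target _)

theorem pull_gauge_one {w : EuclideanSpace ℝ (Fin n)} (hw : w ∈ c.dom)
    (v : EuclideanSpace ℝ (Fin n)) (β : EG) :
    S.pull c.gauge (w, extChartAt 𝓘(ℝ, EG) (1 : G) 1) (v, β) = (c.solder w v,
      GStr.Ad (1 : G)⁻¹ (S.pull c.σ w v).2 +
        plainDeriv EG EG (extChartAt 𝓘(ℝ, EG) (1 : G)).symm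
          (extChartAt 𝓘(ℝ, EG) (1 : G) 1) β) := by
  have h1 : plainDeriv EG EG (fun g : G => (1 : G)⁻¹ * g) 1 = ContinuousLinearMap.id ℝ EG := by
    simp only [inv_one, one_mul]
    exact mfderiv_id
  have h2 := S.pull_gauge c.isOpen_dom c.smooth hw (mem_extChartAt_target (1 : G)) v β
  rw [extChartAt_to_inv, h1] at h2
  refine h2.trans (Prod.ext ?_ rfl)
  rw [inv_one, rep_one]
  rfl

/-- By `pull_gauge_one` the map is block triangular, with the invertible blocks `c.solder w` and the
derivative of the inverse chart of `G`. -/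
theorem isInvertible_pull_gauge {w : EuclideanSpace ℝ (Fin n)} (hw : w ∈ c.dom) :
    (S.pull c.gauge (w, extChartAt 𝓘(ℝ, EG) (1 : G) 1)).IsInvertible := by
  refine ContinuousLinearMap.isInvertible_of_injective ?_ rfl
  rw [injective_iff_map_eq_zero]
  rintro ⟨v, β⟩ h
  rw [c.pull_gauge_one hw, Prod.mk_eq_zero] at h
  have hv : v = 0 := (c.isInvertible_solder hw).injective (by rw [h.1, map_zero])
  subst hv
  have hβ : β = 0 := isInvertible_plainDeriv_extChartAt_symm_one.injective
    (by simpa using h.2)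
  rw [hβ]; rfl

/-- Normal coordinates at `w₀`, together with the section over them that is parallel along the
rays: these are determined by the radial flow of the horizontal vector fields dual to `θ`. -/
structure RadialGauge (w₀ : EuclideanSpace ℝ (Fin n)) where
  r : ℝ
  r_pos : 0 < r
  range : Set (EuclideanSpace ℝ (Fin n) × EG)
  isOpen_range : IsOpen range
  range_subset : range ⊆ c.dom ×ˢ (extChartAt 𝓘(ℝ, EG) (1 : G)).target
  isInvertible : ∀ z ∈ range, (S.pull c.gauge z).IsInvertible
  coord : OpenPartialHomeomorph (EuclideanSpace ℝ (Fin n)) (EuclideanSpace ℝ (Fin n))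
  lift : EuclideanSpace ℝ (Fin n) → EuclideanSpace ℝ (Fin n) × EG
  fst_lift : ∀ x, (lift x).1 = coord x
  coord_source : coord.source = Metric.ball 0 r
  coord_zero : coord 0 = w₀
  smooth : ContDiffOn ℝ ∞ lift (Metric.ball 0 r)
  smooth_symm : ContDiffOn ℝ ∞ coord.symm coord.target
  isInvertible_fderiv : ∀ x ∈ Metric.ball 0 r, (fderiv ℝ coord x).IsInvertible
  lift_mem : ∀ x ∈ Metric.ball 0 r, lift x ∈ range
  radial : ∀ (t : ℝ) (u : EuclideanSpace ℝ (Fin n)), t • u ∈ Metric.ball 0 r →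
    S.pull c.gauge (lift (t • u)) (fderiv ℝ lift (t • u) u) = (u, 0)

/-- On the open set where the coframe pulls back to an invertible map, `(S.pull c.gauge z).inverse
(u, 0)` is a horizontal field, and `exists_radial_flow` integrates these fields from `(w₀, χ 1)`.
The base component of the flow has derivative inverse to `c.solder w₀` at the origin, so after
shrinking the ball it is a coordinate system. -/
theorem nonempty_radialGauge {w₀ : EuclideanSpace ℝ (Fin n)} (hw₀ : w₀ ∈ c.dom) :
    Nonempty (c.RadialGauge w₀) := by
  let χ := extChartAt 𝓘(ℝ, EG) (1 : G)
  have hκ := S.contDiffOn_pull c.isOpen_dom_prod c.contMDiffOn_gauge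
  let O : Set (EuclideanSpace ℝ (Fin n) × EG) := (c.dom ×ˢ χ.target) ∩
    S.pull c.gauge ⁻¹' Set.range ((↑) : ((EuclideanSpace ℝ (Fin n) × EG) ≃L[ℝ]
      (EuclideanSpace ℝ (Fin n) × EG)) → _)
  have hO : IsOpen O := hκ.continuousOn.isOpen_inter_preimage c.isOpen_dom_prod
    ContinuousLinearEquiv.isOpen
  have hinv : ∀ z ∈ O, (S.pull c.gauge z).IsInvertible := fun z hz => hz.2
  have hz : (w₀, χ 1) ∈ O := ⟨⟨hw₀, mem_extChartAt_target (1 : G)⟩, c.isInvertible_pull_gauge hw₀⟩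
  have hf : ContDiffOn ℝ ∞ (fun z => (S.pull c.gauge z).inverse.comp
      (ContinuousLinearMap.inl ℝ (EuclideanSpace ℝ (Fin n)) EG)) O := by
    intro z hz
    obtain ⟨L, hL⟩ := hinv z hz
    have h4 := contDiffAt_map_inverse (𝕜 := ℝ) (n := ∞) L
    rw [hL] at h4
    exact (h4.comp_contDiffWithinAt z ((hκ z hz.1).mono Set.inter_subset_left)).clm_comp
      contDiffWithinAt_const
  have : CompleteSpace EG := FiniteDimensional.complete ℝ EG
  obtain ⟨r₀, hr₀, τ, hτ, hτ0, hτO, hray⟩ := exists_radial_flow hf hO hz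
  have hrad : ∀ (t : ℝ) (u : EuclideanSpace ℝ (Fin n)), t • u ∈ Metric.ball 0 r₀ →
      S.pull c.gauge (τ (t • u)) (fderiv ℝ τ (t • u) u) = (u, 0) := by
    intro t u h
    rw [hray t u h]
    exact (hinv _ (hτO _ h)).self_apply_inverse _
  have h0 : (0 : EuclideanSpace ℝ (Fin n)) ∈ Metric.ball 0 r₀ := Metric.mem_ball_self hr₀
  have hτd : DifferentiableAt ℝ τ 0 :=
    (hτ.contDiffAt (Metric.isOpen_ball.mem_nhds h0)).differentiableAt (by simp)
  have hφ0 : (fderiv ℝ (fun x => (τ x).1) 0).IsInvertible := by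
    refine ContinuousLinearMap.isInvertible_of_injective ?_ rfl
    rw [injective_iff_map_eq_zero]
    intro u hu
    have h1 := hrad 0 u (by simpa using hr₀)
    rw [hτd.hasFDerivAt.fst.fderiv] at hu
    have hu' : (fderiv ℝ τ 0 u).1 = 0 := hu
    rw [zero_smul, hτ0, ← Prod.mk.eta (p := fderiv ℝ τ 0 u), c.pull_gauge_one hw₀, hu',
      map_zero] at h1
    exact (congrArg Prod.fst h1).symm
  obtain ⟨e, he0, hes, he, hsymm, hder⟩ :=
    hτ.fst.exists_openPartialHomeomorph Metric.isOpen_ball h0 hφ0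
  obtain ⟨r, hr, hre⟩ := Metric.isOpen_iff.1 e.open_source 0 he0
  have hsub : Metric.ball (0 : EuclideanSpace ℝ (Fin n)) r ⊆ Metric.ball 0 r₀ := hre.trans hes
  have hsource : (e.restrOpen (Metric.ball 0 r) Metric.isOpen_ball).source = Metric.ball 0 r := by
    rw [OpenPartialHomeomorph.restrOpen_source]
    exact Set.inter_eq_right.2 hre
  exact ⟨{
    r := r
    r_pos := hr
    range := O
    isOpen_range := hO
    range_subset := Set.inter_subset_left
    isInvertible := hinv
    coord := e.restrOpen (Metric.ball 0 r) Metric.isOpen_ball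
    lift := τ
    fst_lift := fun x => (congrFun he x).symm
    coord_source := hsource
    coord_zero := (congrFun he 0).trans (congrArg Prod.fst hτ0)
    smooth := hτ.mono hsub
    smooth_symm := hsymm.mono fun y hy => hy.1
    isInvertible_fderiv := fun x hx => by
      have h1 := hder x (hre hx)
      rw [← he] at h1
      exact h1
    lift_mem := fun x hx => hτO x (hsub hx)
    radial := fun t u h => hrad t u (hsub h) }⟩

end FramedChart

/-! ### Geodesics and the geodesic symmetry in normal coordinates -/

namespace FramedChart.RadialGauge

variable {S} {c : S.FramedChart} {w₀ : EuclideanSpace ℝ (Fin n)} (R : c.RadialGauge w₀)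

/-- The pullback of the coframe of `P` to normal coordinates. -/
def form (x : EuclideanSpace ℝ (Fin n)) :
    EuclideanSpace ℝ (Fin n) →L[ℝ] EuclideanSpace ℝ (Fin n) × EG :=
  (S.pull c.gauge (R.lift x)).comp (fderiv ℝ R.lift x)

/-- The soldering form in normal coordinates. -/
def solder (x : EuclideanSpace ℝ (Fin n)) : EuclideanSpace ℝ (Fin n) →L[ℝ] EuclideanSpace ℝ
    (Fin n) :=
  (ContinuousLinearMap.fst ℝ _ _).comp (R.form x)

/-- The connection form in normal coordinates. -/
def connForm (x : EuclideanSpace ℝ (Fin n)) :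
    EuclideanSpace ℝ (Fin n) →L[ℝ] EuclideanSpace ℝ (Fin n) →L[ℝ] EuclideanSpace ℝ (Fin n) :=
  S.repDeriv.comp ((ContinuousLinearMap.snd ℝ _ _).comp (R.form x))

/-- The change of frame from the given section to the radially parallel one. -/
def transition (x : EuclideanSpace ℝ (Fin n)) :
    EuclideanSpace ℝ (Fin n) →L[ℝ] EuclideanSpace ℝ (Fin n) :=
  S.rep ((extChartAt 𝓘(ℝ, EG) (1 : G)).symm (R.lift x).2)

variable {x : EuclideanSpace ℝ (Fin n)}

theorem coord_eq : (R.coord : EuclideanSpace ℝ (Fin n) → EuclideanSpace ℝ (Fin n))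
    = fun x => (R.lift x).1 :=
  funext fun x => (R.fst_lift x).symm

theorem smooth_coord : ContDiffOn ℝ ∞ R.coord (Metric.ball 0 R.r) := by
  rw [coord_eq]
  exact R.smooth.fst

theorem contDiffAt_lift (hx : x ∈ Metric.ball 0 R.r) : ContDiffAt ℝ ∞ R.lift x :=
  R.smooth.contDiffAt (Metric.isOpen_ball.mem_nhds hx)

theorem contDiffAt_coord (hx : x ∈ Metric.ball 0 R.r) : ContDiffAt ℝ ∞ R.coord x :=
  R.smooth_coord.contDiffAt (Metric.isOpen_ball.mem_nhds hx)

theorem lift_mem_prod (hx : x ∈ Metric.ball 0 R.r) :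
    R.lift x ∈ c.dom ×ˢ (extChartAt 𝓘(ℝ, EG) (1 : G)).target :=
  R.range_subset (R.lift_mem x hx)

theorem coord_mem (hx : x ∈ Metric.ball 0 R.r) : R.coord x ∈ c.dom := by
  rw [← R.fst_lift]
  exact (R.lift_mem_prod hx).1

theorem zero_mem : (0 : EuclideanSpace ℝ (Fin n)) ∈ Metric.ball 0 R.r :=
  Metric.mem_ball_self R.r_pos

theorem form_smul {t : ℝ} {u : EuclideanSpace ℝ (Fin n)} (h : t • u ∈ Metric.ball 0 R.r) :
    R.form (t • u) u = (u, 0) :=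
  R.radial t u h

theorem contDiffAt_form (hx : x ∈ Metric.ball 0 R.r) : ContDiffAt ℝ ∞ R.form x := by
  have h1 : ContDiffAt ℝ ∞ (S.pull c.gauge) (R.lift x) :=
    (S.contDiffOn_pull c.isOpen_dom_prod c.contMDiffOn_gauge).contDiffAt
      (c.isOpen_dom_prod.mem_nhds (R.lift_mem_prod hx))
  exact (h1.comp x (R.contDiffAt_lift hx)).clm_comp
    ((R.contDiffAt_lift hx).fderiv_right (by norm_cast))

theorem differentiableAt_solder (hx : x ∈ Metric.ball 0 R.r) : DifferentiableAt ℝ R.solder x :=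
  (contDiffAt_const.clm_comp (R.contDiffAt_form hx)).differentiableAt (by simp)

theorem mdifferentiableAt_section (hx : x ∈ Metric.ball 0 R.r) :
    MDifferentiableAt 𝓘(ℝ, EuclideanSpace ℝ (Fin n)) 𝓘(ℝ, EP) c.σ (R.coord x) :=
  (c.smooth.contMDiffAt (c.isOpen_dom.mem_nhds (R.coord_mem hx))).mdifferentiableAt (by simp)

theorem mdifferentiableAt_chart (hx : x ∈ Metric.ball 0 R.r) :
    MDifferentiableAt 𝓘(ℝ, EuclideanSpace ℝ (Fin n)) 𝓘(ℝ, EG)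
      (fun y => (extChartAt 𝓘(ℝ, EG) (1 : G)).symm (R.lift y).2) x :=
  (mdifferentiableAt_extChartAt_symm_one (R.lift_mem_prod hx).2).comp x
    ((R.contDiffAt_lift hx).differentiableAt (by simp)).snd.mdifferentiableAt

theorem differentiableAt_transition (hx : x ∈ Metric.ball 0 R.r) :
    DifferentiableAt ℝ R.transition x :=
  ((S.mdifferentiable_rep _).comp x (R.mdifferentiableAt_chart hx)).differentiableAt

/-- `c.gauge ∘ R.lift` is the section `c.σ ∘ R.coord` moved by a `G`-valued function. This makes the
gauge-change formulas available for the radial gauge. -/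
theorem form_eq (hx : x ∈ Metric.ball 0 R.r) : R.form x = S.pull (fun y =>
    op ((extChartAt 𝓘(ℝ, EG) (1 : G)).symm (R.lift y).2) • (c.σ ∘ R.coord) y) x := by
  have h1 := S.pull_comp (f := c.gauge) (g := R.lift) (y := x)
    ((c.contMDiffOn_gauge.contMDiffAt
      (c.isOpen_dom_prod.mem_nhds (R.lift_mem_prod hx))).mdifferentiableAt (by simp))
    ((R.contDiffAt_lift hx).differentiableAt (by simp))
  rw [form, ← h1, coord_eq]
  rfl

theorem pull_section (hx : x ∈ Metric.ball 0 R.r) (v : EuclideanSpace ℝ (Fin n)) :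
    S.pull (c.σ ∘ R.coord) x v = S.pull c.σ (R.coord x) (fderiv ℝ R.coord x v) := by
  rw [S.pull_comp (R.mdifferentiableAt_section hx)
    ((R.contDiffAt_coord hx).differentiableAt (by simp))]
  rfl

theorem transition_solder (hx : x ∈ Metric.ball 0 R.r) (v : EuclideanSpace ℝ (Fin n)) :
    R.transition x (R.solder x v) = c.solder (R.coord x) (fderiv ℝ R.coord x v) := by
  have h1 := S.rep_pull_action_fst (s := c.σ ∘ R.coord) (z := x)
    ((R.mdifferentiableAt_section hx).comp x
      ((R.contDiffAt_coord hx).differentiableAt (by simp)).mdifferentiableAt)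
    (R.mdifferentiableAt_chart hx) v
  rw [← R.form_eq hx, R.pull_section hx] at h1
  exact h1

theorem transition_connForm (hx : x ∈ Metric.ball 0 R.r) (v : EuclideanSpace ℝ (Fin n)) :
    (R.transition x).comp (R.connForm x v)
      = (c.connForm (R.coord x) (fderiv ℝ R.coord x v)).comp (R.transition x)
        + fderiv ℝ R.transition x v := by
  have h1 := S.rep_pull_action_snd (s := c.σ ∘ R.coord) (z := x)
    ((R.mdifferentiableAt_section hx).comp x
      ((R.contDiffAt_coord hx).differentiableAt (by simp)).mdifferentiableAt)
    (R.mdifferentiableAt_chart hx) v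
  rw [← R.form_eq hx, R.pull_section hx] at h1
  exact h1

theorem isInvertible_solder (hx : x ∈ Metric.ball 0 R.r) : (R.solder x).IsInvertible := by
  refine ContinuousLinearMap.isInvertible_of_injective ?_ rfl
  rw [injective_iff_map_eq_zero]
  intro v hv
  have h1 := R.transition_solder hx v
  rw [hv, map_zero] at h1
  refine (R.isInvertible_fderiv x hx).injective ?_
  rw [map_zero]
  exact (c.isInvertible_solder (R.coord_mem hx)).injective (by rw [map_zero, ← h1])

/-- The Christoffel symbols in normal coordinates. -/
def christoffel (x v u : EuclideanSpace ℝ (Fin n)) : EuclideanSpace ℝ (Fin n) :=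
  coframeChristoffel R.solder R.connForm x v u

theorem christoffel_transformation (hx : x ∈ Metric.ball 0 R.r) (v u : EuclideanSpace ℝ (Fin n)) :
    fderiv ℝ (fun y => fderiv ℝ R.coord y u) x v
      + c.christoffel (R.coord x) (fderiv ℝ R.coord x v) (fderiv ℝ R.coord x u)
      = fderiv ℝ R.coord x (R.christoffel x v u) := by
  rw [c.christoffel_eq (R.coord_mem hx)]
  exact coframeChristoffel_transformation ((R.contDiffAt_coord hx).of_le (by norm_cast))
    (R.differentiableAt_transition hx) (c.differentiableAt_solder (R.coord_mem hx))
    (R.differentiableAt_solder hx) (c.isInvertible_solder (R.coord_mem hx))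
    (R.isInvertible_solder hx)
    (Filter.eventually_of_mem (Metric.isOpen_ball.mem_nhds hx) fun y hy => R.transition_solder hy)
    (R.transition_connForm hx) v u

/-- In the radial gauge the soldering form fixes the radial vector and the connection form
annihilates it, which is the situation of `coframeChristoffel_geodesic`. -/
theorem isGeodesic {ε : ℝ} (u : EuclideanSpace ℝ (Fin n))
    (hu : ∀ t ∈ Set.Ioo (-ε) ε, t • u ∈ Metric.ball 0 R.r) :
    c.IsGeodesic (fun t => R.coord (t • u)) ε := by
  refine ⟨R.smooth_coord.comp (contDiff_id.smul contDiff_const).contDiffOn hu,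
    fun t ht => R.coord_mem (hu t ht), fun t ht => ?_⟩
  rw [c.christoffel_eq (R.coord_mem (hu t ht))]
  have hx := hu t ht
  refine coframeChristoffel_geodesic ((R.contDiffAt_coord hx).of_le (by norm_cast))
    (R.differentiableAt_transition hx) (c.differentiableAt_solder (R.coord_mem hx))
    (R.differentiableAt_solder hx) (c.isInvertible_solder (R.coord_mem hx))
    (R.isInvertible_solder hx)
    (Filter.eventually_of_mem (Metric.isOpen_ball.mem_nhds hx) fun y hy => R.transition_solder hy)
    (R.transition_connForm hx) ?_ ?_
  · filter_upwards [isOpen_Ioo.mem_nhds ht] with r hr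
    exact congrArg Prod.fst (R.form_smul (hu r hr))
  · have h1 : (R.form (t • u) u).2 = 0 := congrArg Prod.snd (R.form_smul hx)
    rw [connForm, ContinuousLinearMap.comp_apply, ContinuousLinearMap.comp_apply]
    exact (congrArg S.repDeriv h1).trans (map_zero _)

theorem hasDerivAt_coord_smul {u : EuclideanSpace ℝ (Fin n)} :
    HasDerivAt (fun t : ℝ => R.coord (t • u)) (fderiv ℝ R.coord 0 u) 0 := by
  have h1 : HasDerivAt (fun t : ℝ => t • u) u 0 := by
    simpa using (hasDerivAt_id (0 : ℝ)).smul_const u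
  have h2 : HasFDerivAt R.coord (fderiv ℝ R.coord 0) ((0 : ℝ) • u) := by
    rw [zero_smul]
    exact ((R.contDiffAt_coord R.zero_mem).differentiableAt (by simp)).hasFDerivAt
  exact h2.comp_hasDerivAt 0 h1

/-- In normal coordinates the geodesics through the origin are the rays. -/
theorem eq_coord_smul_of_isGeodesic {ε : ℝ} (hε : 0 < ε) {γ : ℝ → EuclideanSpace ℝ (Fin n)}
    (hγ : c.IsGeodesic γ ε) (h0 : γ 0 = w₀) (hs : ∀ t ∈ Set.Ioo (-ε) ε, γ t ∈ R.coord.target) :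
    ∃ u : EuclideanSpace ℝ (Fin n), ∀ t ∈ Set.Ioo (-ε) ε,
      t • u ∈ Metric.ball 0 R.r ∧ γ t = R.coord (t • u) := by
  let u := (fderiv ℝ R.coord 0).inverse (deriv γ 0)
  have hu : fderiv ℝ R.coord 0 u = deriv γ 0 :=
    (R.isInvertible_fderiv 0 R.zero_mem).self_apply_inverse _
  have hmem : ∀ δ : ℝ, δ * ‖u‖ ≤ R.r → ∀ t ∈ Set.Ioo (-δ) δ, t • u ∈ Metric.ball 0 R.r := by
    intro δ hδ t ht
    rw [mem_ball_zero_iff, norm_smul, Real.norm_eq_abs]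
    have h1 : |t| < δ := abs_lt.2 ht
    rcases (norm_nonneg u).eq_or_lt with h | h
    · rw [← h, mul_zero]
      exact R.r_pos
    · exact (mul_lt_mul_of_pos_right h1 h).trans_le hδ
  have hagree : ∀ δ : ℝ, 0 < δ → δ ≤ ε → δ * ‖u‖ ≤ R.r →
      Set.EqOn γ (fun t => R.coord (t • u)) (Set.Ioo (-δ) δ) := by
    intro δ hδ hδε hδr
    have hsub : Set.Ioo (-δ) δ ⊆ Set.Ioo (-ε) ε := Set.Ioo_subset_Ioo (neg_le_neg hδε) hδε
    have hg := R.isGeodesic u (hmem δ hδr)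
    refine eqOn_of_second_order (q := fun w v => c.christoffel w v v) c.isOpen_dom
      c.contDiffOn_christoffel ((hγ.1.mono hsub).of_le (by norm_cast))
      (hg.1.of_le (by norm_cast)) (fun t ht => hγ.2.1 t (hsub ht)) hg.2.1
      (fun t ht => hγ.2.2 t (hsub ht)) hg.2.2 (t₀ := 0) ⟨neg_lt_zero.2 hδ, hδ⟩ ?_ ?_
    · rw [h0, zero_smul, R.coord_zero]
    · rw [R.hasDerivAt_coord_smul.deriv, hu]
  -- Otherwise the ray would reach the boundary of the ball at the time `δ = R.r / ‖u‖ < ε`. Up to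
  -- then it agrees with `γ`, so by continuity the normal coordinate of `γ δ` would be `δ • u`, of
  -- norm `R.r`, although `γ δ` lies in the image of the open ball.
  have hle : ε * ‖u‖ ≤ R.r := by
    by_contra! hlt
    have hu0 : 0 < ‖u‖ := pos_of_mul_pos_right (R.r_pos.trans hlt) hε.le
    let δ := R.r / ‖u‖
    have hδ : 0 < δ := div_pos R.r_pos hu0
    have hδr : δ * ‖u‖ = R.r := div_mul_cancel₀ _ hu0.ne'
    have hδε : δ < ε := (div_lt_iff₀ hu0).2 hlt
    have hδm : δ ∈ Set.Ioo (-ε) ε := ⟨by linarith, hδε⟩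
    have hγc : ContinuousAt γ δ := (hγ.1.contDiffAt (isOpen_Ioo.mem_nhds hδm)).continuousAt
    have h1 : ContinuousAt (fun t => R.coord.symm (γ t)) δ :=
      (R.coord.symm.continuousAt (hs δ hδm)).comp hγc
    have h2 : ContinuousAt (fun t : ℝ => t • u) δ := by fun_prop
    have h3 : (fun t : ℝ => t • u) =ᶠ[nhdsWithin δ (Set.Iio δ)] fun t => R.coord.symm (γ t) := by
      filter_upwards [Ioo_mem_nhdsLT (neg_lt_self hδ)] with t ht
      rw [hagree δ hδ hδε.le hδr.le ht, R.coord.left_inv]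
      rw [R.coord_source]
      exact hmem δ hδr.le t ht
    have h4 : R.coord.symm (γ δ) = δ • u := tendsto_nhds_unique
      (h1.tendsto.mono_left nhdsWithin_le_nhds)
      ((h2.tendsto.mono_left nhdsWithin_le_nhds).congr' h3)
    have h5 := R.coord.map_target (hs δ hδm)
    rw [h4, R.coord_source, mem_ball_zero_iff, norm_smul, Real.norm_of_nonneg hδ.le, hδr] at h5
    exact lt_irrefl _ h5
  exact ⟨u, fun t ht => ⟨hmem ε hle t ht, hagree ε hε le_rfl hle ht⟩⟩

/-- The geodesic symmetry at the origin of normal coordinates. -/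
def symmetry : OpenPartialHomeomorph (EuclideanSpace ℝ (Fin n)) (EuclideanSpace ℝ (Fin n)) :=
  R.coord.symm.trans ((Homeomorph.neg (EuclideanSpace ℝ (Fin n))).toOpenPartialHomeomorph.trans
    R.coord)

theorem symmetry_apply (w : EuclideanSpace ℝ (Fin n)) :
    R.symmetry w = R.coord (-R.coord.symm w) := rfl

theorem neg_mem {x : EuclideanSpace ℝ (Fin n)} (hx : x ∈ Metric.ball 0 R.r) :
    -x ∈ Metric.ball 0 R.r := by
  rw [mem_ball_zero_iff, norm_neg]
  exact mem_ball_zero_iff.1 hx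

theorem symm_mem {w : EuclideanSpace ℝ (Fin n)} (hw : w ∈ R.coord.target) :
    R.coord.symm w ∈ Metric.ball 0 R.r := by
  rw [← R.coord_source]
  exact R.coord.map_target hw

theorem symmetry_source : R.symmetry.source = R.coord.target := by
  ext w
  simp only [symmetry, OpenPartialHomeomorph.trans_source, OpenPartialHomeomorph.symm_source,
    Homeomorph.toOpenPartialHomeomorph_source, Set.univ_inter, Set.mem_inter_iff,
    Set.mem_preimage, and_iff_left_iff_imp, R.coord_source]
  exact fun hw => R.neg_mem (R.symm_mem hw)

theorem symmetry_target : R.symmetry.target = R.coord.target := by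
  ext w
  simp only [symmetry, OpenPartialHomeomorph.trans_target, OpenPartialHomeomorph.symm_target,
    Homeomorph.toOpenPartialHomeomorph_target, Set.mem_inter_iff, Set.inter_univ,
    Set.preimage_univ, R.coord_source,
    Set.mem_preimage, and_iff_left_iff_imp]
  exact fun hw => R.neg_mem (R.symm_mem hw)

theorem target_subset : R.coord.target ⊆ c.dom := by
  intro w hw
  rw [← R.coord.right_inv hw]
  exact R.coord_mem (R.symm_mem hw)

theorem smooth_symmetry : ContDiffOn ℝ ∞ R.symmetry R.coord.target :=
  R.smooth_coord.comp R.smooth_symm.neg fun _ hw => R.neg_mem (R.symm_mem hw)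

theorem isGeodesicSymmetry : c.IsGeodesicSymmetry w₀ R.symmetry where
  mem_source := by
    have h := R.coord.map_source (x := 0) (by rw [R.coord_source]; exact R.zero_mem)
    rwa [R.coord_zero, ← R.symmetry_source] at h
  source_subset := R.symmetry_source ▸ R.target_subset
  target_subset := R.symmetry_target ▸ R.target_subset
  smooth := R.symmetry_source ▸ R.smooth_symmetry
  smooth_symm := R.symmetry_target ▸ R.smooth_symmetry
  reverses := by
    intro ε γ hε hγ h0 hs t ht
    rw [R.symmetry_source] at hs
    obtain ⟨u, hu⟩ := R.eq_coord_smul_of_isGeodesic hε hγ h0 hs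
    have ht' : -t ∈ Set.Ioo (-ε) ε := ⟨neg_lt_neg ht.2, by linarith [ht.1]⟩
    rw [(hu t ht).2, (hu (-t) ht').2, symmetry_apply, R.coord.left_inv, neg_smul]
    rw [R.coord_source]
    exact (hu t ht).1

/-- The geodesic symmetry is affine if the Christoffel symbols in normal coordinates are odd. -/
theorem isAffine_symmetry
    (hodd : ∀ x ∈ Metric.ball 0 R.r, ∀ v u, R.christoffel (-x) v u = -R.christoffel x v u) :
    c.IsAffine R.symmetry := by
  intro w hw v u
  rw [R.symmetry_source] at hw
  obtain ⟨x, hx, rfl⟩ : ∃ x ∈ Metric.ball 0 R.r, R.coord x = w :=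
    ⟨_, R.symm_mem hw, R.coord.right_inv hw⟩
  obtain ⟨v, rfl⟩ := (R.isInvertible_fderiv x hx).surjective v
  obtain ⟨u, rfl⟩ := (R.isInvertible_fderiv x hx).surjective u
  have hs : ∀ y ∈ Metric.ball 0 R.r, ContDiffAt ℝ ∞ R.symmetry (R.coord y) := fun y hy =>
    R.smooth_symmetry.contDiffAt (R.coord.open_target.mem_nhds
      (R.coord.map_source (by rwa [R.coord_source])))
  -- The relation `s ∘ φ = φ ∘ (-1)` is differentiated once in `hd` and a second time in `hdd`.
  have hcomp : ∀ y ∈ Metric.ball 0 R.r, R.symmetry (R.coord y) = R.coord (-y) := fun y hy => by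
    rw [symmetry_apply, R.coord.left_inv (by rwa [R.coord_source])]
  have hd : ∀ y ∈ Metric.ball 0 R.r, ∀ u,
      fderiv ℝ R.symmetry (R.coord y) (fderiv ℝ R.coord y u) = -fderiv ℝ R.coord (-y) u := by
    intro y hy u
    have h1 := ((hs y hy).differentiableAt (by simp)).hasFDerivAt.comp y
      ((R.contDiffAt_coord hy).differentiableAt (by simp)).hasFDerivAt
    have h2 : R.symmetry ∘ R.coord =ᶠ[nhds y] fun y => R.coord (-y) :=
      Filter.eventually_of_mem (Metric.isOpen_ball.mem_nhds hy) hcomp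
    have h3 : HasFDerivAt (fun y => R.coord (-y)) _ y :=
      ((R.contDiffAt_coord (R.neg_mem hy)).differentiableAt (by simp)).hasFDerivAt.comp y
        (hasFDerivAt_id y).neg
    have h4 := congrArg (fun L : EuclideanSpace ℝ (Fin n) →L[ℝ] EuclideanSpace ℝ (Fin n) => L u)
      (h1.unique (h3.congr_of_eventuallyEq h2))
    simpa using h4
  have hφ2 : ∀ y ∈ Metric.ball 0 R.r, DifferentiableAt ℝ (fderiv ℝ R.coord) y := fun y hy =>
    ((R.contDiffAt_coord hy).fderiv_right (m := 1) (by norm_cast)).differentiableAt (by simp)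
  have hφu : ∀ y ∈ Metric.ball 0 R.r, ∀ v u,
      fderiv ℝ (fun x => fderiv ℝ R.coord x u) y v = fderiv ℝ (fderiv ℝ R.coord) y v u := by
    intro y hy v u
    rw [((hφ2 y hy).hasFDerivAt.clm_apply (hasFDerivAt_const u y)).fderiv]
    simp
  have hs2 : DifferentiableAt ℝ (fderiv ℝ R.symmetry) (R.coord x) :=
    ((hs x hx).fderiv_right (m := 1) (by norm_cast)).differentiableAt (by simp)
  have hsu : fderiv ℝ (fun y => fderiv ℝ R.symmetry y (fderiv ℝ R.coord x u)) (R.coord x)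
      (fderiv ℝ R.coord x v)
      = fderiv ℝ (fderiv ℝ R.symmetry) (R.coord x) (fderiv ℝ R.coord x v)
          (fderiv ℝ R.coord x u) := by
    rw [(hs2.hasFDerivAt.clm_apply (hasFDerivAt_const _ _)).fderiv]
    simp
  have hdd : fderiv ℝ (fderiv ℝ R.symmetry) (R.coord x) (fderiv ℝ R.coord x v)
      (fderiv ℝ R.coord x u) + fderiv ℝ R.symmetry (R.coord x)
        (fderiv ℝ (fderiv ℝ R.coord) x v u) = fderiv ℝ (fderiv ℝ R.coord) (-x) v u := by
    have h1 := (hs2.hasFDerivAt.comp x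
      ((R.contDiffAt_coord hx).differentiableAt (by simp)).hasFDerivAt).clm_apply
      ((hφ2 x hx).hasFDerivAt.clm_apply (hasFDerivAt_const u x))
    have h2 : HasFDerivAt (fun y => -fderiv ℝ R.coord (-y) u) _ x :=
      (((hφ2 (-x) (R.neg_mem hx)).hasFDerivAt.comp x
        (hasFDerivAt_id x).neg).clm_apply (hasFDerivAt_const u x)).neg
    have h3 := h1.unique (h2.congr_of_eventuallyEq
      (Filter.eventually_of_mem (Metric.isOpen_ball.mem_nhds hx) fun y hy => hd y hy u))
    have h4 := congrArg (fun L : EuclideanSpace ℝ (Fin n) →L[ℝ] EuclideanSpace ℝ (Fin n) => L v) h3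
    simp at h4
    rw [← h4]
    abel
  -- The laws at `x` and `-x` are compared. Oddness and `hd` turn the right-hand side at `-x` into
  -- the image under the derivative of `s` of the right-hand side at `x`. The second derivatives of
  -- the coordinates then cancel by `hdd`, which leaves the affine condition.
  have h1 := R.christoffel_transformation hx v u
  have h2 := R.christoffel_transformation (R.neg_mem hx) v u
  rw [hφu _ hx] at h1
  rw [hφu _ (R.neg_mem hx), hodd x hx, map_neg, ← hd x hx, ← h1, map_add, ← hdd] at h2
  have h3 : c.christoffel (R.coord (-x)) (-fderiv ℝ R.coord (-x) v) (-fderiv ℝ R.coord (-x) u)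
      = c.christoffel (R.coord (-x)) (fderiv ℝ R.coord (-x) v) (fderiv ℝ R.coord (-x) u) := by
    rw [c.christoffel_eq (R.coord_mem (R.neg_mem hx)),
      c.christoffel_eq (R.coord_mem (R.neg_mem hx)), coframeChristoffel, coframeChristoffel]
    simp
  rw [hsu, hcomp x hx, hd x hx, hd x hx, h3]
  rw [add_right_comm] at h2
  have h4 := add_right_cancel (h2.trans (add_comm _ _))
  exact h4

end FramedChart.RadialGauge

/-! ### Vanishing `T` and `F` imply that the induced connection is locally symmetric -/

theorem structureFn_fst_of_T_eq_zero (hT : ∀ x u v, S.T x u v = 0) (p : P)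
    (u v : EuclideanSpace ℝ (Fin n)) : (S.structureFn p (u, 0) (v, 0)).1 = 0 :=
  neg_eq_zero.1 (hT (S.h p) u v)

/-- Splitting `(v, β)` into its horizontal and vertical parts separates the curvature from the
action of `𝔤` on `ℝⁿ`. This is the shape of structure equation that `radial_pullback_symmetric`
expects. -/
theorem structureFn_horizontal_of_T_eq_zero (hT : ∀ x u v, S.T x u v = 0) (p : P)
    (u v : EuclideanSpace ℝ (Fin n)) (β : EG) :
    S.structureFn p (u, 0) (v, β)
      = (-S.repDeriv β u, (S.structureFn p (u, 0) (v, 0)).2) := by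
  have h1 : (v, β) = ((v, 0) : EuclideanSpace ℝ (Fin n) × EG) + (0, β) := by simp
  rw [h1, structureFn_add_right, S.structureFn_swap p _ (0, β), structureFn_vertical_horizontal]
  refine Prod.ext ?_ ?_
  · simp [S.structureFn_fst_of_T_eq_zero hT]
  · simp

/-- If `F = 0`, the functions on `X` are constant in horizontal directions. -/
theorem mfderiv_frame_of_F_eq_zero (hF : ∀ u, S.F u = 0) (f : S.smoothFunctions) (p : P)
    (u : EuclideanSpace ℝ (Fin n)) :
    plainDeriv EP ℝ (fun q => f.1 (S.h q)) p (S.frame p (u, 0)) = 0 :=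
  congrArg (fun D : Derivation ℝ S.smoothFunctions S.smoothFunctions => (D f).1 (S.h p)) (hF u)

theorem contMDiff_structureFn (a b : EuclideanSpace ℝ (Fin n) × EG) :
    ContMDiff 𝓘(ℝ, EP) 𝓘(ℝ, EuclideanSpace ℝ (Fin n) × EG) ∞ (fun p => S.structureFn p a b) :=
  S.bracketAux_smooth _ _

theorem differentiableAt_structureFn_comp {f : E → P} {z : E}
    (hf : MDifferentiableAt 𝓘(ℝ, E) 𝓘(ℝ, EP) f z) (a b : EuclideanSpace ℝ (Fin n) × EG) :
    DifferentiableAt ℝ (fun y => S.structureFn (f y) a b) z :=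
  (((S.contMDiff_structureFn a b).mdifferentiable (by simp) (f z)).comp z hf).differentiableAt

theorem frame_pull (f : E → P) (z ξ : E) :
    S.frame (f z) (S.pull f z ξ) = plainDeriv E EP f z ξ :=
  S.frame_coframe (f z) _

/-- If `F = 0`, the structure functions are constant in horizontal directions. -/
theorem fderiv_structureFn_of_F_eq_zero (hF : ∀ u, S.F u = 0) {f : E → P} {z ξ : E}
    (hf : MDifferentiableAt 𝓘(ℝ, E) 𝓘(ℝ, EP) f z) (hξ : (S.pull f z ξ).2 = 0)
    (a b : EuclideanSpace ℝ (Fin n) × EG) :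
    fderiv ℝ (fun y => S.structureFn (f y) a b) z ξ = 0 := by
  -- The structure functions descend to `X` as brackets of constant sections. Composing with a
  -- functional `ℓ` produces a scalar smooth function on `X`, to which `F = 0` applies.
  refine SeparatingDual.eq_zero_of_forall_dual_eq_zero (R := ℝ) fun ℓ => ?_
  have hs : ContMDiff 𝓘(ℝ, EP) 𝓘(ℝ, ℝ) ∞ (fun p => ℓ (S.structureFn p a b)) :=
    ℓ.contDiff.contMDiff.comp (S.contMDiff_structureFn a b)
  have h1 := S.mfderiv_frame_of_F_eq_zero hF
    ⟨fun x => ℓ ((S.bracket (S.constSection a) (S.constSection b)).1 x), hs⟩ (f z)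
    (S.pull f z ξ).1
  have h2 : S.frame (f z) ((S.pull f z ξ).1, 0) = plainDeriv E EP f z ξ := by
    rw [← S.frame_pull, ← hξ]
  rw [h2] at h1
  have h3 := plainDeriv_comp E EP (hs.mdifferentiable (by simp) (f z)) hf rfl
  rw [plainDeriv_eq_fderiv] at h3
  have h4 := (ℓ.hasFDerivAt.comp z (S.differentiableAt_structureFn_comp hf a b).hasFDerivAt).fderiv
  have h5 := congrArg (fun L : E →L[ℝ] ℝ => L ξ) (h4.symm.trans h3)
  exact h5.trans h1

namespace FramedChart.RadialGauge

variable {S} {c : S.FramedChart} {w₀ : EuclideanSpace ℝ (Fin n)} (R : c.RadialGauge w₀)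

/-- `T = 0` gives the torsion-free structure equation and `F = 0` the constancy of the curvature in
horizontal directions. These are the hypotheses of `radial_pullback_symmetric`, with `L` the action
of `𝔤` and `R` the curvature part of the structure equation. -/
theorem form_neg (hT : ∀ x u v, S.T x u v = 0) (hF : ∀ u, S.F u = 0)
    {x : EuclideanSpace ℝ (Fin n)} (hx : x ∈ Metric.ball 0 R.r) (v : EuclideanSpace ℝ (Fin n)) :
    (R.form (-x) v).1 = (R.form x v).1 ∧ (R.form (-x) v).2 = -(R.form x v).2 := by
  have hmd : ∀ z ∈ R.range, MDifferentiableAt 𝓘(ℝ, EuclideanSpace ℝ (Fin n) × EG) 𝓘(ℝ, EP)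
      c.gauge z := fun z hz => (c.contMDiffOn_gauge.contMDiffAt
    (c.isOpen_dom_prod.mem_nhds (R.range_subset hz))).mdifferentiableAt (by simp)
  refine radial_pullback_symmetric R.isOpen_range
    ((S.contDiffOn_pull c.isOpen_dom_prod c.contMDiffOn_gauge).mono R.range_subset)
    R.isInvertible (L := fun β u => S.repDeriv β u) (fun β u => map_neg _ _)
    (R := fun z u v => -(S.structureFn (c.gauge z) (u, 0) (v, 0)).2) ?_ ?_ ?_ R.smooth R.lift_mem
    R.radial hx v
  · intro z hz ξ η hξ
    have h1 := S.structureFn_horizontal_of_T_eq_zero hT (c.gauge z) (S.pull c.gauge z ξ).1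
      (S.pull c.gauge z η).1 (S.pull c.gauge z η).2
    have h2 := S.formD_pull c.isOpen_dom_prod c.contMDiffOn_gauge (R.range_subset hz) ξ η
    rw [← Prod.mk.eta (p := S.pull c.gauge z ξ), hξ] at h2
    refine h2.trans ((congrArg Neg.neg h1).trans ?_)
    simp
  · exact fun z hz u v => (S.differentiableAt_structureFn_comp (hmd z hz) _ _).snd.neg
  · intro z hz ξ hξ u v
    have h1 := S.fderiv_structureFn_of_F_eq_zero hF (hmd z hz) hξ (u, 0) (v, 0)
    have h2 : HasFDerivAt (fun z => -(S.structureFn (c.gauge z) (u, 0) (v, 0)).2) _ z :=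
      (S.differentiableAt_structureFn_comp (hmd z hz) (u, 0) (v, 0)).hasFDerivAt.snd.neg
    rw [h2.fderiv]
    simp [h1]

/-- The soldering form is even, so its derivative is odd, and the connection form is odd: each term
of the Christoffel symbol contains exactly one odd factor. -/
theorem christoffel_neg (hT : ∀ x u v, S.T x u v = 0) (hF : ∀ u, S.F u = 0)
    {x : EuclideanSpace ℝ (Fin n)} (hx : x ∈ Metric.ball 0 R.r) (v u : EuclideanSpace ℝ (Fin n)) :
    R.christoffel (-x) v u = -R.christoffel x v u := by
  have hs : ∀ y ∈ Metric.ball 0 R.r, R.solder (-y) = R.solder y := fun y hy =>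
    ContinuousLinearMap.ext fun v => (R.form_neg hT hF hy v).1
  have ha : R.connForm (-x) v = -R.connForm x v :=
    (congrArg S.repDeriv (R.form_neg hT hF hx v).2).trans (map_neg _ _)
  have hd : fderiv ℝ R.solder (-x) v = -fderiv ℝ R.solder x v := by
    have h1 : HasFDerivAt (fun y => R.solder (-y)) _ x :=
      (R.differentiableAt_solder (R.neg_mem hx)).hasFDerivAt.comp x (hasFDerivAt_id x).neg
    have h2 := h1.unique ((R.differentiableAt_solder hx).hasFDerivAt.congr_of_eventuallyEq
      (Filter.eventually_of_mem (Metric.isOpen_ball.mem_nhds hx) hs))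
    rw [← h2]
    simp
  rw [christoffel, christoffel, coframeChristoffel, coframeChristoffel, hs x hx, ha, hd,
    ← map_neg]
  simp [add_comm]

end FramedChart.RadialGauge

theorem inducedConnectionLocallySymmetric (hT : ∀ x u v, S.T x u v = 0) (hF : ∀ u, S.F u = 0) :
    S.InducedConnectionLocallySymmetric := by
  intro c w₀ hw₀
  obtain ⟨R⟩ := c.nonempty_radialGauge hw₀
  exact ⟨R.symmetry, R.isGeodesicSymmetry,
    R.isAffine_symmetry fun x hx v u => R.christoffel_neg hT hF hx v u⟩

/-! ### Local symmetry implies that `T` and `F` vanish -/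

/-- The action of `g` on the coframe. -/
def coframeAction (S : GStructureWithConnection n EG G EP P) (g : G) :
    EuclideanSpace ℝ (Fin n) × EG →L[ℝ] EuclideanSpace ℝ (Fin n) × EG :=
  (S.rep g⁻¹).prodMap (GStr.Ad g⁻¹)

theorem pull_const_action {f : E → P} {z : E} (hf : MDifferentiableAt 𝓘(ℝ, E) 𝓘(ℝ, EP) f z)
    (g : G) : S.pull (fun y => op g • f y) z = (S.coframeAction g).comp (S.pull f z) := by
  ext1 v
  have h1 := S.pull_action (a := fun _ : E => g) hf mdifferentiableAt_const v
  have h2 : plainDeriv E EG (fun _ : E => g) z = 0 := mfderiv_const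
  rw [h2] at h1
  refine h1.trans (Prod.ext rfl ?_)
  change GStr.Ad g⁻¹ (S.pull f z v).2 + plainDeriv EG EG (fun k : G => g⁻¹ * k) g 0 = _
  rw [map_zero, add_zero]
  rfl

theorem plainDeriv_const_action_frame (g : G) (p : P) (u : EuclideanSpace ℝ (Fin n)) :
    plainDeriv EP EP (fun q : P => op g • q) p (S.frame p (u, 0))
      = S.frame (op g • p) (S.rep g⁻¹ u, 0) := by
  refine (S.coframe_bijective (op g • p)).1 ?_
  rw [S.coframe_frame]
  have h1 : S.coframe p (S.frame p (u, 0)) = (u, 0) := S.coframe_frame p _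
  exact Prod.ext ((S.θ_equivariant g p (S.frame p (u, 0))).trans
      (congrArg (S.rep g⁻¹) (congrArg Prod.fst h1)))
    ((S.conn_equivariant g p (S.frame p (u, 0))).trans
      ((congrArg (GStr.Ad g⁻¹) (congrArg Prod.snd h1)).trans (map_zero (GStr.Ad g⁻¹))))

theorem rep_inv_of_rep_eq_neg {g : G} (hg : ∀ u, S.rep g u = -u) (u : EuclideanSpace ℝ (Fin n)) :
    S.rep g⁻¹ u = -u := by
  have h1 := S.rep_inv_rep g (-u)
  rwa [hg, neg_neg] at h1

theorem structureFn_eq_of_h_eq {p q : P} (h : S.h p = S.h q)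
    (a b : EuclideanSpace ℝ (Fin n) × EG) : S.structureFn p a b = S.structureFn q a b :=
  congrArg (S.bracket (S.constSection a) (S.constSection b)).1 h

/-- If `-1 ∈ G` acts trivially on `X` at `p`, then `T` vanishes at `p`. -/
theorem T_eq_zero_of_rep_eq_neg {g : G} (hg : ∀ u, S.rep g u = -u) {p : P}
    (hp : S.h (op g • p) = S.h p) (u v : EuclideanSpace ℝ (Fin n)) : S.T (S.h p) u v = 0 := by
  obtain ⟨f, U, hU, hf, hinv, z, hz, rfl⟩ := S.exists_parametrization p
  have hmd : ∀ y ∈ U, MDifferentiableAt 𝓘(ℝ, EP) 𝓘(ℝ, EP) f y := fun y hy =>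
    (hf.contMDiffAt (hU.mem_nhds hy)).mdifferentiableAt (by simp)
  have hact : ContMDiffOn 𝓘(ℝ, EP) 𝓘(ℝ, EP) ∞ (fun y => op g • f y) U :=
    S.act_smooth.comp_contMDiffOn (hf.prodMk contMDiffOn_const)
  have hpull : S.pull (fun y => op g • f y) =ᶠ[nhds z]
      fun y => (S.coframeAction g).comp (S.pull f y) :=
    Filter.eventually_of_mem (hU.mem_nhds hz) fun y hy => S.pull_const_action (hmd y hy) g
  obtain ⟨ξ, hξ⟩ := (hinv z hz).surjective (u, 0)
  obtain ⟨η, hη⟩ := (hinv z hz).surjective (v, 0)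
  have h1 := S.formD_pull hU hf hz (-ξ) (-η)
  have h2 := S.formD_pull hU hact hz ξ η
  have hκ : DifferentiableAt ℝ (S.pull f) z :=
    ((S.contDiffOn_pull hU hf).contDiffAt (hU.mem_nhds hz)).differentiableAt (by simp)
  have h3 : formD (S.pull fun y => op g • f y) z ξ η
      = S.coframeAction g (formD (S.pull f) z ξ η) := by
    rw [← formD_const_comp _ hκ, formD, formD, hpull.fderiv_eq]
  have h4 : ∀ (ξ : EP) (u : EuclideanSpace ℝ (Fin n)), S.pull f z ξ = (u, 0) →
      S.pull (fun y => op g • f y) z ξ = (-u, 0) := by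
    intro ξ u hξ
    rw [hpull.eq_of_nhds, ContinuousLinearMap.comp_apply, hξ]
    exact Prod.ext (S.rep_inv_of_rep_eq_neg hg u) (map_zero (GStr.Ad g⁻¹))
  have h5 : formD (S.pull f) z (-ξ) (-η) = formD (S.pull f) z ξ η := by simp [formD]
  have hneg : ∀ (ξ : EP) (u : EuclideanSpace ℝ (Fin n)), S.pull f z ξ = (u, 0) →
      S.pull f z (-ξ) = (-u, 0) := fun ξ u hξ => by rw [map_neg, hξ]; simp
  rw [h5, hneg ξ u hξ, hneg η v hη] at h1
  rw [h3, h1, h4 ξ u hξ, h4 η v hη, map_neg, neg_inj] at h2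
  have h6 : S.rep g⁻¹ (S.structureFn (f z) (-u, 0) (-v, 0)).1
      = (S.structureFn (op g • f z) (-u, 0) (-v, 0)).1 := congrArg Prod.fst h2
  -- Equivariance relates the structure functions at `p · g` and `p` by `-1`, while `hp` says that
  -- they are equal. The arguments `(-u, -v)` give the same value as `(u, v)`, as `h5` records for
  -- `formD`.
  rw [S.structureFn_eq_of_h_eq hp, S.rep_inv_of_rep_eq_neg hg] at h6
  have h8 := add_eq_zero_iff_eq_neg.2 h6.symm
  rw [← two_smul ℝ, smul_eq_zero_iff_right two_ne_zero] at h8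
  have h7 := S.formD_pull hU hf hz ξ η
  rw [h1, neg_inj, hξ, hη] at h7
  exact neg_eq_zero.2 ((congrArg Prod.fst h7).symm.trans h8)

/-- If `-1 ∈ G` acts trivially on `X`, then `F = 0`. -/
theorem F_eq_zero_of_rep_eq_neg {g : G} (hg : ∀ u, S.rep g u = -u)
    (hh : ∀ p, S.h (op g • p) = S.h p) (u : EuclideanSpace ℝ (Fin n)) : S.F u = 0 := by
  refine Derivation.ext fun f => Subtype.ext <| S.ext_h fun p => ?_
  let f' : P → ℝ := fun q => f.1 (S.h q)
  have hf : MDifferentiable 𝓘(ℝ, EP) 𝓘(ℝ, ℝ) f' := S.mdifferentiable_comp_h f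
  have h1 := plainDeriv_comp EP EP (hf (op g • p)) (S.mdifferentiable_action_left g p) rfl
  -- An identity of functions is needed in order to differentiate it, hence the hypothesis that `g`
  -- preserves `h` at every point and not only at `p`.
  have h2 : f' ∘ (fun q : P => op g • q) = f' := funext fun q => congrArg f.1 (hh q)
  rw [h2] at h1
  have h3 := congrArg (fun L : EP →L[ℝ] ℝ => L (S.frame p (u, 0))) h1
  have h4 : plainDeriv EP ℝ f' p (S.frame p (u, 0)) = plainDeriv EP ℝ f' (op g • p)
      (S.frame (op g • p) (-u, 0)) := by
    rw [← S.rep_inv_of_rep_eq_neg hg, ← S.plainDeriv_const_action_frame]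
    exact h3
  have h5 : S.frame (op g • p) (-u, 0) = -S.frame (op g • p) (u, 0) := by
    rw [← map_neg]
    simp
  -- The derivative of `f'` along the frame field of `(u, 0)` itself descends to `X`, so it agrees
  -- at `p` and `p · g`. By `h4` and `h5` these two values are also opposite.
  have h6 : plainDeriv EP ℝ f' (op g • p) (S.frame (op g • p) (u, 0))
      = plainDeriv EP ℝ f' p (S.frame p (u, 0)) :=
    congrArg (S.anchorFun (S.constSection (u, 0)) f).1 (hh p)
  have h7 : plainDeriv EP ℝ f' (op g • p) (-S.frame (op g • p) (u, 0))
      = -plainDeriv EP ℝ f' (op g • p) (S.frame (op g • p) (u, 0)) :=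
    map_neg (plainDeriv EP ℝ f' (op g • p)) (S.frame (op g • p) (u, 0))
  rw [h5, h7, h6, self_eq_neg] at h4
  exact h4

/-- A geodesic symmetry at `w₀` fixes `w₀`, and its derivative there is `-1`. -/
theorem FramedChart.IsGeodesicSymmetry.eq_and_fderiv {S : GStructureWithConnection n EG G EP P}
    {c : S.FramedChart} {w₀ : EuclideanSpace ℝ (Fin n)}
    {s : OpenPartialHomeomorph (EuclideanSpace ℝ (Fin n)) (EuclideanSpace ℝ (Fin n))}
    (hs : c.IsGeodesicSymmetry w₀ s) : s w₀ = w₀ ∧ ∀ v, fderiv ℝ s w₀ v = -v := by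
  have hw₀ : w₀ ∈ c.dom := hs.source_subset hs.mem_source
  obtain ⟨R⟩ := c.nonempty_radialGauge hw₀
  have key : ∀ u : EuclideanSpace ℝ (Fin n),
      ∀ᶠ t : ℝ in nhds 0, s (R.coord (t • u)) = R.coord ((-t) • u) := by
    intro u
    have h0 : (0 : ℝ) • u ∈ Metric.ball 0 R.r := by rw [zero_smul]; exact R.zero_mem
    have hc : ContinuousAt (fun t : ℝ => t • u) 0 := by fun_prop
    have hc' : ContinuousAt (fun t : ℝ => R.coord (t • u)) 0 :=
      R.hasDerivAt_coord_smul.continuousAt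
    have hsrc : R.coord ((0 : ℝ) • u) ∈ s.source := by
      rw [zero_smul, R.coord_zero]
      exact hs.mem_source
    have hev : ∀ᶠ t : ℝ in nhds 0, t • u ∈ Metric.ball 0 R.r ∧ R.coord (t • u) ∈ s.source :=
      (hc.eventually (Metric.isOpen_ball.mem_nhds h0)).and
        (hc'.eventually (s.open_source.mem_nhds hsrc))
    obtain ⟨ε, hε, hball⟩ := Metric.eventually_nhds_iff_ball.1 hev
    rw [Real.ball_eq_Ioo, zero_sub, zero_add] at hball
    have h1 := hs.reverses ε _ hε (R.isGeodesic u fun t ht => (hball t ht).1)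
      (by rw [zero_smul, R.coord_zero]) fun t ht => (hball t ht).2
    exact Filter.eventually_of_mem (Ioo_mem_nhds (neg_lt_zero.2 hε) hε) h1
  -- The ray in the direction `0` is the constant geodesic at `w₀`.
  have hfix : s w₀ = w₀ := by
    have h1 := (key 0).self_of_nhds
    rwa [smul_zero, smul_zero, R.coord_zero] at h1
  refine ⟨hfix, fun v => ?_⟩
  obtain ⟨u, rfl⟩ := (R.isInvertible_fderiv 0 R.zero_mem).surjective v
  have hsd : HasFDerivAt s (fderiv ℝ s w₀) (R.coord ((0 : ℝ) • u)) := by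
    rw [zero_smul, R.coord_zero]
    exact ((hs.smooth.contDiffAt (s.open_source.mem_nhds hs.mem_source)).differentiableAt
      (by simp)).hasFDerivAt
  have h1 : HasDerivAt (fun t : ℝ => s (R.coord (t • u))) _ 0 :=
    hsd.comp_hasDerivAt 0 R.hasDerivAt_coord_smul
  have h2 : HasDerivAt (fun t : ℝ => R.coord (t • u)) (fderiv ℝ R.coord 0 u) (-0) := by
    rw [neg_zero]
    exact R.hasDerivAt_coord_smul
  have h3 : HasDerivAt (fun t : ℝ => R.coord ((-t) • u)) _ 0 :=
    h2.scomp (0 : ℝ) (hasDerivAt_neg (0 : ℝ))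
  have h4 := h1.unique (h3.congr_of_eventuallyEq (key u))
  simpa using h4

/-- The structure group of a locally symmetric `G`-structure contains `-1`, which acts trivially on
the classifying space. -/
theorem LocallySymmetric.exists_rep_eq_neg {S : GStructureWithConnection n EG G EP P}
    (hS : S.LocallySymmetric) (p : P) :
    ∃ g : G, (∀ u, S.rep g u = -u) ∧ S.h (op g • p) = S.h p := by
  obtain ⟨c, w₀, hw₀, rfl, s, hs, Φ, hΦ, a, ha, hΦa⟩ := hS p
  obtain ⟨hfix, hds⟩ := hs.eq_and_fderiv
  have hΦp := hΦa w₀ hs.mem_source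
  rw [hfix] at hΦp
  refine ⟨a w₀, fun u => ?_, ?_⟩
  · obtain ⟨v, rfl⟩ := (c.isInvertible_solder hw₀).surjective u
    have hnhds := s.open_source.mem_nhds hs.mem_source
    have hσ : MDifferentiableAt 𝓘(ℝ, EuclideanSpace ℝ (Fin n)) 𝓘(ℝ, EP) c.σ w₀ :=
      (c.smooth.contMDiffAt (c.isOpen_dom.mem_nhds hw₀)).mdifferentiableAt (by simp)
    have hsd : DifferentiableAt ℝ s w₀ :=
      (hs.smooth.contDiffAt hnhds).differentiableAt (by simp)
    have hσ' : MDifferentiableAt 𝓘(ℝ, EuclideanSpace ℝ (Fin n)) 𝓘(ℝ, EP) c.σ (s w₀) := by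
      rwa [hfix]
    -- `Φ ∘ σ` is `σ ∘ s` moved by `a`, and `Φ` preserves `θ`. Hence `ρ(a w₀)` maps `σ^*θ (v)` to
    -- `σ^*θ (ds v) = -σ^*θ (v)`, and `σ^*θ` is onto at `w₀`.
    have h1 := S.rep_pull_action_fst (s := c.σ ∘ s) (a := a) (z := w₀)
      (hσ'.comp w₀ hsd.mdifferentiableAt)
      ((ha.contMDiffAt hnhds).mdifferentiableAt (by simp)) v
    have h2 : Φ ∘ c.σ =ᶠ[nhds w₀] fun y => op (a y) • (c.σ ∘ s) y :=
      Filter.eventually_of_mem hnhds fun y hy => (hΦa y hy).2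
    have h3 : S.pull (Φ ∘ c.σ) w₀ v = S.pull c.σ w₀ v := by
      have h4 := mfderiv_comp_apply w₀ (hΦ.mdifferentiableAt hΦp.1) hσ v
      rw [pull_apply, h4]
      exact hΦ.coframe hΦp.1 _
    rw [← S.pull_congr h2, h3, S.pull_comp hσ' hsd, ContinuousLinearMap.comp_apply, hds, hfix,
      map_neg] at h1
    exact h1
  · rw [← hΦp.2]
    exact S.h_eq hΦ hΦp.1

/-- The element supplied by `exists_rep_eq_neg` could depend on the point, but injectivity of `ρ`
allows only one element acting as `-1`. So a single `g` preserves `h` on all of `P`. -/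
theorem LocallySymmetric.h_action {S : GStructureWithConnection n EG G EP P}
    (hS : S.LocallySymmetric) {g : G} (hg : ∀ u, S.rep g u = -u) (p : P) :
    S.h (op g • p) = S.h p := by
  obtain ⟨k, hk, hp⟩ := hS.exists_rep_eq_neg p
  have h1 : S.ρ k = S.ρ g := Units.ext <| ContinuousLinearMap.ext fun u =>
    (hk u).trans (hg u).symm
  rwa [S.ρ_closed.injective h1] at hp

theorem LocallySymmetric.T_eq_zero {S : GStructureWithConnection n EG G EP P}
    (hS : S.LocallySymmetric) (x : S.ClassifyingSpace) (u v : EuclideanSpace ℝ (Fin n)) :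
    S.T x u v = 0 :=
  Quotient.inductionOn x fun p =>
    have ⟨_, hg, hp⟩ := hS.exists_rep_eq_neg p
    S.T_eq_zero_of_rep_eq_neg hg hp u v

theorem LocallySymmetric.F_eq_zero {S : GStructureWithConnection n EG G EP P}
    (hS : S.LocallySymmetric) (u : EuclideanSpace ℝ (Fin n)) : S.F u = 0 := by
  -- Without a point of `P` there is nothing to produce `-1 ∈ G`, but then `X` is empty as well.
  rcases isEmpty_or_nonempty P with hP | ⟨⟨p⟩⟩
  · exact Derivation.ext fun f => Subtype.ext <| S.ext_h fun p => (hP.false p).elim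
  · obtain ⟨g, hg, -⟩ := hS.exists_rep_eq_neg p
    exact S.F_eq_zero_of_rep_eq_neg hg (hS.h_action hg) u

end GStructureWithConnection

end

theorem mainTheorem5 {n : ℕ}
    {EG : Type*} [NormedAddCommGroup EG] [NormedSpace ℝ EG] [FiniteDimensional ℝ EG]
    {G : Type*} [TopologicalSpace G] [ChartedSpace EG G] [Group G] [LieGroup 𝓘(ℝ, EG) ∞ G]
    {EP : Type*} [NormedAddCommGroup EP] [NormedSpace ℝ EP] [FiniteDimensional ℝ EP]
    {P : Type*} [TopologicalSpace P] [T2Space P] [SecondCountableTopology P]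
    [ChartedSpace EP P] [IsManifold 𝓘(ℝ, EP) ∞ P] [MulAction Gᵐᵒᵖ P]
    (S : GStructureWithConnection n EG G EP P) :
    (S.LocallySymmetric → (∀ x u v, S.T x u v = 0) ∧ (∀ u, S.F u = 0)) ∧
    ((∀ x u v, S.T x u v = 0) ∧ (∀ u, S.F u = 0) → S.InducedConnectionLocallySymmetric) := by
  exact ⟨fun h => ⟨h.T_eq_zero, h.F_eq_zero⟩,
    fun h => S.inducedConnectionLocallySymmetric h.1 h.2⟩
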